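/- Let $n\ge 2$. Let $Q^{2n-1}\subset\mathbb P^{2n}_{\mathbb C}$ be the smooth quadric $x_0x_{n+1}+\dots+x_{n-1}x_{2n}+x_n^2=0$, and let $H_n=\mathbb C^*$ act on it by $$t\cdot[x_0:\dots:x_{2n}]=[t x_0:\dots:t x_{n-1}:x_n:t^{-1}x_{n+1}:\dots:t^{-1}x_{2n}].$$ Put $\mathbb P^{n-1}_-=\{x_n=\dots=x_{2n}=0\}$ and $\mathbb P^{n-1}_+=\{x_0=\dots=x_n=0\}$; both lie on $Q^{2n-1}$. Let $X=G(\mathbb P^1,Q^{2n-1})$ be the variety of lines contained in $Q^{2n-1}$, a closed subvariety of $\mathbb P(\bigwedge^2\mathbb C^{2n+1})$ by the Plücker embedding, with the induced $H_n$-action, and let $Y_\pm=G(\mathbb P^1,\mathbb P^{n-1}_\pm)$ be the variety of lines contained in $\mathbb P^{n-1}_\pm$. Then: 1. The fixed locus is a disjoint union $$X^{H_n}=Y_-\sqcup Y_0\sqcup Y_+,$$ where $Y_0$ is the set of lines contained in $Q^{2n-1}$ that meet both $\mathbb P^{n-1}_-$ and $\mathbb P^{n-1}_+$. The variety $Y_0$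 is isomorphic to $\mathbb P(T_{\mathbb P^{n-1}})$, the variety of pairs consisting of a point of $\mathbb P^{n-1}$ and a hyperplane of the tangent space at that point. The sets $Y_-$, $Y_0$, $Y_+$ are exactly the irreducible components of $X^{H_n}$. 2. $Y_-$ is the sink and $Y_+$ is the source of the action: the set of $x\in X$ with $\lim_{t\to\infty}t\cdot x\in Y_-$ and the set of $x\in X$ with $\lim_{t\to 0}t\cdot x\in Y_+$ are both open and dense in $X$. 3. The action has criticality $2$: for every very ample line bundle $L$ on $X$ with an $H_n$-linearization, given by an equivariant embedding $\iota$ of $X$ into the projective space of lines of a finite-dimensional rational representation of $\mathbb C^*$ with $L=\iota^*\mathcal O(1)$, the weights $\mu_L(Y)$ of $\mathbb C^*$ on the fibres of $L$ over the components $Y$ of $X^{H_n}$ take exactly three values $a_0<a_1<a_2$. (Passing from $L$ to $L^{\otimes m}$, $m>0$, multiplies the weights by $m$, so the same holds for ample $L$.) 4. For $L=\mathcal O_X(1)$, the restriction of $\mathcal O(1)$ under the Plücker embedding, with its natural linearization, $\mu_L(Y_-)=-2$, $\mu_L(Y_0)=0$ and $\mu_L(Y_+)=2$; in particular the bandwidth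 $\max\mu_L-\min\mu_L$ of the action on $(X,L)$ is $4$. -/

import Mathlib

open scoped LinearAlgebra.Projectivization TensorProduct Topology

noncomputable section

namespace QuadricLines

/-! ### Spaces with functions, projective varieties, morphisms -/

/-- A space with `ℂ`-valued functions: a topology and, at each point, the functions that are
regular at (that is, on a neighbourhood of) that point. -/
@[ext]
class FunctionSpace (X : Type*) extends TopologicalSpace X where
  /-- `regularAt f x`: the function `f` is regular near `x`. -/
  regularAt : (X → ℂ) → X → Prop

/-- A morphism: a continuous map pulling back regular functions to regular functions. -/
structure IsMorphism {X Y : Type*} [FunctionSpace X] [FunctionSpace Y] (f : X → Y) : Prop where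
  continuous : Continuous f
  pullback : ∀ (g : Y → ℂ) (x : X),
    FunctionSpace.regularAt g (f x) → FunctionSpace.regularAt (g ∘ f) x

/-- An isomorphism of varieties. -/
structure VarietyIso (X Y : Type*) [FunctionSpace X] [FunctionSpace Y] where
  /-- the underlying bijection -/
  toEquiv : X ≃ Y
  isMorphism_toFun : IsMorphism toEquiv
  isMorphism_invFun : IsMorphism toEquiv.symm

/-- The structure of (reduced) subvariety induced by an injection `e`: the induced topology, and
the functions which locally are restrictions of regular functions. -/
abbrev FunctionSpace.induced {X Y : Type*} (e : X → Y) (S : FunctionSpace Y) :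
    FunctionSpace X where
  toTopologicalSpace := TopologicalSpace.induced e S.toTopologicalSpace
  regularAt f x := ∃ g : Y → ℂ, S.regularAt g (e x) ∧
    ∀ᶠ x' in @nhds X (TopologicalSpace.induced e S.toTopologicalSpace) x, f x' = g (e x')

theorem FunctionSpace.induced_induced {X Y Z : Type*} (e : X → Y) (e' : Y → Z)
    (S : FunctionSpace Z) : FunctionSpace.induced e (FunctionSpace.induced e' S) =
      FunctionSpace.induced (fun x => e' (e x)) S := by
  have ht : TopologicalSpace.induced e (TopologicalSpace.induced e' S.toTopologicalSpace) =
      TopologicalSpace.induced (fun x => e' (e x)) S.toTopologicalSpace := induced_compose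
  refine FunctionSpace.ext (congrArg (fun t => t.IsOpen) ht) ?_
  funext f x
  refine propext ⟨?_, ?_⟩
  · rintro ⟨g, ⟨k, hk, hgk⟩, hfg⟩
    refine ⟨k, hk, ?_⟩
    rw [← ht]
    have hc := @Continuous.tendsto X Y (TopologicalSpace.induced e
      (TopologicalSpace.induced e' S.toTopologicalSpace))
      (TopologicalSpace.induced e' S.toTopologicalSpace) e continuous_induced_dom x
    filter_upwards [hfg, hc.eventually hgk] with x' h1 h2
    rw [h1, h2]
  · rintro ⟨k, hk, hfk⟩
    rw [← ht] at hfk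
    exact ⟨fun y => k (e' y), ⟨k, hk, Filter.Eventually.of_forall fun _ => rfl⟩, hfk⟩

/-- A subset of a variety is equipped with the induced structure. -/
instance {X : Type*} [S : FunctionSpace X] (s : Set X) : FunctionSpace s :=
  FunctionSpace.induced (fun x : s => (x : X)) S

section Projective

variable {E F : Type*} [AddCommGroup E] [Module ℂ E] [AddCommGroup F] [Module ℂ F]

/-- Polynomial functions on a vector space, as polynomials in the linear forms. -/
def polyEval (P : MvPolynomial (Module.Dual ℂ E) ℂ) (v : E) : ℂ :=
  MvPolynomial.eval (fun φ : Module.Dual ℂ E => φ v) P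

/-- The Zariski topology on a projective space (generated by the complements of the
hypersurfaces), with the functions that locally are quotients of homogeneous polynomials of the
same degree. -/
instance : FunctionSpace (ℙ ℂ E) where
  toTopologicalSpace := TopologicalSpace.generateFrom
    {U | ∃ (d : ℕ) (P : MvPolynomial (Module.Dual ℂ E) ℂ), P.IsHomogeneous d ∧
      U = {x : ℙ ℂ E | polyEval P x.rep ≠ 0}}
  regularAt f x := ∃ (d : ℕ) (P Q : MvPolynomial (Module.Dual ℂ E) ℂ),
    P.IsHomogeneous d ∧ Q.IsHomogeneous d ∧ polyEval Q x.rep ≠ 0 ∧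
    ∀ y : ℙ ℂ E, polyEval Q y.rep ≠ 0 → f y = polyEval P y.rep / polyEval Q y.rep

theorem exists_dual_ne {v : E} (hv : v ≠ 0) : ∃ f : Module.Dual ℂ E, f v ≠ 0 := by
  by_contra! h
  exact hv ((Module.forall_dual_apply_eq_zero_iff ℂ v).1 h)

theorem tmul_rep_ne_zero (x : ℙ ℂ E) (y : ℙ ℂ F) : x.rep ⊗ₜ[ℂ] y.rep ≠ 0 := by
  intro h
  obtain ⟨f, hf⟩ := exists_dual_ne x.rep_nonzero
  obtain ⟨g, hg⟩ := exists_dual_ne y.rep_nonzero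
  have h2 := congrArg (LinearMap.mul' ℂ ℂ) (congrArg (TensorProduct.map f g) h)
  simp at h2
  exact h2.elim hf hg

/-- The Segre embedding `ℙ(E) × ℙ(F) → ℙ(E ⊗ F)`. -/
def segre (x : ℙ ℂ E) (y : ℙ ℂ F) : ℙ ℂ (E ⊗[ℂ] F) :=
  Projectivization.mk ℂ (x.rep ⊗ₜ[ℂ] y.rep) (tmul_rep_ne_zero x y)

end Projective

/-! ### The projectivised tangent bundle of a projective space -/

section Tangent

variable (V : Type*) [AddCommGroup V] [Module ℂ V]

/-- The tangent space `Hom(p, V / p)` of the projective space of lines of `V` at `p`. -/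
abbrev TangentAt {V : Type*} [AddCommGroup V] [Module ℂ V] (p : ℙ ℂ V) : Type _ :=
  p.submodule →ₗ[ℂ] (V ⧸ p.submodule)

/-- The points of `P(T)`, for `T` the tangent bundle of `ℙ(V)`: a point `p` of `ℙ(V)`, and a
hyperplane of (a nonzero linear form up to scalars on) the tangent space at `p`.  This is
`P(T) = Proj (Sym T)`, the variety of one-dimensional quotients of the fibres of `T`. -/
structure ProjTangent where
  /-- the point of the projective space -/
  pt : ℙ ℂ V
  /-- the hyperplane of the tangent space at that point -/
  hyp : ℙ ℂ (Module.Dual ℂ (TangentAt pt))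

variable {V}

/-- The coordinate on the line `p` dual to the generator `p.rep`. -/
def lineCoord (p : ℙ ℂ V) : p.submodule ≃ₗ[ℂ] ℂ :=
  (LinearEquiv.ofEq _ _ p.submodule_eq).trans
    (LinearEquiv.toSpanNonzeroSingleton ℂ V p.rep p.rep_nonzero).symm

/-- The Euler surjection `V ⊗ 𝒪(1) → T` in the fibre over `p`, where the fibre of `𝒪(1)`, the
dual of the line `p`, is trivialised by `p.rep`: a vector `w` goes to the tangent vector
`p.rep ↦ w mod p`. -/
def eulerMap (p : ℙ ℂ V) : V →ₗ[ℂ] TangentAt p :=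
  (LinearMap.smulRightₗ (lineCoord p).toLinearMap).comp p.submodule.mkQ

theorem eulerMap_surjective (p : ℙ ℂ V) : Function.Surjective (eulerMap p) := by
  intro φ
  obtain ⟨w, hw⟩ := p.submodule.mkQ_surjective (φ ((lineCoord p).symm 1))
  refine ⟨w, LinearMap.ext fun x => ?_⟩
  have hx : x = lineCoord p x • (lineCoord p).symm 1 := by
    rw [← map_smul, smul_eq_mul, mul_one, LinearEquiv.symm_apply_apply]
  conv_rhs => rw [hx, map_smul, ← hw]
  rfl

/-- The closed embedding `P(T) → ℙ(V) × ℙ(V^∨)` given by the Euler surjection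
`V ⊗ 𝒪(1) → T`, followed by the Segre embedding. -/
def ProjTangent.embed (x : ProjTangent V) : ℙ ℂ (V ⊗[ℂ] Module.Dual ℂ V) :=
  segre x.pt (Projectivization.map (eulerMap x.pt).dualMap
    (LinearMap.dualMap_injective_of_surjective (eulerMap_surjective x.pt)) x.hyp)

instance : FunctionSpace (ProjTangent V) := FunctionSpace.induced ProjTangent.embed inferInstance

/-! ### Grassmannians of lines -/

variable (V) in
/-- The Grassmannian of lines of `ℙ(V)`, that is, of two-dimensional subspaces of `V`. -/
@[ext]
structure LineGrassmannian where
  /-- the two-dimensional subspace whose projectivisation is the line -/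
  space : Submodule ℂ V
  finrank_eq : Module.finrank ℂ space = 2

theorem finrank_exteriorSquare_range (W : LineGrassmannian V) :
    Module.finrank ℂ (LinearMap.range (exteriorPower.map 2 W.1.subtype)) = 1 := by
  have : Module.Finite ℂ W.1 := Module.finite_of_finrank_pos (by rw [W.2]; norm_num)
  rw [LinearMap.finrank_range_of_inj (exteriorPower.map_injective_field W.1.injective_subtype),
    exteriorPower.finrank_eq, W.2]
  rfl

/-- If `⋀² W = ⋀² W'` then `W ⊆ W'`. -/
theorem le_of_exteriorSquare_eq (W W' : LineGrassmannian V)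
    (h : LinearMap.range (exteriorPower.map 2 W.1.subtype) =
      LinearMap.range (exteriorPower.map 2 W'.1.subtype)) : W.1 ≤ W'.1 := by
  intro u hu
  by_contra hu'
  obtain ⟨φ, hφu, hφ⟩ := Submodule.exists_dual_map_eq_bot_of_notMem (p := W'.1) hu' inferInstance
  have hφ' : ∀ x ∈ W'.1, φ x = 0 := fun x hx =>
    (Submodule.mem_bot ℂ).1 (hφ ▸ Submodule.mem_map_of_mem hx)
  obtain ⟨w, hw, hwu⟩ : ∃ w ∈ W.1, w ∉ Submodule.span ℂ {u} := by
    by_contra! hc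
    have h1 := Submodule.finrank_mono (R := ℂ) (s := W.1) (t := Submodule.span ℂ {u}) hc
    have h2 := finrank_span_finset_le_card (R := ℂ) ({u} : Finset V)
    rw [Finset.coe_singleton, Finset.card_singleton, Set.finrank] at h2
    have h3 := W.2
    omega
  set w' := w - (φ w / φ u) • u with hw'
  have hw'0 : w' ≠ 0 := by
    intro h0
    apply hwu
    rw [sub_eq_zero.1 h0]
    exact Submodule.smul_mem _ _ (Submodule.mem_span_singleton_self u)
  have hw'W : w' ∈ W.1 := W.1.sub_mem hw (W.1.smul_mem _ hu)
  have hφw' : φ w' = 0 := by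
    simp [hw', div_mul_cancel₀ _ hφu]
  obtain ⟨ψ, hψ⟩ := exists_dual_ne hw'0
  let D : V [⋀^Fin 2]→ₗ[ℂ] ℂ :=
    (Matrix.detRowAlternating (R := ℂ) (n := Fin 2)).compLinearMap (LinearMap.pi ![φ, ψ])
  have hD : ∀ a : Fin 2 → V, D a = φ (a 0) * ψ (a 1) - ψ (a 0) * φ (a 1) := by
    intro a
    change Matrix.det (Matrix.of fun i => LinearMap.pi ![φ, ψ] (a i)) = _
    rw [Matrix.det_fin_two]
    rfl
  have hz : (exteriorPower.alternatingMapLinearEquiv D).comp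
      (exteriorPower.map 2 W'.1.subtype) = 0 := by
    apply exteriorPower.linearMap_ext
    ext a
    simp [exteriorPower.map_apply_ιMulti, hD, hφ']
  have hm : exteriorPower.ιMulti ℂ 2 ![u, w'] ∈
      LinearMap.range (exteriorPower.map 2 W.1.subtype) := by
    refine ⟨exteriorPower.ιMulti ℂ 2 ![⟨u, hu⟩, ⟨w', hw'W⟩], ?_⟩
    rw [exteriorPower.map_apply_ιMulti]
    congr 1
    ext i
    fin_cases i <;> rfl
  rw [h] at hm
  obtain ⟨y, hy⟩ := hm
  have h5 := LinearMap.congr_fun hz y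
  rw [LinearMap.comp_apply, hy, exteriorPower.alternatingMapLinearEquiv_apply_ιMulti, hD] at h5
  simp [hφw', hφu, hψ] at h5

/-- The Plücker embedding: `W ↦ ⋀² W ⊆ ⋀² V`. -/
def plucker (W : LineGrassmannian V) : ℙ ℂ (⋀[ℂ]^2 V) :=
  Projectivization.mk'' (LinearMap.range (exteriorPower.map 2 W.1.subtype))
    (finrank_exteriorSquare_range W)

theorem plucker_injective : Function.Injective (plucker : LineGrassmannian V → _) := by
  intro W W' h
  have h' := congrArg Projectivization.submodule h
  simp only [plucker, Projectivization.submodule_mk''] at h'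
  exact LineGrassmannian.ext (le_antisymm (le_of_exteriorSquare_eq W W' h')
    (le_of_exteriorSquare_eq W' W h'.symm))

instance : FunctionSpace (LineGrassmannian V) := FunctionSpace.induced plucker inferInstance

/-- `G(ℙ¹, ℙ(U))`: the lines of `ℙ(V)` contained in the linear subspace `ℙ(U)`. -/
def linesIn (U : Submodule ℂ V) : Set (LineGrassmannian V) := {W | W.1 ≤ U}

end Tangent

/-! ### Actions of the multiplicative group -/

section Action

variable {X : Type*} [FunctionSpace X] [MulAction ℂˣ X]

variable (X) in
/-- The irreducible components of the fixed locus. -/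
def fixedComponents : Set (Set X) :=
  {Y | Maximal (fun s : Set X => s ⊆ MulAction.fixedPoints ℂˣ X ∧ IsIrreducible s) Y}

/-- The point `[a : b]` of `ℙ¹`. -/
def pointP1 (a b : ℂ) (h : (![a, b] : Fin 2 → ℂ) ≠ 0) : ℙ ℂ (Fin 2 → ℂ) :=
  Projectivization.mk ℂ ![a, b] h

/-- `γ : ℙ¹ → X` is the extension of the orbit map `t ↦ t • x`; here `t` is the point `[1 : t]`. -/
def ExtendsOrbit (x : X) (γ : ℙ ℂ (Fin 2 → ℂ) → X) : Prop :=
  IsMorphism γ ∧ ∀ t : ℂˣ, γ (pointP1 1 t (by simp)) = t • x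

/-- `lim_{t → 0} t • x = y`. -/
def IsLimitAtZero (x y : X) : Prop :=
  ∃ γ : ℙ ℂ (Fin 2 → ℂ) → X, ExtendsOrbit x γ ∧ γ (pointP1 1 0 (by simp)) = y

/-- `lim_{t → ∞} t • x = y`. -/
def IsLimitAtInfty (x y : X) : Prop :=
  ∃ γ : ℙ ℂ (Fin 2 → ℂ) → X, ExtendsOrbit x γ ∧ γ (pointP1 0 1 (by simp)) = y

/-- The Białynicki-Birula cell `X⁺(Y)`: the points whose limit at `0` lies in `Y`. -/
def cellPlus (Y : Set X) : Set X := {x | ∃ y ∈ Y, IsLimitAtZero x y}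

/-- The Białynicki-Birula cell `X⁻(Y)`: the points whose limit at `∞` lies in `Y`. -/
def cellMinus (Y : Set X) : Set X := {x | ∃ y ∈ Y, IsLimitAtInfty x y}

/-- The source: the fixed component `Y` with `X⁺(Y)` open and dense. -/
def IsSource (Y : Set X) : Prop :=
  Y ∈ fixedComponents X ∧ IsOpen (cellPlus Y) ∧ Dense (cellPlus Y)

/-- The sink: the fixed component `Y` with `X⁻(Y)` open and dense. -/
def IsSink (Y : Set X) : Prop :=
  Y ∈ fixedComponents X ∧ IsOpen (cellMinus Y) ∧ Dense (cellMinus Y)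

/-- A representation of `ℂ*` is rational (algebraic) if it is spanned by the vectors on which `t`
acts by an integral power of `t`. -/
def IsRational {E : Type*} [AddCommGroup E] [Module ℂ E] (ρ : Representation ℂ ℂˣ E) : Prop :=
  Submodule.span ℂ {v : E | ∃ k : ℤ, ∀ t : ℂˣ, ρ t v = ((t ^ k : ℂˣ) : ℂ) • v} = ⊤

/-- The action on `ℙ(E)` of a representation on `E`. -/
def projAct {E : Type*} [AddCommGroup E] [Module ℂ E] (ρ : Representation ℂ ℂˣ E) (t : ℂˣ) :
    ℙ ℂ E → ℙ ℂ E :=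
  Projectivization.map (ρ t) (ρ.apply_bijective t).1

variable (X) in
/-- A linearized very ample line bundle `L = ι^* 𝒪(1)` on `X`, given as an equivariant embedding
`ι` of `X` into the projective space of a finite-dimensional rational representation `E`. The
fibre of `L` at `x` is the dual of the line `ι x` of `E`. -/
structure LinearizedEmbedding (E : Type*) [AddCommGroup E] [Module ℂ E]
    [FiniteDimensional ℂ E] where
  /-- the representation of `ℂ*` -/
  rep : Representation ℂ ℂˣ E
  rational : IsRational rep
  /-- the embedding -/
  toFun : X → ℙ ℂ E
  injective : Function.Injective toFun
  embedding : (inferInstance : FunctionSpace X) = FunctionSpace.induced toFun inferInstance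
  equivariant : ∀ (t : ℂˣ) (x : X), toFun (t • x) = projAct rep t (toFun x)

namespace LinearizedEmbedding

variable {E : Type*} [AddCommGroup E] [Module ℂ E] [FiniteDimensional ℂ E]

/-- `μ_L(Y) = k`: at every point `x` of `Y`, `ℂ*` acts on the fibre of `L` at `x`, the dual of the
line `ι x`, with weight `k`, that is, on the line `ι x` with weight `-k`. -/
def HasWeight (L : LinearizedEmbedding X E) (Y : Set X) (k : ℤ) : Prop :=
  ∀ x ∈ Y, ∀ v ∈ (L.toFun x).submodule, ∀ t : ℂˣ, L.rep t v = ((t ^ (-k) : ℂˣ) : ℂ) • v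

/-- The set of values `μ_L(Y)`, for `Y` a fixed point component. -/
def weights (L : LinearizedEmbedding X E) : Set ℤ :=
  {k | ∃ Y ∈ fixedComponents X, L.HasWeight Y k}

/-- The criticality is `r`: the weights form a chain `a₀ < a₁ < … < a_r`. -/
def HasCriticality (L : LinearizedEmbedding X E) (r : ℕ) : Prop :=
  ∃ a : Fin (r + 1) → ℤ, StrictMono a ∧ Set.range a = L.weights

/-- The bandwidth: the difference between the maximal and the minimal weight. -/
def HasBandwidth (L : LinearizedEmbedding X E) (b : ℤ) : Prop :=
  ∃ m M : ℤ, IsLeast L.weights m ∧ IsGreatest L.weights M ∧ b = M - m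

end LinearizedEmbedding

end Action

/-! ### The quadric, its lines, and the action of `H_n` -/

section Quadric

variable (n : ℕ)

/-- The space `ℂ^(2n+1)` with coordinates `x_0, …, x_{2n}`. -/
abbrev Coord : Type := Fin (2 * n + 1) → ℂ

/-- The equation `x_0 x_{n+1} + … + x_{n-1} x_{2n} + x_n²` of `Q^{2n-1}`. -/
def quadric (x : Coord n) : ℂ :=
  ∑ i : Fin n, x ⟨i, by omega⟩ * x ⟨n + 1 + i, by omega⟩ + x ⟨n, by omega⟩ ^ 2

/-- The weight of `H_n` on the `i`-th coordinate. -/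
def coordWeight (i : Fin (2 * n + 1)) : ℤ :=
  if (i : ℕ) < n then 1 else if (i : ℕ) = n then 0 else -1

/-- The linear action of `t ∈ H_n = ℂ*` on `ℂ^(2n+1)`:
`(t x_0, …, t x_{n-1}, x_n, t⁻¹ x_{n+1}, …, t⁻¹ x_{2n})`. -/
def hRep : Representation ℂ ℂˣ (Coord n) where
  toFun t := LinearMap.pi fun i => ((t ^ coordWeight n i : ℂˣ) : ℂ) • LinearMap.proj i
  map_one' := by ext; simp
  map_mul' s t := by
    ext
    simp [mul_zpow, mul_assoc]

theorem hRep_apply (t : ℂˣ) (x : Coord n) (i : Fin (2 * n + 1)) :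
    hRep n t x i = ((t ^ coordWeight n i : ℂˣ) : ℂ) * x i := rfl

theorem quadric_hRep (t : ℂˣ) (x : Coord n) : quadric n (hRep n t x) = quadric n x := by
  have ht : (t : ℂ) ≠ 0 := t.ne_zero
  have h1 : ∀ i : Fin n, coordWeight n ⟨i, by omega⟩ = 1 := fun i => by simp [coordWeight]
  have h2 : coordWeight n ⟨n, by omega⟩ = 0 := by simp [coordWeight]
  have h3 : ∀ i : Fin n, coordWeight n ⟨n + 1 + i, by omega⟩ = -1 := fun i => by
    have ha : ¬ n + 1 + (i : ℕ) < n := by omega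
    have hb : ¬ n + 1 + (i : ℕ) = n := by omega
    simp [coordWeight, ha, hb]
  simp only [quadric, hRep_apply, h1, h2, h3]
  congr 1
  · refine Finset.sum_congr rfl fun i _ => ?_
    simp only [zpow_one, zpow_neg, Units.val_inv_eq_inv_val]
    field_simp
  · simp

/-- `X = G(ℙ¹, Q^{2n-1})` as a subset of the Grassmannian of lines of `ℙ^{2n}`: the lines on which
the equation of the quadric vanishes. -/
def quadricLines : Set (LineGrassmannian (Coord n)) :=
  {W | ∀ v ∈ W.1, quadric n v = 0}

/-- The action of `H_n` on `G(ℙ¹, Q^{2n-1})` moving the lines. -/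
instance quadricLinesAction : MulAction ℂˣ (quadricLines n) where
  smul t W := ⟨⟨W.1.1.map (hRep n t), by
      rw [((Submodule.equivMapOfInjective _ ((hRep n).apply_bijective t).1 W.1.1).finrank_eq).symm]
      exact W.1.2⟩, by
    rintro _ ⟨v, hv, rfl⟩
    rw [quadric_hRep]
    exact W.2 v hv⟩
  one_smul W := by
    refine Subtype.ext (LineGrassmannian.ext ?_)
    change W.1.1.map (hRep n 1) = W.1.1
    rw [map_one]
    exact Submodule.map_id _
  mul_smul s t W := by
    refine Subtype.ext (LineGrassmannian.ext ?_)
    change W.1.1.map (hRep n (s * t)) = (W.1.1.map (hRep n t)).map (hRep n s)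
    rw [map_mul, Module.End.mul_eq_comp, Submodule.map_comp]

/-- The induced representation on `⋀² ℂ^(2n+1)`. -/
def extRep : Representation ℂ ℂˣ (⋀[ℂ]^2 (Coord n)) where
  toFun t := exteriorPower.map 2 (hRep n t)
  map_one' := by
    rw [map_one]
    exact exteriorPower.map_id
  map_mul' s t := by
    rw [map_mul, Module.End.mul_eq_comp, Module.End.mul_eq_comp, exteriorPower.map_comp]

theorem plucker_smul (t : ℂˣ) (W : quadricLines n) :
    plucker (t • W).1 = projAct (extRep n) t (plucker W.1) := by
  apply Projectivization.submodule_injective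
  have h : (projAct (extRep n) t (plucker W.1)).submodule =
      (plucker W.1).submodule.map (extRep n t) := by
    induction plucker W.1 using Projectivization.ind with
    | h v hv =>
      rw [projAct, Projectivization.map_mk, Projectivization.submodule_mk,
        Projectivization.submodule_mk, Submodule.map_span, Set.image_singleton]
  rw [h]
  simp only [plucker, Projectivization.submodule_mk'']
  change LinearMap.range (exteriorPower.map 2 (W.1.1.map (hRep n t)).subtype) =
    (LinearMap.range (exteriorPower.map 2 W.1.1.subtype)).map (exteriorPower.map 2 (hRep n t))
  have hs : Function.Surjective (exteriorPower.map 2 ((hRep n t).submoduleMap W.1.1)) :=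
    exteriorPower.map_surjective ((hRep n t).submoduleMap_surjective W.1.1)
  rw [← LinearMap.range_comp, ← exteriorPower.map_comp,
    ← LinearMap.range_comp_of_range_eq_top _ (LinearMap.range_eq_top.2 hs),
    ← exteriorPower.map_comp]
  rfl

theorem extRep_isRational : IsRational (extRep n) := by
  rw [IsRational, eq_top_iff, ← exteriorPower.ιMulti_span_of_span ℂ 2 _
    (Pi.basisFun ℂ (Fin (2 * n + 1))).span_eq]
  refine Submodule.span_mono ?_
  rintro _ ⟨a, ha, rfl⟩
  have hb : ∀ i : Fin 2, ∃ k : ℤ, ∀ t : ℂˣ, hRep n t (a i) = ((t ^ k : ℂˣ) : ℂ) • a i := by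
    intro i
    obtain ⟨j, hj⟩ := ha ⟨i, rfl⟩
    refine ⟨coordWeight n j, fun t => funext fun l => ?_⟩
    rw [hRep_apply, ← hj, Pi.basisFun_apply, Pi.smul_apply, smul_eq_mul]
    by_cases hl : l = j
    · rw [hl]
    · simp [hl]
  choose k hk using hb
  refine ⟨∑ i, k i, fun t => ?_⟩
  change exteriorPower.map 2 (hRep n t) _ = _
  rw [exteriorPower.map_apply_ιMulti]
  have : (hRep n t) ∘ a = fun i => ((t ^ k i : ℂˣ) : ℂ) • a i := funext fun i => hk i t
  rw [this, AlternatingMap.map_smul_univ, Fin.prod_univ_two, Fin.sum_univ_two, zpow_add,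
    Units.val_mul]

/-- The line bundle `𝒪(1)` on `G(ℙ¹, Q^{2n-1})`: the Plücker embedding, with the natural
linearization. -/
def pluckerBundle : LinearizedEmbedding (quadricLines n) (⋀[ℂ]^2 (Coord n)) where
  rep := extRep n
  rational := extRep_isRational n
  toFun W := plucker W.1
  injective := plucker_injective.comp Subtype.val_injective
  embedding := FunctionSpace.induced_induced Subtype.val plucker inferInstance
  equivariant := plucker_smul n

/-- The subspace `{[p_+ : 0 : 0]}`, where only the coordinates of positive weight are nonzero;
its projective space is `ℙ^{n-1}_-`. -/
def minusSpace : Submodule ℂ (Coord n) where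
  carrier := {x | ∀ i : Fin (2 * n + 1), n ≤ (i : ℕ) → x i = 0}
  add_mem' ha hb i hi := by simp [ha i hi, hb i hi]
  zero_mem' i _ := rfl
  smul_mem' c x hx i hi := by simp [hx i hi]

/-- The subspace `{[0 : 0 : p_-]}`, where only the coordinates of negative weight are nonzero;
its projective space is `ℙ^{n-1}_+`. -/
def plusSpace : Submodule ℂ (Coord n) where
  carrier := {x | ∀ i : Fin (2 * n + 1), (i : ℕ) ≤ n → x i = 0}
  add_mem' ha hb i hi := by simp [ha i hi, hb i hi]
  zero_mem' i _ := rfl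
  smul_mem' c x hx i hi := by simp [hx i hi]

/-- `Y_- = G(ℙ¹, ℙ^{n-1}_-)` inside `X`. -/
def sinkLines : Set (quadricLines n) := {W | W.1 ∈ linesIn (minusSpace n)}

/-- `Y_+ = G(ℙ¹, ℙ^{n-1}_+)` inside `X`. -/
def sourceLines : Set (quadricLines n) := {W | W.1 ∈ linesIn (plusSpace n)}

/-- The lines of the quadric joining a point of `ℙ^{n-1}_-` to a point of `ℙ^{n-1}_+`. -/
def innerLines : Set (quadricLines n) :=
  {W | W.1.1 ⊓ minusSpace n ≠ ⊥ ∧ W.1.1 ⊓ plusSpace n ≠ ⊥}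

end Quadric

end QuadricLines

end

open QuadricLines

/-! Write a vector of ℂ^(2n+1) as (a, c, b) with parts of weights 1, 0, -1; the quadric becomes a·b
+ c². A fixed line is stable under t = -1 and t = 2, which forces c = 0 on it and makes it contain
the weight parts (a, 0, 0) and (0, 0, b) of each of its vectors (`parts_mem_of_mem_fixedPoints`). So
it lies in ℙ_-, lies in ℙ_+, or joins a point of each. A line of the last kind is a pair [a], [b]
with a·b = 0, that is, a point and a hyperplane through it; by the Euler sequence such pairs are the
points of P(T). In Plücker and Segre coordinates this bijection and its inverse are linear.

Irreducibility of the three pieces comes from polynomial parametrizations by vector spaces. For the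
inner piece the equation a·b = 0 is solved by a = p, b = (C - Cᵀ)p with C an arbitrary matrix. The
pieces are separated by weights: the weight of a linearized embedding is constant on an irreducible
set of fixed points (`LinearizedEmbedding.exists_hasWeight`), and the Plücker weights -2, 0, 2 are
distinct.

The cell of Y_- turns out to be the set of lines missing ℙ_+ (`cellMinus_sinkLines`). It is open,
being a nonvanishing condition on Plücker coordinates; its members have limits given by explicit
curves; and it is dense because a line meeting ℙ_+ moves in an explicit polynomial family of lines
of the quadric whose other members include lines of the cell. Exchanging a and b turns t into t⁻¹,
so the statement for the source follows from that for the sink.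

For the criticality, let an orbit have limits at 0 and ∞. A quotient of two weight forms is a
constant times a power of t along the orbit, and regularity at the two ends confines every weight
occurring in the orbit between those of the limits. If the orbit is not a fixed point, the weight of
L is therefore strictly smaller at ∞ than at 0 (`LinearizedEmbedding.weight_infty_lt_weight_zero`).
One explicit orbit joins Y_0 to Y_-, and its image under the involution joins Y_+ to Y_0; this gives
a₀ < a₁ < a₂ for every L. -/

noncomputable section

namespace QuadricLines

/-! ### Homogeneous polynomials on a vector space -/

section PolyEval

variable {E F G H : Type*} [AddCommGroup E] [Module ℂ E] [AddCommGroup F] [Module ℂ F]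
  [AddCommGroup G] [Module ℂ G] [AddCommGroup H] [Module ℂ H]

theorem polyEval_mul (P Q : MvPolynomial (Module.Dual ℂ E) ℂ) (v : E) :
    polyEval (P * Q) v = polyEval P v * polyEval Q v := map_mul _ _ _

theorem polyEval_X (φ : Module.Dual ℂ E) (v : E) : polyEval (MvPolynomial.X φ) v = φ v := by
  simp [polyEval]

theorem polyEval_smul {P : MvPolynomial (Module.Dual ℂ E) ℂ} {d : ℕ} (hP : P.IsHomogeneous d)
    (c : ℂ) (v : E) : polyEval P (c • v) = c ^ d * polyEval P v := by
  simp only [polyEval, MvPolynomial.eval_eq, map_smul, smul_eq_mul, Finset.mul_sum]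
  refine Finset.sum_congr rfl fun m hm => ?_
  have hd : m.degree = d := by
    by_contra h
    exact MvPolynomial.mem_support_iff.1 hm (hP.coeff_eq_zero h)
  simp only [mul_pow, Finset.prod_mul_distrib, Finset.prod_pow_eq_pow_sum]
  rw [← hd, Finsupp.degree_apply]
  ring

theorem polyEval_rep_mk_ne_zero {P : MvPolynomial (Module.Dual ℂ E) ℂ} {d : ℕ}
    (hP : P.IsHomogeneous d) (v : E) (hv : v ≠ 0) :
    polyEval P (Projectivization.mk ℂ v hv).rep ≠ 0 ↔ polyEval P v ≠ 0 := by
  obtain ⟨a, ha⟩ := Projectivization.exists_smul_eq_mk_rep ℂ v hv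
  rw [← ha, Units.smul_def, polyEval_smul hP]
  simp

theorem polyEval_div_rep_mk {P Q : MvPolynomial (Module.Dual ℂ E) ℂ} {d : ℕ}
    (hP : P.IsHomogeneous d) (hQ : Q.IsHomogeneous d) (v : E) (hv : v ≠ 0) :
    polyEval P (Projectivization.mk ℂ v hv).rep / polyEval Q (Projectivization.mk ℂ v hv).rep =
      polyEval P v / polyEval Q v := by
  obtain ⟨a, ha⟩ := Projectivization.exists_smul_eq_mk_rep ℂ v hv
  rw [← ha, Units.smul_def, polyEval_smul hP, polyEval_smul hQ,
    mul_div_mul_left _ _ (pow_ne_zero _ a.ne_zero)]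

/-- The restriction of a polynomial function to the affine line through `v` and `w`. -/
theorem exists_polynomial_line (P : MvPolynomial (Module.Dual ℂ E) ℂ) (v w : E) :
    ∃ p : Polynomial ℂ, ∀ s : ℂ, p.eval s = polyEval P (v + s • w) := by
  refine ⟨MvPolynomial.eval₂ Polynomial.C
    (fun φ => Polynomial.C (φ v) + Polynomial.X * Polynomial.C (φ w)) P, fun s => ?_⟩
  induction P using MvPolynomial.induction_on with
  | C a => simp [polyEval]
  | add p q hp hq => rw [MvPolynomial.eval₂_add, Polynomial.eval_add, hp, hq]; simp [polyEval]
  | mul_X p φ hp =>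
    rw [MvPolynomial.eval₂_mul, Polynomial.eval_mul, hp, polyEval_mul, polyEval_X]
    simp [mul_comm s]

/-- On the line joining v and w both functions become nonzero polynomials in one variable, and so
does their product. This is the irreducibility of a vector space, from which all irreducibility and
density statements below are drawn. -/
theorem exists_polyEval_ne_zero {P Q : MvPolynomial (Module.Dual ℂ E) ℂ} {v w : E}
    (hP : polyEval P v ≠ 0) (hQ : polyEval Q w ≠ 0) :
    ∃ u, polyEval P u ≠ 0 ∧ polyEval Q u ≠ 0 := by
  obtain ⟨p, hp⟩ := exists_polynomial_line P v (w - v)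
  obtain ⟨q, hq⟩ := exists_polynomial_line Q v (w - v)
  have hp0 : p ≠ 0 := by
    rintro rfl
    exact hP (by simpa using (hp 0).symm)
  have hq0 : q ≠ 0 := by
    rintro rfl
    exact hQ (by simpa using (hq 1).symm)
  obtain ⟨s, hs⟩ : ∃ s, (p * q).eval s ≠ 0 := by
    by_contra! h
    exact mul_ne_zero hp0 hq0 (Polynomial.funext fun s => by simpa using h s)
  rw [Polynomial.eval_mul, hp, hq] at hs
  exact ⟨_, left_ne_zero_of_mul hs, right_ne_zero_of_mul hs⟩

/-- Homogeneous polynomial maps of degree `d` between vector spaces. -/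
def IsPolyMap (d : ℕ) (Φ : E → F) : Prop :=
  ∀ φ : Module.Dual ℂ F, ∃ P : MvPolynomial (Module.Dual ℂ E) ℂ, P.IsHomogeneous d ∧
    ∀ v, polyEval P v = φ (Φ v)

theorem isPolyMap_linear (f : E →ₗ[ℂ] F) : IsPolyMap 1 f := fun φ =>
  ⟨MvPolynomial.X (φ.comp f), MvPolynomial.isHomogeneous_X _ _, fun _ => polyEval_X _ _⟩

theorem isPolyMap_const (w : F) : IsPolyMap 0 (fun _ : E => w) := fun φ =>
  ⟨MvPolynomial.C (φ w), MvPolynomial.isHomogeneous_C _ _, fun _ => by simp [polyEval]⟩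

theorem IsPolyMap.add {d : ℕ} {Φ Ψ : E → F} (hΦ : IsPolyMap d Φ) (hΨ : IsPolyMap d Ψ) :
    IsPolyMap d (fun v => Φ v + Ψ v) := fun φ => by
  obtain ⟨P, hP, hP'⟩ := hΦ φ
  obtain ⟨Q, hQ, hQ'⟩ := hΨ φ
  refine ⟨P + Q, hP.add hQ, fun v => ?_⟩
  rw [map_add, ← hP', ← hQ']
  exact map_add _ _ _

/-- Substituting for each linear form on the target the polynomial that represents its pullback
multiplies degrees. -/
theorem IsPolyMap.polyEval_comp {d m : ℕ} {Φ : E → F} (hΦ : IsPolyMap d Φ)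
    {P : MvPolynomial (Module.Dual ℂ F) ℂ} (hP : P.IsHomogeneous m) :
    ∃ Q : MvPolynomial (Module.Dual ℂ E) ℂ, Q.IsHomogeneous (d * m) ∧
      ∀ v, polyEval Q v = polyEval P (Φ v) := by
  choose Ψ hΨ hΨ' using hΦ
  refine ⟨MvPolynomial.aeval Ψ P, hP.aeval Ψ hΨ, fun v => ?_⟩
  clear hP
  induction P using MvPolynomial.induction_on with
  | C a => simp [polyEval]
  | add p q hp hq =>
    rw [map_add, polyEval, map_add, ← polyEval, hp, ← polyEval, hq]
    simp [polyEval]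
  | mul_X p φ hp =>
    rw [map_mul, MvPolynomial.aeval_X, polyEval_mul, polyEval_mul, polyEval_X, hp, hΨ']

theorem IsPolyMap.linear_comp {m : ℕ} (f : F →ₗ[ℂ] G) {Ψ : E → F}
    (hΨ : IsPolyMap m Ψ) : IsPolyMap m (fun v => f (Ψ v)) := fun φ => hΨ (φ.comp f)

/-- Finite bases of F and G write the form as a finite sum of products of coordinate polynomials, of
degree d + m. -/
theorem IsPolyMap.bilinear [FiniteDimensional ℂ F] [FiniteDimensional ℂ G]
    (B : F →ₗ[ℂ] G →ₗ[ℂ] H) {d m : ℕ} {Φ : E → F} {Ψ : E → G} (hΦ : IsPolyMap d Φ)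
    (hΨ : IsPolyMap m Ψ) : IsPolyMap (d + m) (fun v => B (Φ v) (Ψ v)) := fun φ => by
  let b := Module.finBasis ℂ F
  let c := Module.finBasis ℂ G
  choose P hP hP' using fun i => hΦ (b.coord i)
  choose Q hQ hQ' using fun i => hΨ (c.coord i)
  refine ⟨∑ i, ∑ j, MvPolynomial.C (φ (B (b i) (c j))) * (P i * Q j), ?_, fun v => ?_⟩
  · exact MvPolynomial.IsHomogeneous.sum _ _ _ fun i _ =>
      MvPolynomial.IsHomogeneous.sum _ _ _ fun j _ => ((hP i).mul (hQ j)).C_mul _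
  · change _ = φ (B (Φ v) (Ψ v))
    conv_rhs => rw [← b.sum_repr (Φ v), ← c.sum_repr (Ψ v)]
    have : ∀ i j, polyEval (MvPolynomial.C (φ (B (b i) (c j))) * (P i * Q j)) v =
        φ (B (b i) (c j)) * (b.repr (Φ v) i * c.repr (Ψ v) j) := fun i j => by
      rw [polyEval_mul, polyEval_mul, hP', hQ']
      simp [polyEval]
    simp only [map_sum, LinearMap.sum_apply, map_smul, LinearMap.smul_apply, smul_eq_mul]
    simp only [polyEval] at this ⊢
    simp only [map_sum (MvPolynomial.eval fun φ : Module.Dual ℂ E => φ v)]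
    rw [Finset.sum_comm]
    simp only [this, Finset.mul_sum]
    refine Finset.sum_congr rfl fun j _ => Finset.sum_congr rfl fun i _ => ?_
    ring

end PolyEval

/-! ### Subvarieties of projective spaces -/

section Embedded

variable {E F : Type*} [AddCommGroup E] [Module ℂ E] [AddCommGroup F] [Module ℂ F]

theorem isOpen_polyEval_ne_zero {P : MvPolynomial (Module.Dual ℂ E) ℂ} {d : ℕ}
    (hP : P.IsHomogeneous d) : IsOpen {x : ℙ ℂ E | polyEval P x.rep ≠ 0} :=
  TopologicalSpace.isOpen_generateFrom_of_mem ⟨d, P, hP, rfl⟩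

/-- The generating open sets form a base, since the product of two homogeneous polynomials cuts out
the intersection of their nonvanishing sets. -/
theorem exists_polyEval_ne_zero_subset {U : Set (ℙ ℂ E)} (hU : IsOpen U) {x : ℙ ℂ E}
    (hx : x ∈ U) : ∃ (d : ℕ) (P : MvPolynomial (Module.Dual ℂ E) ℂ), P.IsHomogeneous d ∧
      polyEval P x.rep ≠ 0 ∧ ∀ y : ℙ ℂ E, polyEval P y.rep ≠ 0 → y ∈ U := by
  induction hU generalizing x with
  | basic s hs =>
    obtain ⟨d, P, hP, rfl⟩ := hs
    exact ⟨d, P, hP, hx, fun y hy => hy⟩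
  | univ => exact ⟨0, 1, MvPolynomial.isHomogeneous_one _ _, by simp [polyEval], fun _ _ => trivial⟩
  | inter s t _ _ hs ht =>
    obtain ⟨d, P, hP, hPx, hPs⟩ := hs hx.1
    obtain ⟨m, Q, hQ, hQx, hQt⟩ := ht hx.2
    refine ⟨d + m, P * Q, hP.mul hQ, ?_, fun y hy => ?_⟩
    · rw [polyEval_mul]
      exact mul_ne_zero hPx hQx
    · rw [polyEval_mul] at hy
      exact ⟨hPs y (left_ne_zero_of_mul hy), hQt y (right_ne_zero_of_mul hy)⟩
  | sUnion S _ hS =>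
    obtain ⟨s, hs, hxs⟩ := hx
    obtain ⟨d, P, hP, hPx, hPs⟩ := hS s hs hxs
    exact ⟨d, P, hP, hPx, fun y hy => ⟨s, hs, hPs y hy⟩⟩

/-- The structure of `X` is that of a subvariety of `ℙ(E)` through `e`. -/
def IsSubvariety {X : Type*} [S : FunctionSpace X] (e : X → ℙ ℂ E) : Prop :=
  S = FunctionSpace.induced e inferInstance

variable {X Y : Type*} [FunctionSpace X] [FunctionSpace Y] {e : X → ℙ ℂ E} {e' : Y → ℙ ℂ F}

namespace IsSubvariety

theorem isOpen_iff (he : IsSubvariety e) {U : Set X} :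
    IsOpen U ↔ ∃ t : Set (ℙ ℂ E), IsOpen t ∧ e ⁻¹' t = U := by
  unfold IsSubvariety at he
  subst he
  exact isOpen_induced_iff

theorem continuous (he : IsSubvariety e) : Continuous e :=
  continuous_def.2 fun t ht => he.isOpen_iff.2 ⟨t, ht, rfl⟩

theorem isOpen_polyEval_ne_zero (he : IsSubvariety e) {P : MvPolynomial (Module.Dual ℂ E) ℂ}
    {d : ℕ} (hP : P.IsHomogeneous d) : IsOpen {x : X | polyEval P (e x).rep ≠ 0} :=
  (QuadricLines.isOpen_polyEval_ne_zero hP).preimage he.continuous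

theorem exists_polyEval_ne_zero_subset (he : IsSubvariety e) {U : Set X} (hU : IsOpen U) {x : X}
    (hx : x ∈ U) : ∃ (d : ℕ) (P : MvPolynomial (Module.Dual ℂ E) ℂ), P.IsHomogeneous d ∧
      polyEval P (e x).rep ≠ 0 ∧ ∀ y : X, polyEval P (e y).rep ≠ 0 → y ∈ U := by
  obtain ⟨t, ht, rfl⟩ := he.isOpen_iff.1 hU
  obtain ⟨d, P, hP, hPx, hPt⟩ := QuadricLines.exists_polyEval_ne_zero_subset ht hx
  exact ⟨d, P, hP, hPx, fun y hy => hPt _ hy⟩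

/-- A fraction valid only near x becomes valid wherever its denominator is nonzero once numerator
and denominator are multiplied by a polynomial R whose nonvanishing set lies in that neighbourhood.
-/
theorem regularAt_iff (he : IsSubvariety e) {f : X → ℂ} {x : X} :
    FunctionSpace.regularAt f x ↔ ∃ (d : ℕ) (P Q : MvPolynomial (Module.Dual ℂ E) ℂ),
      P.IsHomogeneous d ∧ Q.IsHomogeneous d ∧ polyEval Q (e x).rep ≠ 0 ∧
      ∀ y : X, polyEval Q (e y).rep ≠ 0 → f y = polyEval P (e y).rep / polyEval Q (e y).rep := by
  have h1 : FunctionSpace.regularAt f x ↔ ∃ g : ℙ ℂ E → ℂ, FunctionSpace.regularAt g (e x) ∧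
    ∀ᶠ x' in 𝓝 x, f x' = g (e x') := by
    unfold IsSubvariety at he
    subst he
    rfl
  rw [h1]
  constructor
  · rintro ⟨g, ⟨d, P, Q, hP, hQ, hQx, hg⟩, hfg⟩
    obtain ⟨U, hUf, hU, hxU⟩ := eventually_nhds_iff.1 hfg
    obtain ⟨m, R, hR, hRx, hRU⟩ := he.exists_polyEval_ne_zero_subset hU hxU
    refine ⟨d + m, P * R, Q * R, hP.mul hR, hQ.mul hR, ?_, fun y hy => ?_⟩
    · rw [polyEval_mul]
      exact mul_ne_zero hQx hRx
    · rw [polyEval_mul] at hy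
      have hy2 := right_ne_zero_of_mul hy
      rw [hUf y (hRU y hy2), hg _ (left_ne_zero_of_mul hy), polyEval_mul, polyEval_mul,
        mul_div_mul_right _ _ hy2]
  · rintro ⟨d, P, Q, hP, hQ, hQx, hf⟩
    refine ⟨fun z => polyEval P z.rep / polyEval Q z.rep,
      ⟨d, P, Q, hP, hQ, hQx, fun _ _ => rfl⟩, ?_⟩
    filter_upwards [(he.isOpen_polyEval_ne_zero hQ).mem_nhds hQx] with y hy using hf y hy

/-- This allows a projective space itself, in particular ℙ¹, as the source or target in
`isMorphism`. -/
theorem id : IsSubvariety (fun x : ℙ ℂ E => x) := by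
  refine FunctionSpace.ext ?_ ?_
  · exact congrArg (fun t => t.IsOpen)
      (induced_id (t := (inferInstance : TopologicalSpace (ℙ ℂ E)))).symm
  · funext f x
    refine propext ⟨fun h => ⟨f, h, Filter.Eventually.of_forall fun _ => rfl⟩, ?_⟩
    rintro ⟨g, ⟨d, P, Q, hP, hQ, hQx, hg⟩, hfg⟩
    have ht : TopologicalSpace.induced (fun x : ℙ ℂ E => x) inferInstance =
      (inferInstance : TopologicalSpace (ℙ ℂ E)) := induced_id
    rw [ht] at hfg
    obtain ⟨U, hUf, hU, hxU⟩ := eventually_nhds_iff.1 hfg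
    obtain ⟨m, R, hR, hRx, hRU⟩ := QuadricLines.exists_polyEval_ne_zero_subset hU hxU
    refine ⟨d + m, P * R, Q * R, hP.mul hR, hQ.mul hR, ?_, fun y hy => ?_⟩
    · rw [polyEval_mul]
      exact mul_ne_zero hQx hRx
    · rw [polyEval_mul] at hy
      have hy2 := right_ne_zero_of_mul hy
      rw [hUf y (hRU y hy2), hg _ (left_ne_zero_of_mul hy), polyEval_mul, polyEval_mul,
        mul_div_mul_right _ _ hy2]

/-- A map which in homogeneous coordinates is given by homogeneous polynomials of the same degree
without common zeros is a morphism. -/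
theorem isMorphism (he : IsSubvariety e) (he' : IsSubvariety e') {f : X → Y} {d : ℕ} {Φ : E → F}
    (hΦ : IsPolyMap d Φ) (hf : ∀ x, ∃ h : Φ (e x).rep ≠ 0,
      e' (f x) = Projectivization.mk ℂ (Φ (e x).rep) h) : IsMorphism f where
  continuous := by
    refine continuous_def.2 fun U hU => isOpen_iff_mem_nhds.2 fun x hx => ?_
    obtain ⟨m, P, hP, hPx, hPU⟩ := he'.exists_polyEval_ne_zero_subset hU hx
    obtain ⟨Q, hQ, hQP⟩ := hΦ.polyEval_comp hP
    have key : ∀ y, polyEval P (e' (f y)).rep ≠ 0 ↔ polyEval Q (e y).rep ≠ 0 := fun y => by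
      obtain ⟨h, hy⟩ := hf y
      rw [hy, polyEval_rep_mk_ne_zero hP, hQP]
    filter_upwards [(he.isOpen_polyEval_ne_zero hQ).mem_nhds ((key x).1 hPx)] with y hy
    exact hPU _ ((key y).2 hy)
  pullback g x hg := by
    obtain ⟨m, P, Q, hP, hQ, hQx, hPQ⟩ := he'.regularAt_iff.1 hg
    obtain ⟨P', hP', hPP⟩ := hΦ.polyEval_comp hP
    obtain ⟨Q', hQ', hQQ⟩ := hΦ.polyEval_comp hQ
    have key : ∀ y, polyEval Q (e' (f y)).rep ≠ 0 ↔ polyEval Q' (e y).rep ≠ 0 := fun y => by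
      obtain ⟨h, hy⟩ := hf y
      rw [hy, polyEval_rep_mk_ne_zero hQ, hQQ]
    refine he.regularAt_iff.2 ⟨_, P', Q', hP', hQ', (key x).1 hQx, fun y hy => ?_⟩
    obtain ⟨h, hy'⟩ := hf y
    rw [Function.comp_apply, hPQ _ ((key y).2 hy), hy', polyEval_div_rep_mk hP hQ, hPP, hQQ]

/-- Two open subsets of `X` which contain points of the image of a parametrization by
homogeneous polynomials meet in that image. -/
theorem exists_mem_inter {A : Type*} [AddCommGroup A] [Module ℂ A] (he : IsSubvariety e)
    {d : ℕ} {Φ : A → E} (hΦ : IsPolyMap d Φ) {S : Set X}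
    (hS : ∀ a (h : Φ a ≠ 0), ∃ x ∈ S, e x = Projectivization.mk ℂ (Φ a) h)
    {x y : X} {a b : A} {ha : Φ a ≠ 0} {hb : Φ b ≠ 0}
    (hxa : e x = Projectivization.mk ℂ (Φ a) ha) (hyb : e y = Projectivization.mk ℂ (Φ b) hb)
    {U V : Set X} (hU : IsOpen U) (hV : IsOpen V) (hx : x ∈ U) (hy : y ∈ V) :
    (S ∩ (U ∩ V)).Nonempty := by
  obtain ⟨m, P, hP, hPx, hPU⟩ := he.exists_polyEval_ne_zero_subset hU hx
  obtain ⟨k, Q, hQ, hQy, hQV⟩ := he.exists_polyEval_ne_zero_subset hV hy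
  obtain ⟨ξ, hξ⟩ := exists_dual_ne ha
  obtain ⟨P', hP', hPP⟩ := hΦ.polyEval_comp hP
  obtain ⟨Q', hQ', hQQ⟩ := hΦ.polyEval_comp hQ
  obtain ⟨R, hR, hRR⟩ := hΦ ξ
  rw [hxa, polyEval_rep_mk_ne_zero hP, ← hPP] at hPx
  rw [hyb, polyEval_rep_mk_ne_zero hQ, ← hQQ] at hQy
  rw [← hRR] at hξ
  -- The factor R = ξ ∘ Φ, nonzero at a, ensures Φ c ≠ 0, so that c does parametrize a point of S.
  obtain ⟨c, hc, hQc⟩ := exists_polyEval_ne_zero (P := P' * R) (v := a)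
    (by rw [polyEval_mul]; exact mul_ne_zero hPx hξ) hQy
  rw [polyEval_mul] at hc
  have hΦc : Φ c ≠ 0 := fun h => right_ne_zero_of_mul hc (by rw [hRR, h, map_zero])
  obtain ⟨z, hzS, hz⟩ := hS c hΦc
  refine ⟨z, hzS, hPU z ?_, hQV z ?_⟩
  · rw [hz, polyEval_rep_mk_ne_zero hP, ← hPP]
    exact left_ne_zero_of_mul hc
  · rwa [hz, polyEval_rep_mk_ne_zero hQ, ← hQQ]

/-- The image of a vector space under a polynomial map inherits its irreducibility; the zeros of Φ
are discarded. -/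
theorem isPreirreducible {A : Type*} [AddCommGroup A] [Module ℂ A] (he : IsSubvariety e)
    {d : ℕ} {Φ : A → E} (hΦ : IsPolyMap d Φ) {S : Set X}
    (hS : ∀ a (h : Φ a ≠ 0), ∃ x ∈ S, e x = Projectivization.mk ℂ (Φ a) h)
    (hS' : ∀ x ∈ S, ∃ a, ∃ h : Φ a ≠ 0, e x = Projectivization.mk ℂ (Φ a) h) :
    IsPreirreducible S := by
  rintro U V hU hV ⟨x, hxS, hxU⟩ ⟨y, hyS, hyV⟩
  obtain ⟨a, ha, hxa⟩ := hS' x hxS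
  obtain ⟨b, hb, hyb⟩ := hS' y hyS
  exact he.exists_mem_inter hΦ hS hxa hyb hU hV hxU hyV

end IsSubvariety

theorem IsMorphism.comp {X Y Z : Type*} [FunctionSpace X] [FunctionSpace Y] [FunctionSpace Z]
    {g : Y → Z} {f : X → Y} (hg : IsMorphism g) (hf : IsMorphism f) :
    IsMorphism (fun x => g (f x)) where
  continuous := hg.continuous.comp hf.continuous
  pullback _ _ hh := hf.pullback _ _ (hg.pullback _ _ hh)

end Embedded

/-! ### Bivectors and lines -/

section Wedge

variable {V W G : Type*} [AddCommGroup V] [Module ℂ V] [AddCommGroup W] [Module ℂ W]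
  [AddCommGroup G] [Module ℂ G]

/-- The alternating map `(u, v) ↦ B u v - B v u`. -/
def altOfBilin (B : V →ₗ[ℂ] V →ₗ[ℂ] G) : V [⋀^Fin 2]→ₗ[ℂ] G where
  toFun m := B (m 0) (m 1) - B (m 1) (m 0)
  map_update_add' m i x y := by
    fin_cases i <;> simp [Function.update] <;> abel
  map_update_smul' m i c x := by
    fin_cases i <;> simp [Function.update, smul_sub]
  map_eq_zero_of_eq' m i j h hij := by
    fin_cases i <;> fin_cases j <;> simp_all

/-- The bivector `u ∧ v`. -/
def wedge (u v : V) : ⋀[ℂ]^2 V := exteriorPower.ιMulti ℂ 2 ![u, v]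

/-- The linear form on bivectors with `u ∧ v ↦ B u v - B v u`. -/
def wedgeLift (B : V →ₗ[ℂ] V →ₗ[ℂ] G) : ⋀[ℂ]^2 V →ₗ[ℂ] G :=
  exteriorPower.alternatingMapLinearEquiv (altOfBilin B)

theorem wedgeLift_wedge (B : V →ₗ[ℂ] V →ₗ[ℂ] G) (u v : V) :
    wedgeLift B (wedge u v) = B u v - B v u := by
  rw [wedgeLift, wedge, exteriorPower.alternatingMapLinearEquiv_apply_ιMulti]
  rfl

theorem map_wedge (f : V →ₗ[ℂ] W) (u v : V) :
    exteriorPower.map 2 f (wedge u v) = wedge (f u) (f v) := by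
  rw [wedge, exteriorPower.map_apply_ιMulti, wedge]
  congr 1
  ext i
  fin_cases i <;> rfl

theorem wedge_add_left (u u' v : V) : wedge (u + u') v = wedge u v + wedge u' v :=
  AlternatingMap.map_vecCons_add _ _ _ _

theorem wedge_smul_left (c : ℂ) (u v : V) : wedge (c • u) v = c • wedge u v :=
  AlternatingMap.map_vecCons_smul _ _ _ _

theorem wedge_swap (u v : V) : wedge u v = -wedge v u := by
  rw [wedge, wedge, ← AlternatingMap.map_swap _ _ (zero_ne_one (α := Fin 2))]
  congr 1
  ext i
  fin_cases i <;> rfl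

theorem wedge_add_right (u v v' : V) : wedge u (v + v') = wedge u v + wedge u v' := by
  rw [wedge_swap, wedge_add_left, neg_add, ← wedge_swap, ← wedge_swap]

theorem wedge_smul_right (c : ℂ) (u v : V) : wedge u (c • v) = c • wedge u v := by
  rw [wedge_swap, wedge_smul_left, wedge_swap v u, smul_neg, neg_neg]

/-- The bilinear map `(u, v) ↦ u ∧ v`. -/
def wedgeₗ : V →ₗ[ℂ] V →ₗ[ℂ] ⋀[ℂ]^2 V :=
  LinearMap.mk₂ ℂ wedge wedge_add_left wedge_smul_left wedge_add_right wedge_smul_right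

theorem isPolyMap_wedge [FiniteDimensional ℂ V] {d m : ℕ} {Φ Ψ : W → V} (hΦ : IsPolyMap d Φ)
    (hΨ : IsPolyMap m Ψ) : IsPolyMap (d + m) (fun a => wedge (Φ a) (Ψ a)) :=
  IsPolyMap.bilinear wedgeₗ hΦ hΨ

theorem exists_dual_eq_one_eq_zero {u v : V} (h : LinearIndependent ℂ ![u, v]) :
    ∃ φ : Module.Dual ℂ V, φ u = 1 ∧ φ v = 0 := by
  have hu : u ∉ Submodule.span ℂ {v} := fun hu => by
    obtain ⟨c, hc⟩ := Submodule.mem_span_singleton.1 hu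
    have := (LinearIndependent.pair_iff.1 h 1 (-c) (by rw [← hc]; module)).1
    exact one_ne_zero this
  obtain ⟨φ, hφu, hφ⟩ := Submodule.exists_dual_map_eq_bot_of_notMem hu inferInstance
  have hφv : φ v = 0 := (Submodule.mem_bot ℂ).1
    (hφ ▸ Submodule.mem_map_of_mem (Submodule.mem_span_singleton_self v))
  exact ⟨(φ u)⁻¹ • φ, by simp [hφu], by simp [hφv]⟩

theorem exists_dual_pair {u v : V} (h : LinearIndependent ℂ ![u, v]) :
    ∃ φ ψ : Module.Dual ℂ V, φ u = 1 ∧ φ v = 0 ∧ ψ u = 0 ∧ ψ v = 1 := by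
  obtain ⟨φ, h1, h2⟩ := exists_dual_eq_one_eq_zero h
  obtain ⟨ψ, h3, h4⟩ := exists_dual_eq_one_eq_zero (LinearIndependent.pair_symm_iff.1 h)
  exact ⟨φ, ψ, h1, h2, h4, h3⟩

/-- For independent u, v the 2-form φ ∧ ψ built from a dual pair takes the value 1 on u ∧ v. -/
theorem wedge_ne_zero_iff {u v : V} : wedge u v ≠ 0 ↔ LinearIndependent ℂ ![u, v] := by
  constructor
  · intro h
    by_contra hd
    exact h (AlternatingMap.map_linearDependent _ _ hd)
  · intro h h0
    obtain ⟨φ, ψ, hφu, hφv, -, hψv⟩ := exists_dual_pair h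
    have := congrArg (wedgeLift ((LinearMap.mul ℂ ℂ).compl₁₂ φ ψ)) h0
    rw [wedgeLift_wedge] at this
    simp [hφu, hφv, hψv] at this

theorem wedge_ne_zero_iff' {u v : V} :
    wedge u v ≠ 0 ↔ ∀ s t : ℂ, s • u + t • v = 0 → s = 0 ∧ t = 0 := by
  rw [wedge_ne_zero_iff, LinearIndependent.pair_iff]

namespace LineGrassmannian

theorem finiteDimensional (L : LineGrassmannian V) : FiniteDimensional ℂ L.space :=
  Module.finite_of_finrank_pos (by rw [L.finrank_eq]; norm_num)

theorem space_eq_span {L : LineGrassmannian V} {u v : V} (hu : u ∈ L.space) (hv : v ∈ L.space)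
    (h : wedge u v ≠ 0) : L.space = Submodule.span ℂ {u, v} := by
  have := L.finiteDimensional
  refine (Submodule.eq_of_le_of_finrank_eq ?_ ?_).symm
  · rw [Submodule.span_le]
    rintro x (rfl | rfl)
    exacts [hu, hv]
  · have := finrank_span_eq_card (wedge_ne_zero_iff.1 h)
    rw [Matrix.range_cons_cons_empty] at this
    rw [this, L.finrank_eq]
    rfl

theorem mem_iff {L : LineGrassmannian V} {u v : V} (hu : u ∈ L.space) (hv : v ∈ L.space)
    (h : wedge u v ≠ 0) {x : V} : x ∈ L.space ↔ ∃ a b : ℂ, a • u + b • v = x := by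
  rw [space_eq_span hu hv h, Submodule.mem_span_pair]

theorem ext_of_mem {L L' : LineGrassmannian V} {u v : V} (h : wedge u v ≠ 0)
    (hu : u ∈ L.space) (hv : v ∈ L.space) (hu' : u ∈ L'.space) (hv' : v ∈ L'.space) : L = L' :=
  LineGrassmannian.ext (by rw [space_eq_span hu hv h, space_eq_span hu' hv' h])

/-- The line through two points. -/
def ofPair (u v : V) (h : wedge u v ≠ 0) : LineGrassmannian V where
  space := Submodule.span ℂ {u, v}
  finrank_eq := by
    have := finrank_span_eq_card (wedge_ne_zero_iff.1 h)
    rwa [Matrix.range_cons_cons_empty, Fintype.card_fin] at this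

theorem left_mem_ofPair {u v : V} (h : wedge u v ≠ 0) : u ∈ (ofPair u v h).space :=
  Submodule.subset_span (by simp)

theorem right_mem_ofPair {u v : V} (h : wedge u v ≠ 0) : v ∈ (ofPair u v h).space :=
  Submodule.subset_span (by simp)

theorem mem_ofPair {u v x : V} (h : wedge u v ≠ 0) :
    x ∈ (ofPair u v h).space ↔ ∃ a b : ℂ, a • u + b • v = x := Submodule.mem_span_pair

theorem exists_pair (L : LineGrassmannian V) :
    ∃ u ∈ L.space, ∃ v ∈ L.space, wedge u v ≠ 0 := by
  have := L.finiteDimensional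
  let b := Module.finBasisOfFinrankEq ℂ L.space L.finrank_eq
  refine ⟨b 0, (b 0).2, b 1, (b 1).2, wedge_ne_zero_iff.2 ?_⟩
  have h := b.linearIndependent.map' L.space.subtype L.space.ker_subtype
  have h2 : ![((b 0 : L.space) : V), b 1] = L.space.subtype ∘ b := by
    ext i
    fin_cases i <;> rfl
  rw [h2]
  exact h

/-- A nonzero vector of the plane completes to a basis. -/
theorem exists_wedge_ne_zero (L : LineGrassmannian V) {u : V} (hu : u ∈ L.space) (hu0 : u ≠ 0) :
    ∃ v ∈ L.space, wedge u v ≠ 0 := by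
  by_contra! hc
  obtain ⟨x, hx, y, hy, hxy⟩ := L.exists_pair
  obtain ⟨a, b, rfl⟩ := (mem_iff hx hy hxy).1 hu
  have h1 := hc y hy
  have h2 := hc x hx
  have hxx : ∀ z : V, wedge z z = 0 := fun z =>
    AlternatingMap.map_eq_zero_of_eq _ _ (i := 0) (j := 1) rfl (by simp)
  rw [wedge_add_left, wedge_smul_left, wedge_smul_left, hxx, smul_zero, add_zero] at h1
  rw [wedge_add_left, wedge_smul_left, wedge_smul_left, hxx, smul_zero, zero_add, wedge_swap,
    smul_neg, neg_eq_zero] at h2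
  have ha := (smul_eq_zero.1 h1).resolve_right hxy
  have hb := (smul_eq_zero.1 h2).resolve_right hxy
  simp [ha, hb] at hu0

end LineGrassmannian

/-- The line ⋀² L is one-dimensional and contains u ∧ v, so a nonzero u ∧ v spans it. -/
theorem plucker_eq_mk (L : LineGrassmannian V) {u v : V} (hu : u ∈ L.space) (hv : v ∈ L.space)
    (h : wedge u v ≠ 0) : plucker L = Projectivization.mk ℂ (wedge u v) h := by
  apply Projectivization.submodule_injective
  rw [plucker, Projectivization.submodule_mk'', Projectivization.submodule_mk]
  have hm : wedge u v ∈ LinearMap.range (exteriorPower.map 2 L.1.subtype) :=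
    ⟨wedge ⟨u, hu⟩ ⟨v, hv⟩, map_wedge _ _ _⟩
  refine le_antisymm (fun x hx => ?_) ((Submodule.span_singleton_le_iff_mem _ _).2 hm)
  obtain ⟨c, hc⟩ := (finrank_eq_one_iff_of_nonzero' (⟨_, hm⟩ : LinearMap.range _)
    (fun h0 => h (congrArg Subtype.val h0))).1 (finrank_exteriorSquare_range L) ⟨x, hx⟩
  exact Submodule.mem_span_singleton.2 ⟨c, congrArg Subtype.val hc⟩

theorem exists_smul_plucker_rep (L : LineGrassmannian V) {u v : V} (hu : u ∈ L.space)
    (hv : v ∈ L.space) (h : wedge u v ≠ 0) : ∃ c : ℂˣ, (plucker L).rep = c • wedge u v := by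
  obtain ⟨a, ha⟩ := Projectivization.exists_smul_eq_mk_rep ℂ _ h
  exact ⟨a, by rw [plucker_eq_mk L hu hv h, ha]⟩

theorem isSubvariety_plucker_coe (S : Set (LineGrassmannian V)) :
    IsSubvariety (fun x : S => plucker x.1) :=
  FunctionSpace.induced_induced Subtype.val plucker inferInstance

theorem isSubvariety_plucker_coe_coe (S : Set (LineGrassmannian V)) (T : Set S) :
    IsSubvariety (fun x : T => plucker x.1.1) :=
  (FunctionSpace.induced_induced (Subtype.val : T → S) Subtype.val _).trans
    (FunctionSpace.induced_induced _ plucker inferInstance)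

end Wedge

/-! ### Coordinates adapted to the action -/

section Coordinates

variable {n : ℕ}

/-- The coordinates of weight `1`. -/
def posPart : Coord n →ₗ[ℂ] (Fin n → ℂ) :=
  LinearMap.pi fun i => LinearMap.proj (⟨i, by omega⟩ : Fin (2 * n + 1))

/-- The coordinate of weight `0`. -/
def midPart : Coord n →ₗ[ℂ] ℂ := LinearMap.proj (⟨n, by omega⟩ : Fin (2 * n + 1))

/-- The coordinates of weight `-1`. -/
def negPart : Coord n →ₗ[ℂ] (Fin n → ℂ) :=
  LinearMap.pi fun i => LinearMap.proj (⟨n + 1 + i, by omega⟩ : Fin (2 * n + 1))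

/-- The vector with given coordinates of weights `1`, `0` and `-1`. -/
def coordVec (a : Fin n → ℂ) (c : ℂ) (b : Fin n → ℂ) : Coord n := fun j =>
  if h : (j : ℕ) < n then a ⟨j, h⟩ else
    if h' : (j : ℕ) = n then c else b ⟨j - (n + 1), by omega⟩

@[simp] theorem posPart_coordVec (a : Fin n → ℂ) (c : ℂ) (b : Fin n → ℂ) :
    posPart (coordVec a c b) = a := by
  ext i
  simp [posPart, coordVec]

@[simp] theorem midPart_coordVec (a : Fin n → ℂ) (c : ℂ) (b : Fin n → ℂ) :
    midPart (coordVec a c b) = c := by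
  simp [midPart, coordVec]

@[simp] theorem negPart_coordVec (a : Fin n → ℂ) (c : ℂ) (b : Fin n → ℂ) :
    negPart (coordVec a c b) = b := by
  ext i
  have h1 : ¬ n + 1 + (i : ℕ) < n := by omega
  have h2 : ¬ n + 1 + (i : ℕ) = n := by omega
  simp [negPart, coordVec, h1, h2]

theorem coord_ext {x y : Coord n} (h1 : posPart x = posPart y) (h2 : midPart x = midPart y)
    (h3 : negPart x = negPart y) : x = y := by
  ext j
  rcases lt_trichotomy (j : ℕ) n with h | h | h
  · exact congrFun h1 ⟨j, h⟩
  · have : j = ⟨n, by omega⟩ := Fin.ext h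
    rw [this]
    exact h2
  · have : j = ⟨n + 1 + (j - (n + 1)), by omega⟩ := Fin.ext (by simp; omega)
    rw [this]
    exact congrFun h3 ⟨j - (n + 1), by omega⟩

theorem coordVec_parts (x : Coord n) : coordVec (posPart x) (midPart x) (negPart x) = x :=
  coord_ext (by simp) (by simp) (by simp)

theorem mem_minusSpace {x : Coord n} : x ∈ minusSpace n ↔ midPart x = 0 ∧ negPart x = 0 := by
  constructor
  · intro h
    exact ⟨h _ le_rfl, funext fun i => h _ (by simp; omega)⟩
  · rintro ⟨h0, h1⟩ j hj
    rw [← coordVec_parts x, h0, h1]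
    have : ¬ (j : ℕ) < n := by omega
    simp [coordVec, this]

theorem mem_plusSpace {x : Coord n} : x ∈ plusSpace n ↔ posPart x = 0 ∧ midPart x = 0 := by
  constructor
  · intro h
    exact ⟨funext fun i => h _ (by simp), h _ le_rfl⟩
  · rintro ⟨h0, h1⟩ j hj
    rw [← coordVec_parts x, h0, h1]
    rcases hj.lt_or_eq with h | h <;> simp [coordVec, h]

theorem quadric_eq (x : Coord n) : quadric n x = posPart x ⬝ᵥ negPart x + midPart x ^ 2 := rfl

/-- The polar form of the quadric. -/
def quadricPolar (x y : Coord n) : ℂ :=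
  posPart x ⬝ᵥ negPart y + posPart y ⬝ᵥ negPart x + 2 * midPart x * midPart y

theorem quadric_smul_add_smul (a b : ℂ) (x y : Coord n) : quadric n (a • x + b • y) =
    a ^ 2 * quadric n x + a * b * quadricPolar x y + b ^ 2 * quadric n y := by
  simp only [quadric_eq, quadricPolar, map_add, map_smul, dotProduct_add, add_dotProduct,
    smul_dotProduct, dotProduct_smul, smul_eq_mul]
  ring

theorem mem_quadricLines_iff {L : LineGrassmannian (Coord n)} {u v : Coord n} (hu : u ∈ L.space)
    (hv : v ∈ L.space) (h : wedge u v ≠ 0) :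
    L ∈ quadricLines n ↔ quadric n u = 0 ∧ quadric n v = 0 ∧ quadricPolar u v = 0 := by
  constructor
  · intro hL
    refine ⟨hL u hu, hL v hv, ?_⟩
    have := hL (u + v) (L.space.add_mem hu hv)
    have h2 := quadric_smul_add_smul 1 1 u v
    rw [one_smul, one_smul, this, hL u hu, hL v hv] at h2
    simpa using h2.symm
  · rintro ⟨h1, h2, h3⟩ x hx
    obtain ⟨a, b, rfl⟩ := (LineGrassmannian.mem_iff hu hv h).1 hx
    rw [quadric_smul_add_smul, h1, h2, h3]
    ring

theorem quadricPolar_eq_zero {L : LineGrassmannian (Coord n)} (hL : L ∈ quadricLines n)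
    {u v : Coord n} (hu : u ∈ L.space) (hv : v ∈ L.space) : quadricPolar u v = 0 := by
  have := hL (u + v) (L.space.add_mem hu hv)
  have h2 := quadric_smul_add_smul 1 1 u v
  rw [one_smul, one_smul, this, hL u hu, hL v hv] at h2
  simpa using h2.symm

/-- The line of the quadric through two orthogonal isotropic vectors. -/
def quadricLine (u v : Coord n) (h : wedge u v ≠ 0) (hu : quadric n u = 0) (hv : quadric n v = 0)
    (huv : quadricPolar u v = 0) : quadricLines n :=
  ⟨LineGrassmannian.ofPair u v h, (mem_quadricLines_iff (LineGrassmannian.left_mem_ofPair h)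
    (LineGrassmannian.right_mem_ofPair h) h).2 ⟨hu, hv, huv⟩⟩

@[simp] theorem posPart_hRep (t : ℂˣ) (x : Coord n) :
    posPart (hRep n t x) = (t : ℂ) • posPart x := by
  ext i
  have h : coordWeight n ⟨i, by omega⟩ = 1 := by simp [coordWeight]
  change hRep n t x _ = (t : ℂ) * x _
  rw [hRep_apply, h, zpow_one]

@[simp] theorem midPart_hRep (t : ℂˣ) (x : Coord n) : midPart (hRep n t x) = midPart x := by
  have h : coordWeight n ⟨n, by omega⟩ = 0 := by simp [coordWeight]
  change hRep n t x _ = x _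
  rw [hRep_apply, h, zpow_zero, Units.val_one, one_mul]

@[simp] theorem negPart_hRep (t : ℂˣ) (x : Coord n) :
    negPart (hRep n t x) = (t : ℂ)⁻¹ • negPart x := by
  ext i
  have h : coordWeight n ⟨n + 1 + i, by omega⟩ = -1 := by
    have ha : ¬ n + 1 + (i : ℕ) < n := by omega
    have hb : ¬ n + 1 + (i : ℕ) = n := by omega
    simp [coordWeight, ha, hb]
  change hRep n t x _ = (t : ℂ)⁻¹ * x _
  rw [hRep_apply, h, zpow_neg_one, Units.val_inv_eq_inv_val]

theorem hRep_of_mem_minusSpace {x : Coord n} (hx : x ∈ minusSpace n) (t : ℂˣ) :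
    hRep n t x = (t : ℂ) • x := by
  obtain ⟨h0, h1⟩ := mem_minusSpace.1 hx
  exact coord_ext (by simp) (by simp [h0]) (by simp [h1])

theorem hRep_of_mem_plusSpace {x : Coord n} (hx : x ∈ plusSpace n) (t : ℂˣ) :
    hRep n t x = (t : ℂ)⁻¹ • x := by
  obtain ⟨h0, h1⟩ := mem_plusSpace.1 hx
  exact coord_ext (by simp [h0]) (by simp [h1]) (by simp)

theorem coordVec_mem_minusSpace (a : Fin n → ℂ) : coordVec a 0 0 ∈ minusSpace n :=
  mem_minusSpace.2 (by simp)

theorem coordVec_mem_plusSpace (b : Fin n → ℂ) : coordVec 0 0 b ∈ plusSpace n :=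
  mem_plusSpace.2 (by simp)

theorem eq_coordVec_of_mem_minusSpace {x : Coord n} (hx : x ∈ minusSpace n) :
    x = coordVec (posPart x) 0 0 := by
  obtain ⟨h0, h1⟩ := mem_minusSpace.1 hx
  exact coord_ext (by simp) (by simp [h0]) (by simp [h1])

theorem eq_coordVec_of_mem_plusSpace {x : Coord n} (hx : x ∈ plusSpace n) :
    x = coordVec 0 0 (negPart x) := by
  obtain ⟨h0, h1⟩ := mem_plusSpace.1 hx
  exact coord_ext (by simp [h0]) (by simp [h1]) (by simp)

theorem minusSpace_inf_plusSpace {x : Coord n} (hx : x ∈ minusSpace n) (hx' : x ∈ plusSpace n) :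
    x = 0 := by
  rw [eq_coordVec_of_mem_minusSpace hx, (mem_plusSpace.1 hx').1]
  exact coord_ext (by simp) (by simp) (by simp)

theorem quadric_of_mem_minusSpace {x : Coord n} (hx : x ∈ minusSpace n) : quadric n x = 0 := by
  obtain ⟨h0, h1⟩ := mem_minusSpace.1 hx
  simp [quadric_eq, h0, h1]

theorem quadric_of_mem_plusSpace {x : Coord n} (hx : x ∈ plusSpace n) : quadric n x = 0 := by
  obtain ⟨h0, h1⟩ := mem_plusSpace.1 hx
  simp [quadric_eq, h0, h1]

theorem wedge_ne_zero_of_mem {x y : Coord n} (hx : x ∈ minusSpace n) (hx0 : x ≠ 0)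
    (hy : y ∈ plusSpace n) (hy0 : y ≠ 0) : wedge x y ≠ 0 := by
  rw [wedge_ne_zero_iff']
  intro s t h
  have h1 : s • x = 0 := by
    refine minusSpace_inf_plusSpace ((minusSpace n).smul_mem s hx) ?_
    rw [eq_neg_of_add_eq_zero_left h]
    exact (plusSpace n).neg_mem ((plusSpace n).smul_mem t hy)
  have h2 : t • y = 0 := by rwa [h1, zero_add] at h
  exact ⟨(smul_eq_zero.1 h1).resolve_right hx0, (smul_eq_zero.1 h2).resolve_right hy0⟩

end Coordinates

/-! ### The fixed locus -/

section FixedLocus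

variable {n : ℕ}

theorem hRep_mem_smul (t : ℂˣ) {L : quadricLines n} {v : Coord n} (hv : v ∈ L.1.space) :
    hRep n t v ∈ (t • L).1.space := Submodule.mem_map_of_mem hv

theorem linesIn_minusSpace_subset : linesIn (minusSpace n) ⊆ quadricLines n :=
  fun _ hL _ hv => quadric_of_mem_minusSpace (hL hv)

theorem linesIn_plusSpace_subset : linesIn (plusSpace n) ⊆ quadricLines n :=
  fun _ hL _ hv => quadric_of_mem_plusSpace (hL hv)

theorem mem_innerLines_iff {L : quadricLines n} : L ∈ innerLines n ↔
    ∃ x ∈ L.1.space, ∃ y ∈ L.1.space, x ∈ minusSpace n ∧ y ∈ plusSpace n ∧ x ≠ 0 ∧ y ≠ 0 := by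
  constructor
  · rintro ⟨h1, h2⟩
    obtain ⟨x, hx, hx0⟩ := (Submodule.ne_bot_iff _).1 h1
    obtain ⟨y, hy, hy0⟩ := (Submodule.ne_bot_iff _).1 h2
    exact ⟨x, hx.1, y, hy.1, hx.2, hy.2, hx0, hy0⟩
  · rintro ⟨x, hx, y, hy, hxm, hyp, hx0, hy0⟩
    exact ⟨(Submodule.ne_bot_iff _).2 ⟨x, ⟨hx, hxm⟩, hx0⟩,
      (Submodule.ne_bot_iff _).2 ⟨y, ⟨hy, hyp⟩, hy0⟩⟩

/-- A line spanned by weight vectors of weights `i` and `j`. -/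
def HasWeightBasis (L : quadricLines n) (i j : ℤ) : Prop :=
  ∃ u ∈ L.1.space, ∃ v ∈ L.1.space, wedge u v ≠ 0 ∧
    ∀ t : ℂˣ, hRep n t u = ((t ^ i : ℂˣ) : ℂ) • u ∧ hRep n t v = ((t ^ j : ℂˣ) : ℂ) • v

theorem HasWeightBasis.mem_fixedPoints {L : quadricLines n} {i j : ℤ} (h : HasWeightBasis L i j) :
    L ∈ MulAction.fixedPoints ℂˣ (quadricLines n) := by
  obtain ⟨u, hu, v, hv, huv, ht⟩ := h
  intro t
  have key : ∀ (k : ℤ) (x : Coord n), x ∈ L.1.space →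
      hRep n t x = ((t ^ k : ℂˣ) : ℂ) • x → x ∈ (t • L).1.space := by
    intro k x hx hk
    have := (t • L).1.space.smul_mem (((t ^ k)⁻¹ : ℂˣ) : ℂ) (hRep_mem_smul t hx)
    rwa [hk, smul_smul, ← Units.val_mul, inv_mul_cancel, Units.val_one, one_smul] at this
  exact Subtype.ext (LineGrassmannian.ext_of_mem huv (key i u hu (ht t).1) (key j v hv (ht t).2)
    hu hv)

/-- The Plücker vector u ∧ v has weight i + j; the fibre of 𝒪(1) is the dual of the line it spans,
whence the sign. -/
theorem hasWeight_pluckerBundle {Y : Set (quadricLines n)} {i j k : ℤ}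
    (hY : ∀ L ∈ Y, HasWeightBasis L i j) (hk : -k = i + j) :
    (pluckerBundle n).HasWeight Y k := by
  intro L hL w hw t
  obtain ⟨u, hu, v, hv, huv, ht⟩ := hY L hL
  change w ∈ (plucker L.1).submodule at hw
  rw [plucker_eq_mk L.1 hu hv huv, Projectivization.submodule_mk] at hw
  obtain ⟨c, rfl⟩ := Submodule.mem_span_singleton.1 hw
  change extRep n t _ = _
  rw [map_smul]
  have : extRep n t (wedge u v) = ((t ^ (-k) : ℂˣ) : ℂ) • wedge u v := by
    change exteriorPower.map 2 (hRep n t) (wedge u v) = _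
    rw [map_wedge, (ht t).1, (ht t).2, wedge_smul_left, wedge_smul_right, smul_smul,
      ← Units.val_mul, ← zpow_add, hk]
  rw [this, smul_comm]

theorem hasWeightBasis_of_mem_sinkLines {L : quadricLines n} (hL : L ∈ sinkLines n) :
    HasWeightBasis L 1 1 := by
  obtain ⟨u, hu, v, hv, h⟩ := L.1.exists_pair
  exact ⟨u, hu, v, hv, h, fun t => by simp [hRep_of_mem_minusSpace (hL hu),
    hRep_of_mem_minusSpace (hL hv)]⟩

theorem hasWeightBasis_of_mem_sourceLines {L : quadricLines n} (hL : L ∈ sourceLines n) :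
    HasWeightBasis L (-1) (-1) := by
  obtain ⟨u, hu, v, hv, h⟩ := L.1.exists_pair
  exact ⟨u, hu, v, hv, h, fun t => by simp [hRep_of_mem_plusSpace (hL hu),
    hRep_of_mem_plusSpace (hL hv)]⟩

theorem hasWeightBasis_of_mem_innerLines {L : quadricLines n} (hL : L ∈ innerLines n) :
    HasWeightBasis L 1 (-1) := by
  obtain ⟨x, hx, y, hy, hxm, hyp, hx0, hy0⟩ := mem_innerLines_iff.1 hL
  exact ⟨x, hx, y, hy, wedge_ne_zero_of_mem hxm hx0 hyp hy0, fun t => by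
    simp [hRep_of_mem_minusSpace hxm, hRep_of_mem_plusSpace hyp]⟩

/-- Two values of t suffice to split a vector of a fixed line into weight vectors: t = -1 removes
the middle coordinate, with the help of the quadric, and t = 2 separates the other two parts. -/
theorem parts_mem_of_mem_fixedPoints {L : quadricLines n}
    (hL : L ∈ MulAction.fixedPoints ℂˣ (quadricLines n)) {v : Coord n} (hv : v ∈ L.1.space) :
    midPart v = 0 ∧ coordVec (posPart v) 0 0 ∈ L.1.space ∧
      coordVec 0 0 (negPart v) ∈ L.1.space := by
  have h : ∀ t : ℂˣ, hRep n t v ∈ L.1.space := fun t => by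
    have := hRep_mem_smul t hv
    rwa [hL t] at this
  -- For v = (a, c, b) the sum of v and its translate by -1 is (0, 2c, 0), where the quadric takes
  -- the value 4c².
  have h0 : midPart v = 0 := by
    have h1 := L.2 _ (L.1.space.add_mem hv (h (-1)))
    rw [quadric_eq] at h1
    simpa [← two_mul] using h1
  -- The value t = 2 sends (a, 0, b) to (2a, 0, b/2); twice this minus v is (3a, 0, 0), and 2v minus
  -- this is (0, 0, 3b/2).
  have h2 := h (Units.mk0 2 two_ne_zero)
  refine ⟨h0, ?_, ?_⟩
  · have : coordVec (posPart v) 0 0 =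
        (1 / 3 : ℂ) • ((2 : ℂ) • hRep n (Units.mk0 2 two_ne_zero) v - v) := by
      refine coord_ext ?_ ?_ ?_
      · simp only [posPart_coordVec, map_smul, map_sub, posPart_hRep, Units.val_mk0]
        module
      · simp [h0]
      · simp
    rw [this]
    exact L.1.space.smul_mem _ (L.1.space.sub_mem (L.1.space.smul_mem _ h2) hv)
  · have : coordVec 0 0 (negPart v) =
        (2 / 3 : ℂ) • ((2 : ℂ) • v - hRep n (Units.mk0 2 two_ne_zero) v) := by
      refine coord_ext ?_ ?_ ?_
      · simp
      · simp [h0]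
      · simp only [negPart_coordVec, map_smul, map_sub, negPart_hRep, Units.val_mk0]
        module
    rw [this]
    exact L.1.space.smul_mem _ (L.1.space.sub_mem (L.1.space.smul_mem _ hv) h2)

theorem fixedPoints_quadricLines : MulAction.fixedPoints ℂˣ (quadricLines n) =
    sinkLines n ∪ innerLines n ∪ sourceLines n := by
  ext L
  constructor
  · intro hL
    by_cases h1 : L ∈ sinkLines n
    · exact Or.inl (Or.inl h1)
    by_cases h2 : L ∈ sourceLines n
    · exact Or.inr h2
    refine Or.inl (Or.inr (mem_innerLines_iff.2 ?_))
    obtain ⟨u, hu, hu'⟩ := (SetLike.not_le_iff_exists (p := L.1.space) (q := minusSpace n)).1 h1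
    obtain ⟨v, hv, hv'⟩ := (SetLike.not_le_iff_exists (p := L.1.space) (q := plusSpace n)).1 h2
    obtain ⟨h0, -, h3⟩ := parts_mem_of_mem_fixedPoints hL hu
    obtain ⟨h0', h3', -⟩ := parts_mem_of_mem_fixedPoints hL hv
    -- As the middle coordinates vanish, u outside the minus space has a nonzero part of weight -1,
    -- and v outside the plus space has a nonzero part of weight 1; these parts lie on the line.
    refine ⟨_, h3', _, h3, coordVec_mem_minusSpace _, coordVec_mem_plusSpace _, ?_, ?_⟩
    · intro h
      apply hv'
      refine mem_plusSpace.2 ⟨?_, h0'⟩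
      simpa using congrArg posPart h
    · intro h
      apply hu'
      refine mem_minusSpace.2 ⟨h0, ?_⟩
      simpa using congrArg negPart h
  · rintro ((hL | hL) | hL)
    · exact (hasWeightBasis_of_mem_sinkLines hL).mem_fixedPoints
    · exact (hasWeightBasis_of_mem_innerLines hL).mem_fixedPoints
    · exact (hasWeightBasis_of_mem_sourceLines hL).mem_fixedPoints

theorem disjoint_sinkLines_innerLines : Disjoint (sinkLines n) (innerLines n) := by
  refine Set.disjoint_left.2 fun L hL hL' => ?_
  obtain ⟨_, _, y, hy, _, hyp, _, hy0⟩ := mem_innerLines_iff.1 hL'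
  exact hy0 (minusSpace_inf_plusSpace (hL hy) hyp)

theorem disjoint_innerLines_sourceLines : Disjoint (innerLines n) (sourceLines n) := by
  refine Set.disjoint_left.2 fun L hL' hL => ?_
  obtain ⟨x, hx, _, _, hxm, _, hx0, _⟩ := mem_innerLines_iff.1 hL'
  exact hx0 (minusSpace_inf_plusSpace hxm (hL hx))

theorem disjoint_sinkLines_sourceLines : Disjoint (sinkLines n) (sourceLines n) := by
  refine Set.disjoint_left.2 fun L hL hL' => ?_
  obtain ⟨u, hu, v, _, h⟩ := L.1.exists_pair
  refine h ?_
  rw [minusSpace_inf_plusSpace (hL hu) (hL' hu), ← zero_smul ℂ (0 : Coord n), wedge_smul_left,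
    zero_smul]

end FixedLocus

/-! ### Weights of a linearized embedding -/

/-- The norms at t = 2 already distinguish the exponents. -/
theorem zpow_unit_injective {k l : ℤ} (h : ∀ t : ℂˣ, t ^ k = t ^ l) : k = l := by
  have h2 := congrArg (fun z : ℂˣ => ‖(z : ℂ)‖) (h (Units.mk0 2 two_ne_zero))
  simp only [Units.val_zpow_eq_zpow_val, Units.val_mk0, norm_zpow, Complex.norm_ofNat] at h2
  exact zpow_right_injective₀ (by norm_num) (by norm_num) h2

section Weights

variable {E : Type*} [AddCommGroup E] [Module ℂ E]

/-- A linear form on which `ℂ*` acts with weight `k`. -/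
def IsWeightForm (ρ : Representation ℂ ℂˣ E) (φ : Module.Dual ℂ E) (k : ℤ) : Prop :=
  ∀ (t : ℂˣ) (v : E), φ (ρ t v) = ((t ^ k : ℂˣ) : ℂ) * φ v

/-- In a rational representation, the weight forms separate the points. -/
theorem IsRational.exists_isWeightForm {ρ : Representation ℂ ℂˣ E} (hρ : IsRational ρ) {v : E}
    (hv : v ≠ 0) : ∃ φ k, IsWeightForm ρ φ k ∧ φ v ≠ 0 := by
  have hb := Module.Basis.ofSpan_subset hρ.ge
  have h : ∀ i, ∃ k : ℤ, ∀ t : ℂˣ, ρ t (Module.Basis.ofSpan hρ.ge i) =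
      ((t ^ k : ℂˣ) : ℂ) • Module.Basis.ofSpan hρ.ge i := fun i => hb ⟨i, rfl⟩
  choose κ hκ using h
  generalize Module.Basis.ofSpan hρ.ge = b at hκ
  obtain ⟨i, hi⟩ : ∃ i, b.coord i v ≠ 0 := by
    by_contra! h
    exact hv (b.forall_coord_eq_zero_iff.1 h)
  refine ⟨b.coord i, κ i, fun t w => ?_, hi⟩
  have : (b.coord i).comp (ρ t) = ((t ^ κ i : ℂˣ) : ℂ) • b.coord i := by
    refine b.ext fun j => ?_
    rw [LinearMap.comp_apply, hκ, map_smul, LinearMap.smul_apply]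
    by_cases hij : j = i
    · rw [hij]
    · simp [Module.Basis.coord_apply, hij]
  exact LinearMap.congr_fun this w

/-- The quotient of two linear forms, as a function on a subvariety. -/
theorem regularAt_div {X : Type*} [FunctionSpace X] {e : X → ℙ ℂ E} (he : IsSubvariety e)
    (φ ψ : Module.Dual ℂ E) {x : X} (hx : φ (e x).rep ≠ 0) :
    FunctionSpace.regularAt (fun y => ψ (e y).rep / φ (e y).rep) x := by
  refine he.regularAt_iff.2 ⟨1, MvPolynomial.X ψ, MvPolynomial.X φ,
    MvPolynomial.isHomogeneous_X _ _, MvPolynomial.isHomogeneous_X _ _, ?_, ?_⟩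
  · rwa [polyEval_X]
  · intro y _
    rw [polyEval_X, polyEval_X]

theorem isOpen_dual_ne_zero {X : Type*} [FunctionSpace X] {e : X → ℙ ℂ E} (he : IsSubvariety e)
    (φ : Module.Dual ℂ E) : IsOpen {x | φ (e x).rep ≠ 0} := by
  have := he.isOpen_polyEval_ne_zero (MvPolynomial.isHomogeneous_X ℂ φ)
  simpa only [polyEval_X] using this

end Weights

/-! ### Functions on ℙ¹ that are powers of `t` on ℂ* -/

section Line

/-- A polynomial function on `ℂ²`, along `s ↦ (a + s b, c + s d)`. -/
theorem exists_polynomial_pair (P : MvPolynomial (Module.Dual ℂ (Fin 2 → ℂ)) ℂ) (a b c d : ℂ) :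
    ∃ p : Polynomial ℂ, ∀ s, p.eval s = polyEval P ![a + s * b, c + s * d] := by
  obtain ⟨p, hp⟩ := exists_polynomial_line P ![a, c] ![b, d]
  refine ⟨p, fun s => ?_⟩
  rw [hp]
  congr 1
  ext i
  fin_cases i <;> simp

/-- A nonempty open subset of `ℙ¹` meets `ℂ*`. -/
theorem exists_pointP1_mem {U : Set (ℙ ℂ (Fin 2 → ℂ))} (hU : IsOpen U) {x : ℙ ℂ (Fin 2 → ℂ)}
    (hx : x ∈ U) : ∃ t : ℂˣ, pointP1 1 t (by simp) ∈ U := by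
  obtain ⟨d, P, hP, hPx, hPU⟩ := exists_polyEval_ne_zero_subset hU hx
  let Q : MvPolynomial (Module.Dual ℂ (Fin 2 → ℂ)) ℂ :=
    MvPolynomial.X (LinearMap.proj (R := ℂ) (φ := fun _ : Fin 2 => ℂ) 0) *
      MvPolynomial.X (LinearMap.proj (R := ℂ) (φ := fun _ : Fin 2 => ℂ) 1)
  obtain ⟨u, hPu, hQu⟩ := exists_polyEval_ne_zero (Q := Q) (w := ![1, 1]) hPx
    (by simp [Q, polyEval_mul, polyEval_X])
  have h0 : u 0 ≠ 0 ∧ u 1 ≠ 0 := by simpa [Q, polyEval_mul, polyEval_X] using hQu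
  have hu : u = u 0 • ![1, u 1 / u 0] := by
    ext i
    fin_cases i <;> simp [h0.1, mul_div_cancel₀]
  refine ⟨Units.mk0 (u 1 / u 0) (div_ne_zero h0.2 h0.1), hPU _ ?_⟩
  rw [pointP1, polyEval_rep_mk_ne_zero hP]
  rw [hu, polyEval_smul hP] at hPu
  exact right_ne_zero_of_mul hPu

/-- A function on `ℙ¹` which is `c t^k` on an open subset of `ℂ*` is regular at `0` only if
`0 ≤ k`. -/
theorem nonneg_of_regularAt_zero {f : ℙ ℂ (Fin 2 → ℂ) → ℂ} {c : ℂ} (hc : c ≠ 0) {k : ℤ}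
    (hf : ∀ t : ℂˣ, f (pointP1 1 t (by simp)) = c * ((t ^ k : ℂˣ) : ℂ))
    (hreg : FunctionSpace.regularAt f (pointP1 1 0 (by simp))) : 0 ≤ k := by
  by_contra! hk
  obtain ⟨m, hm⟩ := Int.eq_ofNat_of_zero_le (neg_nonneg.2 hk.le)
  have hm0 : m ≠ 0 := by rintro rfl; simp at hm; omega
  obtain ⟨d, P, Q, hP, hQ, hQ0, hPQ⟩ := hreg
  rw [pointP1, polyEval_rep_mk_ne_zero hQ] at hQ0
  obtain ⟨p, hp⟩ := exists_polynomial_pair P 1 0 0 1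
  obtain ⟨q, hq⟩ := exists_polynomial_pair Q 1 0 0 1
  -- Here k = -m with m > 0, and p, q are P, Q in the affine coordinate t; the relation c t⁻ᵐ = p /
  -- q is cleared of denominators.
  have key : ∀ t : ℂˣ, q.eval (t : ℂ) ≠ 0 → c * q.eval (t : ℂ) = (t : ℂ) ^ m * p.eval (t : ℂ) := by
    intro t ht
    rw [hq] at ht
    simp only [mul_zero, add_zero, zero_add, mul_one] at ht
    have h1 := hPQ (pointP1 1 t (by simp)) ((polyEval_rep_mk_ne_zero hQ _ _).2 ht)
    rw [hf, pointP1, polyEval_div_rep_mk hP hQ] at h1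
    rw [hp, hq]
    simp only [mul_zero, add_zero, zero_add, mul_one]
    have h2 : ((t ^ k : ℂˣ) : ℂ) * (t : ℂ) ^ m = 1 := by
      rw [← Units.val_pow_eq_pow_val, ← zpow_natCast, ← Units.val_mul, ← zpow_add, ← hm]
      simp
    rw [eq_div_iff ht] at h1
    rw [← h1]
    linear_combination (-c * polyEval Q ![1, (t : ℂ)]) * h2
  -- The factor X q makes the identity trivial at the points where it is not known, namely 0 and the
  -- zeros of q; it is cancelled afterwards, since q(0) ≠ 0.
  have hpoly : Polynomial.X * q * (Polynomial.C c * q) =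
      Polynomial.X * q * (Polynomial.X ^ m * p) := by
    refine Polynomial.funext fun s => ?_
    simp only [Polynomial.eval_mul, Polynomial.eval_X, Polynomial.eval_C, Polynomial.eval_pow]
    by_cases hs : s = 0
    · simp [hs]
    by_cases hqs : q.eval s = 0
    · simp [hqs]
    have := key (Units.mk0 s hs) hqs
    rw [Units.val_mk0] at this
    rw [this]
  have hq0 : q.eval 0 ≠ 0 := by
    rw [hq]
    simpa using hQ0
  have hXq : Polynomial.X * q ≠ 0 := mul_ne_zero Polynomial.X_ne_zero (by
    rintro rfl
    simp at hq0)
  -- At 0 the left side is c q(0) ≠ 0, whereas the right side vanishes because m > 0.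
  have h0 := congrArg (Polynomial.eval 0) (mul_left_cancel₀ hXq hpoly)
  simp [hm0, hc, hq0] at h0

/-- The involution of `ℙ¹` exchanging `0` and `∞`. -/
def swapP1 : ℙ ℂ (Fin 2 → ℂ) → ℙ ℂ (Fin 2 → ℂ) :=
  Projectivization.map (LinearEquiv.funCongrLeft ℂ ℂ (Equiv.swap (0 : Fin 2) 1)).toLinearMap
    (LinearEquiv.injective _)

theorem swapP1_pointP1 (a b : ℂ) (h : ![a, b] ≠ 0) (h' : ![b, a] ≠ 0) :
    swapP1 (pointP1 a b h) = pointP1 b a h' := by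
  rw [swapP1, pointP1, Projectivization.map_mk, pointP1]
  congr 1
  ext i
  fin_cases i <;> simp [LinearEquiv.funCongrLeft_apply, LinearMap.funLeft_apply]

theorem pointP1_inv (t : ℂˣ) : pointP1 t 1 (by simp) = pointP1 1 ((t⁻¹ : ℂˣ) : ℂ) (by simp) := by
  rw [pointP1, pointP1, Projectivization.mk_eq_mk_iff]
  refine ⟨t, ?_⟩
  ext i
  fin_cases i <;> simp [Units.smul_def]

theorem isMorphism_projectivization_map {E F : Type*} [AddCommGroup E] [Module ℂ E]
    [AddCommGroup F] [Module ℂ F] (f : E →ₗ[ℂ] F) (hf : Function.Injective f) :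
    IsMorphism (Projectivization.map f hf) := by
  refine IsSubvariety.id.isMorphism IsSubvariety.id (isPolyMap_linear f) fun x => ?_
  refine ⟨fun h => x.rep_nonzero (hf (h.trans (map_zero f).symm)), ?_⟩
  conv_lhs => rw [← x.mk_rep, Projectivization.map_mk]

theorem isMorphism_swapP1 : IsMorphism swapP1 := isMorphism_projectivization_map _ _

/-- The involution of ℙ¹ replaces t by t⁻¹, hence k by -k, and moves ∞ to 0. -/
theorem nonpos_of_regularAt_infty {f : ℙ ℂ (Fin 2 → ℂ) → ℂ} {c : ℂ} (hc : c ≠ 0) {k : ℤ}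
    (hf : ∀ t : ℂˣ, f (pointP1 1 t (by simp)) = c * ((t ^ k : ℂˣ) : ℂ))
    (hreg : FunctionSpace.regularAt f (pointP1 0 1 (by simp))) : k ≤ 0 := by
  refine neg_nonneg.1 (nonneg_of_regularAt_zero (f := f ∘ swapP1) hc (fun t => ?_) ?_)
  · rw [Function.comp_apply, swapP1_pointP1 _ _ _ (by simp), pointP1_inv, hf]
    simp
  · refine isMorphism_swapP1.pullback _ _ ?_
    rwa [swapP1_pointP1 _ _ _ (by simp)]

end Line

/-! ### Weights at fixed points -/

namespace LinearizedEmbedding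

variable {X : Type*} [FunctionSpace X] [MulAction ℂˣ X]
  {E : Type*} [AddCommGroup E] [Module ℂ E] [FiniteDimensional ℂ E]

theorem isSubvariety (L : LinearizedEmbedding X E) : IsSubvariety L.toFun := L.embedding

theorem exists_rep_smul (L : LinearizedEmbedding X E) (t : ℂˣ) (x : X) :
    ∃ c : ℂˣ, (L.toFun (t • x)).rep = (c : ℂ) • L.rep t (L.toFun x).rep := by
  have h : L.toFun (t • x) = Projectivization.mk ℂ (L.rep t (L.toFun x).rep) (fun h =>
      (L.toFun x).rep_nonzero ((L.rep.apply_bijective t).1 (h.trans (map_zero _).symm))) := by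
    rw [L.equivariant, projAct]
    conv_lhs => rw [← (L.toFun x).mk_rep, Projectivization.map_mk]
  obtain ⟨c, hc⟩ := Projectivization.exists_smul_eq_mk_rep ℂ (L.rep t (L.toFun x).rep) (fun h =>
      (L.toFun x).rep_nonzero ((L.rep.apply_bijective t).1 (h.trans (map_zero _).symm)))
  exact ⟨c, by rw [h, ← hc, Units.smul_def]⟩

/-- `ℂ*` acts on the fibre of `L` at `x` with weight `k`. -/
def WeightAt (L : LinearizedEmbedding X E) (x : X) (k : ℤ) : Prop :=
  ∀ v ∈ (L.toFun x).submodule, ∀ t : ℂˣ, L.rep t v = ((t ^ (-k) : ℂˣ) : ℂ) • v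

variable {L : LinearizedEmbedding X E} {x : X}

theorem rep_mem_submodule (L : LinearizedEmbedding X E) (x : X) :
    (L.toFun x).rep ∈ (L.toFun x).submodule := by
  rw [Projectivization.submodule_eq]
  exact Submodule.mem_span_singleton_self _

theorem weightAt_of_rep {k : ℤ} (h : ∀ t : ℂˣ, L.rep t (L.toFun x).rep =
    ((t ^ (-k) : ℂˣ) : ℂ) • (L.toFun x).rep) : L.WeightAt x k := by
  intro v hv t
  rw [Projectivization.submodule_eq] at hv
  obtain ⟨c, rfl⟩ := Submodule.mem_span_singleton.1 hv
  rw [map_smul, h, smul_comm]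

theorem WeightAt.eq_neg {k l : ℤ} (hk : L.WeightAt x k) {φ : Module.Dual ℂ E}
    (hφ : IsWeightForm L.rep φ l) (hx : φ (L.toFun x).rep ≠ 0) : l = -k := by
  refine zpow_unit_injective fun t => Units.ext ?_
  have h := hφ t (L.toFun x).rep
  rw [hk _ (rep_mem_submodule L x), map_smul, smul_eq_mul] at h
  exact (mul_right_cancel₀ hx h).symm

theorem WeightAt.unique {k l : ℤ} (hk : L.WeightAt x k) (hl : L.WeightAt x l) : k = l := by
  obtain ⟨φ, j, hφ, hx⟩ := L.rational.exists_isWeightForm (L.toFun x).rep_nonzero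
  have h1 := hk.eq_neg hφ hx
  have h2 := hl.eq_neg hφ hx
  omega

/-- Each t scales a representative of a fixed point; a weight form that does not vanish on it reads
off the factor as tʲ. -/
theorem exists_weightAt (hx : x ∈ MulAction.fixedPoints ℂˣ X) : ∃ k, L.WeightAt x k := by
  obtain ⟨φ, j, hφ, hφx⟩ := L.rational.exists_isWeightForm (L.toFun x).rep_nonzero
  refine ⟨-j, weightAt_of_rep fun t => ?_⟩
  obtain ⟨c, hc⟩ := L.exists_rep_smul t x
  rw [hx t] at hc
  have h1 : (c : ℂ) * ((t ^ j : ℂˣ) : ℂ) = 1 := by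
    have h := congrArg φ hc
    rw [map_smul, hφ, smul_eq_mul, ← mul_assoc] at h
    exact (mul_right_cancel₀ hφx ((one_mul _).trans h)).symm
  rw [neg_neg]
  conv_rhs => rw [hc, smul_smul, mul_comm, h1, one_smul]

/-- The weight is constant on irreducible subsets of the fixed locus. -/
theorem exists_hasWeight (L : LinearizedEmbedding X E) {Y : Set X}
    (hY : Y ⊆ MulAction.fixedPoints ℂˣ X) (hirr : IsIrreducible Y) : ∃ k, L.HasWeight Y k := by
  obtain ⟨x, hx⟩ := hirr.1
  obtain ⟨k, hk⟩ := L.exists_weightAt (hY hx)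
  refine ⟨k, fun y hy => ?_⟩
  obtain ⟨l, hl⟩ := L.exists_weightAt (hY hy)
  obtain ⟨φ, i, hφ, hφx⟩ := L.rational.exists_isWeightForm (L.toFun x).rep_nonzero
  obtain ⟨ψ, j, hψ, hψy⟩ := L.rational.exists_isWeightForm (L.toFun y).rep_nonzero
  -- The two nonvanishing sets meet in Y by irreducibility; the weight at a common point z is
  -- determined by φ and also by ψ, so it agrees with the weights at x and at y.
  obtain ⟨z, hz, hφz, hψz⟩ := hirr.2 _ _ (isOpen_dual_ne_zero L.isSubvariety φ)
    (isOpen_dual_ne_zero L.isSubvariety ψ) ⟨x, hx, hφx⟩ ⟨y, hy, hψy⟩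
  obtain ⟨m, hm⟩ := L.exists_weightAt (hY hz)
  have h1 := hk.eq_neg hφ hφx
  have h2 := hl.eq_neg hψ hψy
  have h3 := hm.eq_neg hφ hφz
  have h4 := hm.eq_neg hψ hψz
  obtain rfl : k = l := by omega
  exact hl

/-! ### Weights of the limits of an orbit -/

section Limit

variable {γ : ℙ ℂ (Fin 2 → ℂ) → X} {φ ψ : Module.Dual ℂ E} {i j : ℤ}

/-- The open set where φ does not vanish along γ contains p and so meets ℂ*; along the orbit a
weight form changes only by nonzero factors. -/
theorem dual_rep_ne_zero_of_limit (hγ : ExtendsOrbit x γ) (hφ : IsWeightForm L.rep φ i)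
    {p : ℙ ℂ (Fin 2 → ℂ)} (hp : φ (L.toFun (γ p)).rep ≠ 0) : φ (L.toFun x).rep ≠ 0 := by
  obtain ⟨t, ht⟩ := exists_pointP1_mem
    ((isOpen_dual_ne_zero L.isSubvariety φ).preimage hγ.1.continuous) hp
  obtain ⟨c, hc⟩ := L.exists_rep_smul t x
  rw [Set.mem_preimage, Set.mem_ofPred_eq, hγ.2, hc, map_smul, hφ, smul_eq_mul] at ht
  exact right_ne_zero_of_mul (right_ne_zero_of_mul ht)

theorem div_dual_orbit (hγ : ExtendsOrbit x γ) (hφ : IsWeightForm L.rep φ i)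
    (hψ : IsWeightForm L.rep ψ j) (t : ℂˣ) :
    ψ (L.toFun (γ (pointP1 1 t (by simp)))).rep / φ (L.toFun (γ (pointP1 1 t (by simp)))).rep =
      ψ (L.toFun x).rep / φ (L.toFun x).rep * ((t ^ (j - i) : ℂˣ) : ℂ) := by
  obtain ⟨c, hc⟩ := L.exists_rep_smul t x
  rw [hγ.2, hc, map_smul, map_smul, hφ, hψ, smul_eq_mul, smul_eq_mul,
    mul_div_mul_left _ _ c.ne_zero, zpow_sub, Units.val_mul, Units.val_inv_eq_inv_val]
  field_simp

/-- Take a weight form φ that is nonzero at the limit; its weight is -k. Then ψ/φ is regular there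
and equals a nonzero constant times t^(j + k) along the orbit, so the exponent cannot be negative.
-/
theorem neg_le_of_limit_zero (hγ : ExtendsOrbit x γ) {k : ℤ}
    (hk : L.WeightAt (γ (pointP1 1 0 (by simp))) k) (hψ : IsWeightForm L.rep ψ j)
    (hx : ψ (L.toFun x).rep ≠ 0) : -k ≤ j := by
  obtain ⟨φ, i, hφ, hφy⟩ := L.rational.exists_isWeightForm
    (L.toFun (γ (pointP1 1 0 (by simp)))).rep_nonzero
  have h := nonneg_of_regularAt_zero
    (div_ne_zero hx (dual_rep_ne_zero_of_limit hγ hφ hφy)) (div_dual_orbit hγ hφ hψ)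
    (hγ.1.pullback _ _ (regularAt_div L.isSubvariety φ ψ hφy))
  have := hk.eq_neg hφ hφy
  omega

theorem le_neg_of_limit_infty (hγ : ExtendsOrbit x γ) {k : ℤ}
    (hk : L.WeightAt (γ (pointP1 0 1 (by simp))) k) (hψ : IsWeightForm L.rep ψ j)
    (hx : ψ (L.toFun x).rep ≠ 0) : j ≤ -k := by
  obtain ⟨φ, i, hφ, hφy⟩ := L.rational.exists_isWeightForm
    (L.toFun (γ (pointP1 0 1 (by simp)))).rep_nonzero
  have h := nonpos_of_regularAt_infty
    (div_ne_zero hx (dual_rep_ne_zero_of_limit hγ hφ hφy)) (div_dual_orbit hγ hφ hψ)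
    (hγ.1.pullback _ _ (regularAt_div L.isSubvariety φ ψ hφy))
  have := hk.eq_neg hφ hφy
  omega

/-- The weight strictly decreases along a nontrivial orbit, from the limit at `0` to the limit at
`∞`. -/
theorem weight_infty_lt_weight_zero (hγ : ExtendsOrbit x γ) {k l : ℤ}
    (hk : L.WeightAt (γ (pointP1 1 0 (by simp))) k)
    (hl : L.WeightAt (γ (pointP1 0 1 (by simp))) l)
    (hx : x ∉ MulAction.fixedPoints ℂˣ X) : l < k := by
  by_contra! hkl
  refine hx fun t => L.injective ?_
  have h : L.rep t (L.toFun x).rep = ((t ^ (-k) : ℂˣ) : ℂ) • (L.toFun x).rep := by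
    -- A weight form φ of weight j that detects the difference is nonzero at x, so -k ≤ j ≤ -l ≤ -k;
    -- but a form of weight -k cannot detect it.
    by_contra hne
    obtain ⟨φ, j, hφ, hφv⟩ := L.rational.exists_isWeightForm (sub_ne_zero.2 hne)
    rw [map_sub, hφ, map_smul, smul_eq_mul, ← sub_mul] at hφv
    have hφx := right_ne_zero_of_mul hφv
    have h1 := neg_le_of_limit_zero hγ hk hφ hφx
    have h2 := le_neg_of_limit_infty hγ hl hφ hφx
    obtain rfl : j = -k := by omega
    simp at hφv
  obtain ⟨c, hc⟩ := L.exists_rep_smul t x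
  rw [h, smul_smul] at hc
  rw [← (L.toFun (t • x)).mk_rep, ← (L.toFun x).mk_rep, Projectivization.mk_eq_mk_iff']
  exact ⟨_, hc.symm⟩

end Limit

end LinearizedEmbedding

/-! ### Irreducible components of the fixed locus -/

section Components

variable {n : ℕ}

theorem IsSubvariety.quadricLines : IsSubvariety (fun L : quadricLines n => plucker L.1) :=
  isSubvariety_plucker_coe _

theorem isPolyMap_zero {E F : Type*} [AddCommGroup E] [Module ℂ E] [AddCommGroup F] [Module ℂ F]
    (d : ℕ) : IsPolyMap d (fun _ : E => (0 : F)) := fun φ =>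
  ⟨0, MvPolynomial.isHomogeneous_zero _ _ _, fun _ => by simp [polyEval]⟩

/-- The linear map with coordinates of weights `1`, `0` and `-1`. -/
def coordVecₗ : ((Fin n → ℂ) × ℂ × (Fin n → ℂ)) →ₗ[ℂ] Coord n where
  toFun p := coordVec p.1 p.2.1 p.2.2
  map_add' p q := coord_ext (by simp) (by simp) (by simp)
  map_smul' c p := coord_ext (by simp) (by simp) (by simp)

theorem IsPolyMap.coordVec {E : Type*} [AddCommGroup E] [Module ℂ E] {d : ℕ}
    {α : E → Fin n → ℂ} {β : E → ℂ} {δ : E → Fin n → ℂ} (hα : IsPolyMap d α)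
    (hβ : IsPolyMap d β) (hδ : IsPolyMap d δ) :
    IsPolyMap d (fun a => coordVec (α a) (β a) (δ a)) := by
  have h := ((hα.linear_comp (coordVecₗ ∘ₗ LinearMap.inl ℂ _ _)).add
    (hβ.linear_comp (coordVecₗ ∘ₗ LinearMap.inr ℂ _ _ ∘ₗ LinearMap.inl ℂ _ _))).add
    (hδ.linear_comp (coordVecₗ ∘ₗ LinearMap.inr ℂ _ _ ∘ₗ LinearMap.inr ℂ _ _))
  convert h using 2 with a
  exact coord_ext (by simp [coordVecₗ]) (by simp [coordVecₗ]) (by simp [coordVecₗ])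

/-- The lines in ℙ(U) are parametrized by U × U through u ∧ v. -/
theorem isPreirreducible_linesIn {U : Submodule ℂ (Coord n)} (hU : linesIn U ⊆ quadricLines n) :
    IsPreirreducible {L : quadricLines n | L.1 ∈ linesIn U} := by
  refine IsSubvariety.quadricLines.isPreirreducible
    (Φ := fun p : U × U => wedge (p.1 : Coord n) p.2)
    (isPolyMap_wedge (isPolyMap_linear (U.subtype ∘ₗ LinearMap.fst ℂ U U))
      (isPolyMap_linear (U.subtype ∘ₗ LinearMap.snd ℂ U U))) ?_ ?_
  · intro p h
    have hL : LineGrassmannian.ofPair (p.1 : Coord n) p.2 h ∈ linesIn U := by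
      refine Submodule.span_le.2 ?_
      rintro x (rfl | rfl)
      exacts [p.1.2, p.2.2]
    exact ⟨⟨_, hU hL⟩, hL, plucker_eq_mk _ (LineGrassmannian.left_mem_ofPair h)
      (LineGrassmannian.right_mem_ofPair h) h⟩
  · intro L hL
    obtain ⟨u, hu, v, hv, h⟩ := L.1.exists_pair
    exact ⟨(⟨u, hL hu⟩, ⟨v, hL hv⟩), h, plucker_eq_mk _ hu hv h⟩

theorem wedge_ne_zero_of_map {V W : Type*} [AddCommGroup V] [Module ℂ V] [AddCommGroup W]
    [Module ℂ W] (f : V →ₗ[ℂ] W) {u v : V} (h : wedge (f u) (f v) ≠ 0) : wedge u v ≠ 0 :=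
  fun h0 => h (by rw [← map_wedge, h0, map_zero])

theorem wedge_single_ne_zero {i j : Fin n} (hij : i ≠ j) :
    wedge (Pi.single i 1 : Fin n → ℂ) (Pi.single j 1) ≠ 0 := by
  rw [wedge_ne_zero_iff']
  intro s t h
  constructor
  · simpa [hij] using congrFun h i
  · simpa [hij.symm] using congrFun h j

theorem isIrreducible_sinkLines (hn : 2 ≤ n) : IsIrreducible (sinkLines n) := by
  refine ⟨?_, isPreirreducible_linesIn linesIn_minusSpace_subset⟩
  have h : wedge (coordVec (Pi.single ⟨0, by omega⟩ 1) 0 0 : Coord n)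
      (coordVec (Pi.single ⟨1, by omega⟩ 1) 0 0) ≠ 0 :=
    wedge_ne_zero_of_map posPart (by simpa using wedge_single_ne_zero (by simp))
  have hL : LineGrassmannian.ofPair _ _ h ∈ linesIn (minusSpace n) := by
    refine Submodule.span_le.2 ?_
    rintro x (rfl | rfl) <;> exact coordVec_mem_minusSpace _
  exact ⟨⟨_, linesIn_minusSpace_subset hL⟩, hL⟩

theorem isIrreducible_sourceLines (hn : 2 ≤ n) : IsIrreducible (sourceLines n) := by
  refine ⟨?_, isPreirreducible_linesIn linesIn_plusSpace_subset⟩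
  have h : wedge (coordVec 0 0 (Pi.single ⟨0, by omega⟩ 1) : Coord n)
      (coordVec 0 0 (Pi.single ⟨1, by omega⟩ 1)) ≠ 0 :=
    wedge_ne_zero_of_map negPart (by simpa using wedge_single_ne_zero (by simp))
  have hL : LineGrassmannian.ofPair _ _ h ∈ linesIn (plusSpace n) := by
    refine Submodule.span_le.2 ?_
    rintro x (rfl | rfl) <;> exact coordVec_mem_plusSpace _
  exact ⟨⟨_, linesIn_plusSpace_subset hL⟩, hL⟩

theorem coordVec_pos_ne_zero {a : Fin n → ℂ} (ha : a ≠ 0) : coordVec a 0 0 ≠ 0 := fun h =>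
  ha (by simpa using congrArg posPart h)

theorem coordVec_neg_ne_zero {b : Fin n → ℂ} (hb : b ≠ 0) : coordVec 0 0 b ≠ 0 := fun h =>
  hb (by simpa using congrArg negPart h)

theorem wedge_coordVec_ne_zero {a b : Fin n → ℂ} (ha : a ≠ 0) (hb : b ≠ 0) :
    wedge (coordVec a 0 0) (coordVec 0 0 b) ≠ 0 :=
  wedge_ne_zero_of_mem (coordVec_mem_minusSpace a) (coordVec_pos_ne_zero ha)
    (coordVec_mem_plusSpace b) (coordVec_neg_ne_zero hb)

/-- The line joining the point `a` of `ℙ^{n-1}_-` to the point `b` of `ℙ^{n-1}_+`. -/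
def innerLine (a b : Fin n → ℂ) (ha : a ≠ 0) (hb : b ≠ 0) (hab : a ⬝ᵥ b = 0) :
    innerLines n :=
  ⟨quadricLine (coordVec a 0 0) (coordVec 0 0 b) (wedge_coordVec_ne_zero ha hb)
      (quadric_of_mem_minusSpace (coordVec_mem_minusSpace a))
      (quadric_of_mem_plusSpace (coordVec_mem_plusSpace b))
      (by simp [quadricPolar, hab]),
    mem_innerLines_iff.2 ⟨_, LineGrassmannian.left_mem_ofPair (wedge_coordVec_ne_zero ha hb), _,
      LineGrassmannian.right_mem_ofPair (wedge_coordVec_ne_zero ha hb), coordVec_mem_minusSpace a,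
      coordVec_mem_plusSpace b, coordVec_pos_ne_zero ha, coordVec_neg_ne_zero hb⟩⟩

theorem plucker_innerLine (a b : Fin n → ℂ) (ha : a ≠ 0) (hb : b ≠ 0) (hab : a ⬝ᵥ b = 0) :
    plucker (innerLine a b ha hb hab).1.1 =
      Projectivization.mk ℂ (wedge (coordVec a 0 0) (coordVec 0 0 b))
        (wedge_coordVec_ne_zero ha hb) :=
  plucker_eq_mk _ (LineGrassmannian.left_mem_ofPair (wedge_coordVec_ne_zero ha hb))
    (LineGrassmannian.right_mem_ofPair (wedge_coordVec_ne_zero ha hb)) _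

theorem eq_innerLine {L : quadricLines n} (hL : L ∈ innerLines n) :
    ∃ (a b : Fin n → ℂ) (ha : a ≠ 0) (hb : b ≠ 0) (hab : a ⬝ᵥ b = 0),
      L = (innerLine a b ha hb hab).1 := by
  obtain ⟨x, hx, y, hy, hxm, hyp, hx0, hy0⟩ := mem_innerLines_iff.1 hL
  have h := quadricPolar_eq_zero L.2 hx hy
  obtain ⟨a, rfl⟩ : ∃ a, x = coordVec a 0 0 := ⟨_, eq_coordVec_of_mem_minusSpace hxm⟩
  obtain ⟨b, rfl⟩ : ∃ b, y = coordVec 0 0 b := ⟨_, eq_coordVec_of_mem_plusSpace hyp⟩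
  have h0 : coordVec (0 : Fin n → ℂ) 0 0 = 0 := coord_ext (by simp) (by simp) (by simp)
  have ha : a ≠ 0 := by
    rintro rfl
    exact hx0 h0
  have hb : b ≠ 0 := by
    rintro rfl
    exact hy0 h0
  have hab : a ⬝ᵥ b = 0 := by simpa [quadricPolar] using h
  exact ⟨a, b, ha, hb, hab, Subtype.ext (LineGrassmannian.ext_of_mem
    (wedge_coordVec_ne_zero ha hb) hx hy
    (LineGrassmannian.left_mem_ofPair (wedge_coordVec_ne_zero ha hb))
    (LineGrassmannian.right_mem_ofPair (wedge_coordVec_ne_zero ha hb)))⟩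

/-- A skew matrix sends p to a vector orthogonal to p. Pairs of this form satisfy the incidence
equation identically, which frees the inner lines of constraints on their parameters. -/
theorem dotProduct_sub_transpose_mulVec (C : Matrix (Fin n) (Fin n) ℂ) (p : Fin n → ℂ) :
    p ⬝ᵥ (C - C.transpose).mulVec p = 0 := by
  rw [Matrix.sub_mulVec, dotProduct_sub, Matrix.dotProduct_mulVec p C.transpose,
    Matrix.vecMul_transpose, dotProduct_comm, sub_self]

theorem exists_dotProduct_eq_one {p : Fin n → ℂ} (hp : p ≠ 0) : ∃ l : Fin n → ℂ, l ⬝ᵥ p = 1 := by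
  obtain ⟨i, hi⟩ := Function.ne_iff.1 hp
  exact ⟨Pi.single i (p i)⁻¹, by simpa using inv_mul_cancel₀ hi⟩

/-- The inner lines are the image of the vector space of pairs (C, p) under the cubic map sending
(C, p) to the wedge of (p, 0, 0) and (0, 0, (C - Cᵀ)p). -/
theorem isIrreducible_innerLines (hn : 2 ≤ n) : IsIrreducible (innerLines n) := by
  constructor
  · exact ⟨_, (innerLine (Pi.single ⟨0, by omega⟩ 1) (Pi.single ⟨1, by omega⟩ 1) (by simp) (by simp)
      (by simp)).2⟩
  let B : Matrix (Fin n) (Fin n) ℂ →ₗ[ℂ] (Fin n → ℂ) →ₗ[ℂ] (Fin n → ℂ) :=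
    LinearMap.mk₂ ℂ (fun C p => (C - C.transpose).mulVec p)
      (fun C D p => by simp only [Matrix.transpose_add, Matrix.sub_mulVec, Matrix.add_mulVec]; abel)
      (fun c C p => by simp only [Matrix.transpose_smul, Matrix.sub_mulVec, Matrix.smul_mulVec,
        smul_sub])
      (fun C p q => Matrix.mulVec_add _ _ _) (fun c C p => Matrix.mulVec_smul _ _ _)
  have h1 : IsPolyMap 1 (fun a : Matrix (Fin n) (Fin n) ℂ × (Fin n → ℂ) => a.2) :=
    isPolyMap_linear (LinearMap.snd ℂ (Matrix (Fin n) (Fin n) ℂ) (Fin n → ℂ))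
  have h2 : IsPolyMap 2 (fun a : Matrix (Fin n) (Fin n) ℂ × (Fin n → ℂ) =>
      (a.1 - a.1.transpose).mulVec a.2) :=
    IsPolyMap.bilinear B
      (isPolyMap_linear (LinearMap.fst ℂ (Matrix (Fin n) (Fin n) ℂ) (Fin n → ℂ))) h1
  refine IsSubvariety.quadricLines.isPreirreducible
    (isPolyMap_wedge (h1.coordVec (isPolyMap_zero 1) (isPolyMap_zero 1))
      ((isPolyMap_zero 2).coordVec (isPolyMap_zero 2) h2)) ?_ ?_
  · rintro ⟨C, p⟩ h
    have h0 : coordVec (0 : Fin n → ℂ) 0 0 = 0 := coord_ext (by simp) (by simp) (by simp)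
    have hp : p ≠ 0 := by
      rintro rfl
      refine h ?_
      change wedge (coordVec 0 0 0) _ = 0
      rw [h0, ← zero_smul ℂ (0 : Coord n), wedge_smul_left, zero_smul]
    have hq : (C - C.transpose).mulVec p ≠ 0 := by
      intro hq
      refine h ?_
      change wedge _ (coordVec 0 0 ((C - C.transpose).mulVec p)) = 0
      rw [hq, h0, ← zero_smul ℂ (0 : Coord n), wedge_smul_right, zero_smul]
    exact ⟨_, (innerLine p _ hp hq (dotProduct_sub_transpose_mulVec C p)).2,
      plucker_innerLine _ _ _ _ _⟩
  · intro L hL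
    obtain ⟨a, b, ha, hb, hab, rfl⟩ := eq_innerLine hL
    obtain ⟨l, hl⟩ := exists_dotProduct_eq_one ha
    -- With C = b lᵀ the product is b (l·a) - l (b·a), where l·a = 1 and b·a = 0; so every
    -- orthogonal pair is reached.
    have hC : (Matrix.vecMulVec b l - (Matrix.vecMulVec b l).transpose).mulVec a = b := by
      rw [Matrix.transpose_vecMulVec, Matrix.sub_mulVec, Matrix.vecMulVec_mulVec,
        Matrix.vecMulVec_mulVec, hl, dotProduct_comm, hab]
      simp
    have h : wedge (coordVec a 0 0) (coordVec 0 0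
        ((Matrix.vecMulVec b l - (Matrix.vecMulVec b l).transpose).mulVec a)) ≠ 0 := by
      rw [hC]
      exact wedge_coordVec_ne_zero ha hb
    refine ⟨(Matrix.vecMulVec b l, a), h, ?_⟩
    rw [plucker_innerLine]
    simp only [hC]

theorem hasWeight_sinkLines : (pluckerBundle n).HasWeight (sinkLines n) (-2) :=
  hasWeight_pluckerBundle (fun _ => hasWeightBasis_of_mem_sinkLines) (by norm_num)

theorem hasWeight_innerLines : (pluckerBundle n).HasWeight (innerLines n) 0 :=
  hasWeight_pluckerBundle (fun _ => hasWeightBasis_of_mem_innerLines) (by norm_num)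

theorem hasWeight_sourceLines : (pluckerBundle n).HasWeight (sourceLines n) 2 :=
  hasWeight_pluckerBundle (fun _ => hasWeightBasis_of_mem_sourceLines) (by norm_num)

/-- The Plücker weight is constant on Z, and its value -2, 0 or 2 tells which piece contains Z. -/
theorem subset_of_isIrreducible {Z : Set (quadricLines n)}
    (hZ : Z ⊆ MulAction.fixedPoints ℂˣ (quadricLines n)) (hirr : IsIrreducible Z) :
    Z ⊆ sinkLines n ∨ Z ⊆ innerLines n ∨ Z ⊆ sourceLines n := by
  obtain ⟨k, hk⟩ := (pluckerBundle n).exists_hasWeight hZ hirr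
  have key : ∀ L ∈ Z, (L ∈ sinkLines n ∧ k = -2) ∨ (L ∈ innerLines n ∧ k = 0) ∨
      (L ∈ sourceLines n ∧ k = 2) := by
    intro L hL
    have hkL : (pluckerBundle n).WeightAt L k := hk L hL
    rcases fixedPoints_quadricLines ▸ hZ hL with (h | h) | h
    · exact Or.inl ⟨h, hkL.unique (hasWeight_sinkLines L h)⟩
    · exact Or.inr (Or.inl ⟨h, hkL.unique (hasWeight_innerLines L h)⟩)
    · exact Or.inr (Or.inr ⟨h, hkL.unique (hasWeight_sourceLines L h)⟩)
  obtain ⟨L, hL⟩ := hirr.1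
  rcases key L hL with ⟨_, rfl⟩ | ⟨_, rfl⟩ | ⟨_, rfl⟩
  · exact Or.inl fun M hM => by simpa using key M hM
  · exact Or.inr (Or.inl fun M hM => by simpa using key M hM)
  · exact Or.inr (Or.inr fun M hM => by simpa using key M hM)

theorem fixedComponents_quadricLines (hn : 2 ≤ n) :
    fixedComponents (quadricLines n) = {sinkLines n, innerLines n, sourceLines n} := by
  have h1 := isIrreducible_sinkLines hn
  have h2 := isIrreducible_innerLines hn
  have h3 := isIrreducible_sourceLines hn
  have s1 : sinkLines n ⊆ MulAction.fixedPoints ℂˣ (quadricLines n) := by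
    rw [fixedPoints_quadricLines]
    exact fun L hL => Or.inl (Or.inl hL)
  have s2 : innerLines n ⊆ MulAction.fixedPoints ℂˣ (quadricLines n) := by
    rw [fixedPoints_quadricLines]
    exact fun L hL => Or.inl (Or.inr hL)
  have s3 : sourceLines n ⊆ MulAction.fixedPoints ℂˣ (quadricLines n) := by
    rw [fixedPoints_quadricLines]
    exact fun L hL => Or.inr hL
  have key : ∀ {A B : Set (quadricLines n)}, A.Nonempty → Disjoint A B → ¬ A ⊆ B :=
    fun hA hd h => hA.ne_empty (hd.eq_bot_of_le h)
  have d12 := disjoint_sinkLines_innerLines (n := n)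
  have d23 := disjoint_innerLines_sourceLines (n := n)
  have d13 := disjoint_sinkLines_sourceLines (n := n)
  ext Y
  simp only [Set.mem_insert_iff, Set.mem_singleton_iff]
  constructor
  · intro hY
    rcases subset_of_isIrreducible hY.1.1 hY.1.2 with h | h | h
    · exact Or.inl (h.antisymm (hY.2 ⟨s1, h1⟩ h))
    · exact Or.inr (Or.inl (h.antisymm (hY.2 ⟨s2, h2⟩ h)))
    · exact Or.inr (Or.inr (h.antisymm (hY.2 ⟨s3, h3⟩ h)))
  · rintro (rfl | rfl | rfl)
    · refine ⟨⟨s1, h1⟩, fun Z hZ hle => ?_⟩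
      rcases subset_of_isIrreducible hZ.1 hZ.2 with h | h | h
      · exact h
      · exact absurd (hle.trans h) (key h1.1 d12)
      · exact absurd (hle.trans h) (key h1.1 d13)
    · refine ⟨⟨s2, h2⟩, fun Z hZ hle => ?_⟩
      rcases subset_of_isIrreducible hZ.1 hZ.2 with h | h | h
      · exact absurd (hle.trans h) (key h2.1 d12.symm)
      · exact h
      · exact absurd (hle.trans h) (key h2.1 d23)
    · refine ⟨⟨s3, h3⟩, fun Z hZ hle => ?_⟩
      rcases subset_of_isIrreducible hZ.1 hZ.2 with h | h | h
      · exact absurd (hle.trans h) (key h3.1 d13.symm)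
      · exact absurd (hle.trans h) (key h3.1 d23.symm)
      · exact h

end Components

/-! ### Rational curves on the variety of lines -/

section Curves

variable {n : ℕ}

theorem IsPolyMap.map_smul {E F : Type*} [AddCommGroup E] [Module ℂ E] [AddCommGroup F]
    [Module ℂ F] {d : ℕ} {Φ : E → F} (hΦ : IsPolyMap d Φ) (c : ℂ) (v : E) :
    Φ (c • v) = c ^ d • Φ v := by
  rw [← sub_eq_zero, ← Module.forall_dual_apply_eq_zero_iff ℂ]
  intro φ
  obtain ⟨P, hP, hP'⟩ := hΦ φ
  rw [map_sub, _root_.map_smul, ← hP', ← hP', polyEval_smul hP, smul_eq_mul, sub_self]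

theorem isPolyMap_coord_smul {F : Type*} [AddCommGroup F] [Module ℂ F] (i : Fin 2) (a : F) :
    IsPolyMap 1 (fun z : Fin 2 → ℂ => z i • a) :=
  isPolyMap_linear ((LinearMap.toSpanSingleton ℂ F a).comp
    (LinearMap.proj (R := ℂ) (φ := fun _ : Fin 2 => ℂ) i))

theorem isPolyMap_coord_mul_smul {F : Type*} [AddCommGroup F] [Module ℂ F] (i j : Fin 2) (a : F) :
    IsPolyMap 2 (fun z : Fin 2 → ℂ => (z i * z j) • a) :=
  (IsPolyMap.bilinear (LinearMap.mul ℂ ℂ)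
    (isPolyMap_linear (LinearMap.proj (R := ℂ) (φ := fun _ : Fin 2 => ℂ) i))
    (isPolyMap_linear (LinearMap.proj (R := ℂ) (φ := fun _ : Fin 2 => ℂ) j))).linear_comp
      (LinearMap.toSpanSingleton ℂ F a)

theorem plucker_quadricLine {u v : Coord n} (h : wedge u v ≠ 0) (hu : quadric n u = 0)
    (hv : quadric n v = 0) (huv : quadricPolar u v = 0) :
    plucker (quadricLine u v h hu hv huv).1 = Projectivization.mk ℂ (wedge u v) h :=
  plucker_eq_mk _ (LineGrassmannian.left_mem_ofPair h) (LineGrassmannian.right_mem_ofPair h) h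

theorem eq_quadricLine {L : quadricLines n} {u v : Coord n} (hu : u ∈ L.1.space)
    (hv : v ∈ L.1.space) (h : wedge u v ≠ 0) :
    L = quadricLine u v h (L.2 u hu) (L.2 v hv) (quadricPolar_eq_zero L.2 hu hv) :=
  Subtype.ext (LineGrassmannian.ext_of_mem h hu hv (LineGrassmannian.left_mem_ofPair h)
    (LineGrassmannian.right_mem_ofPair h))

/-- A pair of homogeneous polynomial maps from `ℂ²` spanning a line of the quadric at each nonzero
point defines a curve `ℙ¹ → X`. -/
theorem exists_extendsOrbit {L : quadricLines n} {d m : ℕ} {u v : (Fin 2 → ℂ) → Coord n}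
    (hu : IsPolyMap d u) (hv : IsPolyMap m v) (huv : ∀ z, z ≠ 0 → wedge (u z) (v z) ≠ 0)
    (hqu : ∀ z, quadric n (u z) = 0) (hqv : ∀ z, quadric n (v z) = 0)
    (hquv : ∀ z, quadricPolar (u z) (v z) = 0)
    (hL : ∀ t : ℂˣ, u ![1, t] ∈ (t • L).1.space ∧ v ![1, t] ∈ (t • L).1.space) :
    ∃ γ, ExtendsOrbit L γ ∧ ∀ a b (h : ![a, b] ≠ 0),
      γ (pointP1 a b h) = quadricLine (u ![a, b]) (v ![a, b]) (huv _ h) (hqu _) (hqv _)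
        (hquv _) := by
  let γ : ℙ ℂ (Fin 2 → ℂ) → quadricLines n := fun p =>
    quadricLine (u p.rep) (v p.rep) (huv _ p.rep_nonzero) (hqu _) (hqv _) (hquv _)
  -- Replacing z by a multiple rescales u z and v z separately, so the line they span depends only
  -- on the point of ℙ¹, even when the degrees differ.
  have hγ : ∀ a b (h : ![a, b] ≠ 0), γ (pointP1 a b h) =
      quadricLine (u ![a, b]) (v ![a, b]) (huv _ h) (hqu _) (hqv _) (hquv _) := by
    intro a b h
    obtain ⟨c, hc⟩ := Projectivization.exists_smul_eq_mk_rep ℂ ![a, b] h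
    symm
    refine Subtype.ext (LineGrassmannian.ext_of_mem (huv _ (pointP1 a b h).rep_nonzero) ?_ ?_
      (LineGrassmannian.left_mem_ofPair (huv _ (pointP1 a b h).rep_nonzero))
      (LineGrassmannian.right_mem_ofPair (huv _ (pointP1 a b h).rep_nonzero)))
    · rw [pointP1, ← hc, Units.smul_def, hu.map_smul]
      exact Submodule.smul_mem _ _ (LineGrassmannian.left_mem_ofPair (huv _ h))
    · rw [pointP1, ← hc, Units.smul_def, hv.map_smul]
      exact Submodule.smul_mem _ _ (LineGrassmannian.right_mem_ofPair (huv _ h))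
  refine ⟨γ, ⟨?_, fun t => ?_⟩, hγ⟩
  · exact IsSubvariety.id.isMorphism IsSubvariety.quadricLines (isPolyMap_wedge hu hv)
      fun p => ⟨huv _ p.rep_nonzero, plucker_quadricLine _ _ _ _⟩
  · rw [hγ]
    exact (eq_quadricLine (hL t).1 (hL t).2 _).symm

/-- The orbit of `x`, in homogeneous coordinates `[z₀ : z₁]` with `t = z₁ / z₀`. -/
def stretch (x : Coord n) (z : Fin 2 → ℂ) : Coord n :=
  coordVec ((z 1 * z 1) • posPart x) ((z 0 * z 1) • midPart x) ((z 0 * z 0) • negPart x)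

theorem isPolyMap_stretch (x : Coord n) : IsPolyMap 2 (stretch x) :=
  (isPolyMap_coord_mul_smul 1 1 _).coordVec (isPolyMap_coord_mul_smul 0 1 _)
    (isPolyMap_coord_mul_smul 0 0 _)

theorem quadric_stretch (x : Coord n) (z : Fin 2 → ℂ) :
    quadric n (stretch x z) = (z 0 * z 1) ^ 2 * quadric n x := by
  simp only [quadric_eq, stretch, posPart_coordVec, negPart_coordVec, midPart_coordVec,
    smul_dotProduct, dotProduct_smul, smul_eq_mul]
  ring

theorem quadricPolar_stretch (x y : Coord n) (z : Fin 2 → ℂ) :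
    quadricPolar (stretch x z) (stretch y z) = (z 0 * z 1) ^ 2 * quadricPolar x y := by
  simp only [quadricPolar, stretch, posPart_coordVec, negPart_coordVec, midPart_coordVec,
    smul_dotProduct, dotProduct_smul, smul_eq_mul]
  ring

/-- The factor t clears the t⁻¹ in the part of weight -1 and does not affect the spanned line. -/
theorem stretch_one (x : Coord n) (t : ℂˣ) : stretch x ![1, t] = (t : ℂ) • hRep n t x :=
  coord_ext (by simp [stretch, smul_smul]) (by simp [stretch]) (by simp [stretch])

theorem stretch_mem_smul {L : quadricLines n} {x : Coord n} (hx : x ∈ L.1.space) (t : ℂˣ) :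
    stretch x ![1, t] ∈ (t • L).1.space := by
  rw [stretch_one]
  exact Submodule.smul_mem _ _ (hRep_mem_smul t hx)

theorem quadricLine_mem_sinkLines {u v : Coord n} (hu : u ∈ minusSpace n) (hv : v ∈ minusSpace n)
    (h : wedge u v ≠ 0) (h1 : quadric n u = 0) (h2 : quadric n v = 0)
    (h3 : quadricPolar u v = 0) : quadricLine u v h h1 h2 h3 ∈ sinkLines n := by
  refine Submodule.span_le.2 ?_
  rintro x (rfl | rfl)
  exacts [hu, hv]

theorem stretch_infty_mem (x : Coord n) : stretch x ![0, 1] ∈ minusSpace n :=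
  mem_minusSpace.2 (by simp [stretch])

theorem stretch_zero_mem (x : Coord n) : stretch x ![1, 0] ∈ plusSpace n :=
  mem_plusSpace.2 (by simp [stretch])

theorem wedge_smul_smul_ne_zero {V : Type*} [AddCommGroup V] [Module ℂ V] {u v : V} {a b : ℂ}
    (h : wedge u v ≠ 0) (ha : a ≠ 0) (hb : b ≠ 0) : wedge (a • u) (b • v) ≠ 0 := by
  rw [wedge_smul_left, wedge_smul_right]
  exact smul_ne_zero ha (smul_ne_zero hb h)

theorem eq_zero_and_ne_zero_of_ne_zero {z : Fin 2 → ℂ} (hz : z ≠ 0) :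
    z 1 ≠ 0 ∨ (z 1 = 0 ∧ z 0 ≠ 0) := by
  by_contra! h
  refine hz (funext fun i => ?_)
  fin_cases i
  · exact h.2 h.1
  · exact h.1

/-- The line through a point of `ℙ^{n-1}_-` and a general point. -/
theorem exists_curve_of_mem_minusSpace {L : quadricLines n} {u v : Coord n} (hu : u ∈ L.1.space)
    (hv : v ∈ L.1.space) (hum : u ∈ minusSpace n) (huv : wedge (posPart u) (posPart v) ≠ 0)
    (hv0 : negPart v ≠ 0) : ∃ γ, ExtendsOrbit L γ ∧ γ (pointP1 0 1 (by simp)) ∈ sinkLines n ∧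
      γ (pointP1 1 0 (by simp)) ∈ innerLines n := by
  have hu0 : u ≠ 0 := by
    rintro rfl
    rw [map_zero, ← zero_smul ℂ (0 : Fin n → ℂ), wedge_smul_left, zero_smul] at huv
    exact huv rfl
  -- The vector u is kept constant because its stretch would vanish at z₁ = 0. For z₁ ≠ 0 the parts
  -- of weight 1 stay independent; at z₁ = 0 the stretch of v is a nonzero vector of the plus space.
  have hw : ∀ z : Fin 2 → ℂ, z ≠ 0 → wedge u (stretch v z) ≠ 0 := by
    intro z hz
    rcases eq_zero_and_ne_zero_of_ne_zero hz with h | ⟨h, h0⟩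
    · refine wedge_ne_zero_of_map posPart ?_
      rw [stretch, posPart_coordVec, wedge_smul_right]
      exact smul_ne_zero (mul_ne_zero h h) huv
    · refine wedge_ne_zero_of_mem hum hu0 (mem_plusSpace.2 (by simp [stretch, h])) fun h1 => ?_
      have h2 := congrArg negPart h1
      rw [stretch, negPart_coordVec, map_zero] at h2
      exact smul_ne_zero (mul_ne_zero h0 h0) hv0 h2
  have hpol := quadricPolar_eq_zero L.2 hu hv
  obtain ⟨h0, h1⟩ := mem_minusSpace.1 hum
  have hut : ∀ t : ℂˣ, u ∈ (t • L).1.space := fun t => by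
    have := Submodule.smul_mem _ (t : ℂ)⁻¹ (hRep_mem_smul t hu)
    rwa [hRep_of_mem_minusSpace hum, smul_smul, inv_mul_cancel₀ t.ne_zero, one_smul] at this
  obtain ⟨γ, hγ, hγ'⟩ := exists_extendsOrbit (L := L) (isPolyMap_const u) (isPolyMap_stretch v) hw
    (fun _ => L.2 u hu) (fun z => by rw [quadric_stretch, L.2 v hv, mul_zero])
    (fun z => by
      simp only [quadricPolar, h0, h1, dotProduct_zero, mul_zero, zero_mul, add_zero] at hpol
      simp only [quadricPolar, h0, h1, dotProduct_zero, mul_zero, zero_mul, add_zero, stretch,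
        negPart_coordVec, dotProduct_smul, hpol, smul_zero])
    (fun t => ⟨hut t, stretch_mem_smul hv t⟩)
  refine ⟨γ, hγ, ?_, ?_⟩
  · rw [hγ']
    exact quadricLine_mem_sinkLines hum (stretch_infty_mem v) _ _ _ _
  · rw [hγ']
    refine mem_innerLines_iff.2 ⟨u, LineGrassmannian.left_mem_ofPair (hw _ (by simp)), _,
      LineGrassmannian.right_mem_ofPair (hw _ (by simp)), hum, stretch_zero_mem v, hu0,
      fun h => hv0 ?_⟩
    simpa [stretch] using congrArg negPart h

/-- A line with independent parts of weight `1` and independent parts of weight `-1`. -/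
theorem exists_curve_of_wedge_ne_zero {L : quadricLines n} {u v : Coord n} (hu : u ∈ L.1.space)
    (hv : v ∈ L.1.space) (hpos : wedge (posPart u) (posPart v) ≠ 0)
    (hneg : wedge (negPart u) (negPart v) ≠ 0) :
    ∃ γ, ExtendsOrbit L γ ∧ γ (pointP1 0 1 (by simp)) ∈ sinkLines n := by
  -- Independence is seen in the parts of weight 1 where z₁ ≠ 0, and in the parts of weight -1 at z₁
  -- = 0.
  have hw : ∀ z : Fin 2 → ℂ, z ≠ 0 → wedge (stretch u z) (stretch v z) ≠ 0 := by
    intro z hz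
    rcases eq_zero_and_ne_zero_of_ne_zero hz with h | ⟨-, h⟩
    · refine wedge_ne_zero_of_map posPart ?_
      rw [stretch, stretch, posPart_coordVec, posPart_coordVec]
      exact wedge_smul_smul_ne_zero hpos (mul_ne_zero h h) (mul_ne_zero h h)
    · refine wedge_ne_zero_of_map negPart ?_
      rw [stretch, stretch, negPart_coordVec, negPart_coordVec]
      exact wedge_smul_smul_ne_zero hneg (mul_ne_zero h h) (mul_ne_zero h h)
  obtain ⟨γ, hγ, hγ'⟩ := exists_extendsOrbit (L := L) (isPolyMap_stretch u) (isPolyMap_stretch v) hw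
    (fun z => by rw [quadric_stretch, L.2 u hu, mul_zero])
    (fun z => by rw [quadric_stretch, L.2 v hv, mul_zero])
    (fun z => by rw [quadricPolar_stretch, quadricPolar_eq_zero L.2 hu hv, mul_zero])
    (fun t => ⟨stretch_mem_smul hu t, stretch_mem_smul hv t⟩)
  refine ⟨γ, hγ, ?_⟩
  rw [hγ']
  exact quadricLine_mem_sinkLines (stretch_infty_mem u) (stretch_infty_mem v) _ _ _ _

theorem extendsOrbit_const {X : Type*} [FunctionSpace X] [MulAction ℂˣ X] {E : Type*}
    [AddCommGroup E] [Module ℂ E] {e : X → ℙ ℂ E} (he : IsSubvariety e) {x : X}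
    (hx : x ∈ MulAction.fixedPoints ℂˣ X) : ExtendsOrbit x (fun _ => x) := by
  refine ⟨IsSubvariety.id.isMorphism he (isPolyMap_const (e x).rep) fun _ =>
    ⟨(e x).rep_nonzero, (e x).mk_rep.symm⟩, fun t => (hx t).symm⟩

end Curves

/-! ### The sink -/

section Sink

variable {n : ℕ}

/-- With a = 0 the equation a·b + c² = 0 leaves c = 0. -/
theorem mem_plusSpace_of_posPart_eq_zero {L : quadricLines n} {x : Coord n} (hx : x ∈ L.1.space)
    (h : posPart x = 0) : x ∈ plusSpace n := by
  have hq := L.2 x hx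
  rw [quadric_eq, h, zero_dotProduct, zero_add] at hq
  exact mem_plusSpace.2 ⟨h, pow_eq_zero_iff two_ne_zero |>.1 hq⟩

theorem mem_minusSpace_of_negPart_eq_zero {L : quadricLines n} {x : Coord n} (hx : x ∈ L.1.space)
    (h : negPart x = 0) : x ∈ minusSpace n := by
  have hq := L.2 x hx
  rw [quadric_eq, h, dotProduct_zero, zero_add] at hq
  exact mem_minusSpace.2 ⟨pow_eq_zero_iff two_ne_zero |>.1 hq, h⟩

/-- Both sides say that f is injective on the plane with basis u, v. -/
theorem wedge_map_ne_zero_iff {V W : Type*} [AddCommGroup V] [Module ℂ V] [AddCommGroup W]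
    [Module ℂ W] (f : V →ₗ[ℂ] W) {L : LineGrassmannian V} {u v : V} (hu : u ∈ L.space)
    (hv : v ∈ L.space) (h : wedge u v ≠ 0) :
    wedge (f u) (f v) ≠ 0 ↔ ∀ x ∈ L.space, f x = 0 → x = 0 := by
  constructor
  · intro hf x hx hfx
    obtain ⟨a, b, rfl⟩ := (LineGrassmannian.mem_iff hu hv h).1 hx
    rw [map_add, map_smul, map_smul] at hfx
    obtain ⟨rfl, rfl⟩ := wedge_ne_zero_iff'.1 hf a b hfx
    simp
  · intro hf
    refine wedge_ne_zero_iff'.2 fun a b hab => wedge_ne_zero_iff'.1 h a b ?_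
    refine hf _ (L.space.add_mem (L.space.smul_mem _ hu) (L.space.smul_mem _ hv)) ?_
    rw [map_add, map_smul, map_smul, hab]

variable (n) in
/-- The lines of the quadric which do not meet `ℙ^{n-1}_+`. -/
def openCell : Set (quadricLines n) := {L | ∀ x ∈ L.1.space, posPart x = 0 → x = 0}

/-- Missing ℙ_+ means that ⋀² of the projection to the weight 1 part does not kill the Plücker
vector, which is an open condition on its coordinates. -/
theorem isOpen_openCell : IsOpen (openCell n) := by
  have h : openCell n = ⋃ φ : Module.Dual ℂ (⋀[ℂ]^2 (Fin n → ℂ)),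
      {L | (φ ∘ₗ exteriorPower.map 2 posPart) (plucker L.1).rep ≠ 0} := by
    ext L
    obtain ⟨u, hu, v, hv, h⟩ := L.1.exists_pair
    obtain ⟨c, hc⟩ := exists_smul_plucker_rep L.1 hu hv h
    have key : ∀ φ : Module.Dual ℂ (⋀[ℂ]^2 (Fin n → ℂ)),
        (φ ∘ₗ exteriorPower.map 2 posPart) (plucker L.1).rep =
          c * φ (wedge (posPart u) (posPart v)) := by
      intro φ
      rw [hc, Units.smul_def, map_smul, LinearMap.comp_apply, map_wedge, smul_eq_mul]
    rw [openCell, Set.mem_ofPred_eq, ← wedge_map_ne_zero_iff posPart hu hv h]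
    simp only [Set.mem_iUnion, Set.mem_ofPred_eq, key]
    constructor
    · intro hw
      obtain ⟨φ, hφ⟩ := exists_dual_ne hw
      exact ⟨φ, mul_ne_zero c.ne_zero hφ⟩
    · rintro ⟨φ, hφ⟩ h0
      simp [h0] at hφ
  rw [h]
  exact isOpen_iUnion fun φ => isOpen_dual_ne_zero IsSubvariety.quadricLines _

theorem sinkLines_subset_openCell : sinkLines n ⊆ openCell n := fun _ hL x hx h => by
  rw [eq_coordVec_of_mem_minusSpace (hL hx), h]
  exact coord_ext (by simp) (by simp) (by simp)

theorem mem_openCell_of_smul {L : quadricLines n} {t : ℂˣ} (h : t • L ∈ openCell n) :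
    L ∈ openCell n := by
  intro x hx hx0
  have := h _ (hRep_mem_smul t hx) (by rw [posPart_hRep, hx0, smul_zero])
  exact ((hRep n).apply_bijective t).1 (this.trans (map_zero _).symm)

/-- If the limit is in the sink, hence in the open cell, then so is some translate of L, and the
cell is stable under the action. Conversely, a line missing ℙ_+ either misses ℙ_- too, or meets it
in one point, or lies in it; the limit is given by stretching both basis vectors, by stretching one,
or by the constant curve. -/
theorem cellMinus_sinkLines : cellMinus (sinkLines n) = openCell n := by
  ext L
  constructor
  · rintro ⟨y, hy, γ, hγ, rfl⟩
    obtain ⟨t, ht⟩ := exists_pointP1_mem (isOpen_openCell.preimage hγ.1.continuous)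
      (sinkLines_subset_openCell hy)
    rw [Set.mem_preimage, hγ.2] at ht
    exact mem_openCell_of_smul ht
  · intro hL
    suffices ∃ γ, ExtendsOrbit L γ ∧ γ (pointP1 0 1 (by simp)) ∈ sinkLines n by
      obtain ⟨γ, hγ, h⟩ := this
      exact ⟨_, h, γ, hγ, rfl⟩
    by_cases hm : ∀ x ∈ L.1.space, negPart x = 0 → x = 0
    · obtain ⟨u, hu, v, hv, h⟩ := L.1.exists_pair
      exact exists_curve_of_wedge_ne_zero hu hv ((wedge_map_ne_zero_iff posPart hu hv h).2 hL)
        ((wedge_map_ne_zero_iff negPart hu hv h).2 hm)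
    · push Not at hm
      obtain ⟨u, hu, hu0, hu1⟩ := hm
      obtain ⟨v, hv, h⟩ := L.1.exists_wedge_ne_zero hu hu1
      have hum := mem_minusSpace_of_negPart_eq_zero hu hu0
      by_cases hv0 : negPart v = 0
      · have hLs : L ∈ sinkLines n := by
          rw [eq_quadricLine hu hv h]
          exact quadricLine_mem_sinkLines hum (mem_minusSpace_of_negPart_eq_zero hv hv0) _ _ _ _
        exact ⟨_, extendsOrbit_const IsSubvariety.quadricLines
          (hasWeightBasis_of_mem_sinkLines hLs).mem_fixedPoints, hLs⟩
      · obtain ⟨γ, hγ, h1, -⟩ := exists_curve_of_mem_minusSpace hu hv hum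
          ((wedge_map_ne_zero_iff posPart hu hv h).2 hL) hv0
        exact ⟨γ, hγ, h1⟩

/-- An open set containing a member of a polynomial family of lines meets `openCell`, as soon as
the family does. -/
theorem inter_openCell_nonempty {d m : ℕ} {u v : (Fin 2 → ℂ) → Coord n}
    (hu : IsPolyMap d u) (hv : IsPolyMap m v)
    (hqu : ∀ z, quadric n (u z) = 0) (hqv : ∀ z, quadric n (v z) = 0)
    (hquv : ∀ z, quadricPolar (u z) (v z) = 0) {a b : Fin 2 → ℂ}
    (ha : wedge (u a) (v a) ≠ 0) (hb : wedge (posPart (u b)) (posPart (v b)) ≠ 0)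
    {O : Set (quadricLines n)} (hO : IsOpen O)
    (haO : quadricLine (u a) (v a) ha (hqu a) (hqv a) (hquv a) ∈ O) :
    (O ∩ openCell n).Nonempty := by
  have hb' := wedge_ne_zero_of_map posPart hb
  obtain ⟨L, -, hL⟩ := IsSubvariety.quadricLines.exists_mem_inter (S := Set.univ)
    (isPolyMap_wedge hu hv)
    (fun z h => ⟨quadricLine _ _ h (hqu z) (hqv z) (hquv z), trivial, plucker_quadricLine _ _ _ _⟩)
    (plucker_quadricLine ha (hqu a) (hqv a) (hquv a))
    (plucker_quadricLine hb' (hqu b) (hqv b) (hquv b)) hO isOpen_openCell haO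
    ((wedge_map_ne_zero_iff posPart (LineGrassmannian.left_mem_ofPair hb')
      (LineGrassmannian.right_mem_ofPair hb') hb').1 hb)
  exact ⟨L, hL⟩

theorem dotProductEquiv_symm_dotProduct (χ : Module.Dual ℂ (Fin n → ℂ)) (w : Fin n → ℂ) :
    (dotProductEquiv ℂ (Fin n)).symm χ ⬝ᵥ w = χ w := by
  conv_rhs => rw [← (dotProductEquiv ℂ (Fin n)).apply_symm_apply χ]
  rfl

theorem exists_dotProduct_dual_pair {u v : Fin n → ℂ} (h : wedge u v ≠ 0) :
    ∃ f g : Fin n → ℂ, f ⬝ᵥ u = 1 ∧ f ⬝ᵥ v = 0 ∧ g ⬝ᵥ u = 0 ∧ g ⬝ᵥ v = 1 := by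
  obtain ⟨φ, ψ, h1, h2, h3, h4⟩ := exists_dual_pair (wedge_ne_zero_iff.1 h)
  exact ⟨_, _, (dotProductEquiv_symm_dotProduct φ u).trans h1,
    (dotProductEquiv_symm_dotProduct φ v).trans h2, (dotProductEquiv_symm_dotProduct ψ u).trans h3,
    (dotProductEquiv_symm_dotProduct ψ v).trans h4⟩

/-- With f, g dual to u, v, the line is deformed through the spans of (-z₁ g, 0, z₀ u) and (z₁ f, 0,
z₀ v). The signs make the polar form z₀z₁(f·u - g·v) vanish, and at [0 : 1] the parts of weight 1
are -g and f, which are independent. -/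
theorem inter_openCell_nonempty_of_mem_sourceLines {L : quadricLines n} (hL : L ∈ sourceLines n)
    {O : Set (quadricLines n)} (hO : IsOpen O) (hLO : L ∈ O) : (O ∩ openCell n).Nonempty := by
  obtain ⟨x, hx, y, hy, h⟩ := L.1.exists_pair
  obtain ⟨u, rfl⟩ : ∃ u, x = coordVec 0 0 u := ⟨_, eq_coordVec_of_mem_plusSpace (hL hx)⟩
  obtain ⟨v, rfl⟩ : ∃ v, y = coordVec 0 0 v := ⟨_, eq_coordVec_of_mem_plusSpace (hL hy)⟩
  have huv : wedge u v ≠ 0 := by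
    have := (wedge_map_ne_zero_iff negPart hx hy h).2 fun z hz hz0 => by
      rw [eq_coordVec_of_mem_plusSpace (hL hz), hz0]
      exact coord_ext (by simp) (by simp) (by simp)
    simpa using this
  obtain ⟨f, g, hfu, hfv, hgu, hgv⟩ := exists_dotProduct_dual_pair huv
  have hu1 : ∀ z : Fin 2 → ℂ, z = ![1, 0] → coordVec (z 1 • -g) 0 (z 0 • u) = coordVec 0 0 u := by
    rintro _ rfl
    simp
  have hv1 : ∀ z : Fin 2 → ℂ, z = ![1, 0] → coordVec (z 1 • f) 0 (z 0 • v) = coordVec 0 0 v := by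
    rintro _ rfl
    simp
  refine inter_openCell_nonempty (a := ![1, 0]) (b := ![0, 1])
    ((isPolyMap_coord_smul 1 (-g)).coordVec (isPolyMap_zero 1) (isPolyMap_coord_smul 0 u))
    ((isPolyMap_coord_smul 1 f).coordVec (isPolyMap_zero 1) (isPolyMap_coord_smul 0 v))
    (fun z => by simp [quadric_eq, hgu]) (fun z => by simp [quadric_eq, hfv])
    (fun z => by
      simp only [quadricPolar, posPart_coordVec, negPart_coordVec, midPart_coordVec,
        smul_dotProduct, dotProduct_smul, neg_dotProduct, hgv, hfu, smul_eq_mul]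
      ring) ?_ ?_ hO ?_
  · simpa only [hu1 _ rfl, hv1 _ rfl] using h
  · rw [wedge_ne_zero_iff']
    intro s t hst
    simp only [posPart_coordVec] at hst
    have h1 := congrArg (fun w => w ⬝ᵥ u) hst
    have h2 := congrArg (fun w => w ⬝ᵥ v) hst
    simp only [add_dotProduct, smul_dotProduct, neg_dotProduct, hgu, hfu, hgv, hfv,
      zero_dotProduct] at h1 h2
    exact ⟨by simpa using h2, by simpa using h1⟩
  · simp only [hu1 _ rfl, hv1 _ rfl]
    rwa [← eq_quadricLine hx hy h]

/-- The point w of ℙ_+ moves along the conic (-z₁² l, z₀z₁, z₀² w) of the quadric, where l·w = 1,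
and a second basis vector (a, c, b) of the line is corrected so as to stay isotropic and orthogonal
to it. -/
theorem inter_openCell_nonempty_of_mem_plusSpace {L : quadricLines n} {w : Fin n → ℂ}
    {x : Coord n} (hw : coordVec 0 0 w ∈ L.1.space) (hw0 : w ≠ 0) (hx : x ∈ L.1.space)
    (hx0 : posPart x ≠ 0) {O : Set (quadricLines n)} (hO : IsOpen O) (hLO : L ∈ O) :
    (O ∩ openCell n).Nonempty := by
  obtain ⟨l, hl⟩ := exists_dotProduct_eq_one hw0
  -- Subtracting a multiple of w arranges l·b = 0, so that adding a multiple of l to a does not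
  -- change a·b.
  obtain ⟨a, c, b, hy, ha, hlb⟩ : ∃ a c b, coordVec a c b ∈ L.1.space ∧ a ≠ 0 ∧ l ⬝ᵥ b = 0 := by
    refine ⟨posPart x, midPart x, negPart x - (l ⬝ᵥ negPart x) • w, ?_, hx0, ?_⟩
    · convert L.1.space.sub_mem hx (L.1.space.smul_mem (l ⬝ᵥ negPart x) hw) using 1
      exact coord_ext (by simp) (by simp) (by simp)
    · rw [dotProduct_sub, dotProduct_smul, hl, smul_eq_mul, mul_one, sub_self]
  have haw : a ⬝ᵥ w = 0 := by simpa [quadricPolar] using quadricPolar_eq_zero L.2 hw hy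
  have hq : a ⬝ᵥ b + c ^ 2 = 0 := by simpa [quadric_eq] using L.2 _ hy
  have h : wedge (coordVec 0 0 w) (coordVec a c b) ≠ 0 := by
    refine wedge_ne_zero_iff'.2 fun s t hst => ?_
    have h1 : t • a = 0 := by simpa using congrArg posPart hst
    obtain rfl := (smul_eq_zero.1 h1).resolve_right ha
    have h2 : s • w = 0 := by simpa using congrArg negPart hst
    exact ⟨(smul_eq_zero.1 h2).resolve_right hw0, rfl⟩
  have hu1 : ∀ z : Fin 2 → ℂ, z = ![1, 0] → coordVec ((z 1 * z 1) • -l) ((z 0 * z 1) • (1 : ℂ))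
      ((z 0 * z 0) • w) = coordVec 0 0 w := by
    rintro _ rfl
    simp
  -- The coefficient -2c cancels the term 2c z₀²z₁ that the middle coordinates contribute to the
  -- polar form.
  have hv1 : ∀ z : Fin 2 → ℂ, z = ![1, 0] → coordVec (z 0 • a + z 1 • (-(2 * c)) • l) (z 0 • c)
      (z 0 • b) = coordVec a c b := by
    rintro _ rfl
    simp
  refine inter_openCell_nonempty (a := ![1, 0]) (b := ![1, 1])
    ((isPolyMap_coord_mul_smul 1 1 (-l)).coordVec (isPolyMap_coord_mul_smul 0 1 (1 : ℂ))
      (isPolyMap_coord_mul_smul 0 0 w))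
    (((isPolyMap_coord_smul 0 a).add (isPolyMap_coord_smul 1 ((-(2 * c)) • l))).coordVec
      (isPolyMap_coord_smul 0 c) (isPolyMap_coord_smul 0 b))
    (fun z => ?_) (fun z => ?_) (fun z => ?_) ?_ ?_ hO ?_
  · simp only [quadric_eq, posPart_coordVec, negPart_coordVec, midPart_coordVec,
      smul_dotProduct, dotProduct_smul, neg_dotProduct, hl, smul_eq_mul]
    ring
  · simp only [quadric_eq, posPart_coordVec, negPart_coordVec, midPart_coordVec, add_dotProduct,
      smul_dotProduct, dotProduct_smul, hlb, smul_eq_mul]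
    linear_combination (z 0) ^ 2 * hq
  · simp only [quadricPolar, posPart_coordVec, negPart_coordVec, midPart_coordVec, add_dotProduct,
      smul_dotProduct, dotProduct_smul, neg_dotProduct, hlb, haw, hl, smul_eq_mul]
    ring
  · simpa only [hu1 _ rfl, hv1 _ rfl] using h
  · rw [wedge_ne_zero_iff']
    intro s t hst
    simp only [posPart_coordVec] at hst
    -- At [1 : 1] the parts of weight 1 are -l and a - 2c l. Pairing a relation with w, where a·w =
    -- 0 and l·w = 1, gives s = -2ct, and the relation reduces to t a = 0.
    have h1 := congrArg (fun y => y ⬝ᵥ w) hst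
    simp only [add_dotProduct, smul_dotProduct, neg_dotProduct, haw, hl, zero_dotProduct,
      smul_eq_mul] at h1
    simp at h1
    have h2 : t • a = 0 := by
      have : s = -(2 * c) * t := by linear_combination -h1
      rw [← hst, this]
      simp
      module
    obtain rfl := (smul_eq_zero.1 h2).resolve_right ha
    exact ⟨by simpa using h1, rfl⟩
  · simp only [hu1 _ rfl, hv1 _ rfl]
    rwa [← eq_quadricLine hw hy h]

/-- A line outside the cell lies in ℙ_+ or meets it without lying in it; each case has its own
deformation into the cell. -/
theorem dense_openCell : Dense (openCell n) := by
  refine dense_iff_inter_open.2 fun O hO ⟨L, hLO⟩ => ?_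
  by_cases hL : L ∈ openCell n
  · exact ⟨L, hLO, hL⟩
  by_cases hL' : L ∈ sourceLines n
  · exact inter_openCell_nonempty_of_mem_sourceLines hL' hO hLO
  obtain ⟨y, hy, hy0, hy1⟩ : ∃ y ∈ L.1.space, posPart y = 0 ∧ y ≠ 0 := by
    simpa [openCell] using hL
  obtain ⟨x, hx, hx0⟩ := (SetLike.not_le_iff_exists (p := L.1.space) (q := plusSpace n)).1 hL'
  obtain ⟨w, rfl⟩ : ∃ w, y = coordVec 0 0 w :=
    ⟨_, eq_coordVec_of_mem_plusSpace (mem_plusSpace_of_posPart_eq_zero hy hy0)⟩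
  refine inter_openCell_nonempty_of_mem_plusSpace hy ?_ hx
    (fun h => hx0 (mem_plusSpace_of_posPart_eq_zero hx h)) hO hLO
  rintro rfl
  exact hy1 (coord_ext (by simp) (by simp) (by simp))

theorem isSink_sinkLines (hn : 2 ≤ n) : IsSink (sinkLines n) := by
  refine ⟨?_, ?_, ?_⟩
  · rw [fixedComponents_quadricLines hn]
    simp
  · rw [cellMinus_sinkLines]
    exact isOpen_openCell
  · rw [cellMinus_sinkLines]
    exact dense_openCell

end Sink

/-! ### The involution exchanging sink and source -/

section Flip

variable {n : ℕ}

/-- The involution exchanging the coordinates of weights `1` and `-1`. -/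
def flip : Coord n →ₗ[ℂ] Coord n where
  toFun x := coordVec (negPart x) (midPart x) (posPart x)
  map_add' x y := coord_ext (by simp) (by simp) (by simp)
  map_smul' c x := coord_ext (by simp) (by simp) (by simp)

@[simp] theorem posPart_flip (x : Coord n) : posPart (flip x) = negPart x := posPart_coordVec _ _ _

@[simp] theorem midPart_flip (x : Coord n) : midPart (flip x) = midPart x := midPart_coordVec _ _ _

@[simp] theorem negPart_flip (x : Coord n) : negPart (flip x) = posPart x := negPart_coordVec _ _ _

@[simp] theorem flip_flip (x : Coord n) : flip (flip x) = x :=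
  coord_ext (by simp) (by simp) (by simp)

theorem flip_injective : Function.Injective (flip : Coord n → Coord n) :=
  Function.LeftInverse.injective flip_flip

theorem quadric_flip (x : Coord n) : quadric n (flip x) = quadric n x := by
  simp [quadric_eq, dotProduct_comm]

theorem flip_hRep (t : ℂˣ) (x : Coord n) : flip (hRep n t x) = hRep n t⁻¹ (flip x) :=
  coord_ext (by simp) (by simp) (by simp)

/-- The involution of the variety of lines. -/
def flipLine (L : quadricLines n) : quadricLines n :=
  ⟨⟨L.1.1.map flip, by
    rw [((Submodule.equivMapOfInjective _ flip_injective L.1.1).finrank_eq).symm]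
    exact L.1.2⟩, by
    rintro _ ⟨v, hv, rfl⟩
    rw [quadric_flip]
    exact L.2 v hv⟩

theorem flip_mem_flipLine {L : quadricLines n} {x : Coord n} (hx : x ∈ L.1.space) :
    flip x ∈ (flipLine L).1.space := Submodule.mem_map_of_mem hx

theorem flipLine_flipLine (L : quadricLines n) : flipLine (flipLine L) = L := by
  obtain ⟨u, hu, v, hv, h⟩ := L.1.exists_pair
  refine (Subtype.ext (LineGrassmannian.ext_of_mem h hu hv ?_ ?_)).symm
  · simpa using flip_mem_flipLine (flip_mem_flipLine hu)
  · simpa using flip_mem_flipLine (flip_mem_flipLine hv)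

theorem flipLine_smul (t : ℂˣ) (L : quadricLines n) : flipLine (t • L) = t⁻¹ • flipLine L := by
  obtain ⟨u, hu, v, hv, h⟩ := L.1.exists_pair
  have h' : wedge (flip (hRep n t u)) (flip (hRep n t v)) ≠ 0 := by
    have hb : ∀ x, (hRep n t⁻¹ ∘ₗ flip) (flip (hRep n t x)) = x := fun x =>
      coord_ext (by simp) (by simp) (by simp)
    exact wedge_ne_zero_of_map (hRep n t⁻¹ ∘ₗ flip) (by rwa [hb, hb])
  refine Subtype.ext (LineGrassmannian.ext_of_mem h'
    (flip_mem_flipLine (hRep_mem_smul t hu)) (flip_mem_flipLine (hRep_mem_smul t hv)) ?_ ?_)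
  · rw [flip_hRep]
    exact hRep_mem_smul _ (flip_mem_flipLine hu)
  · rw [flip_hRep]
    exact hRep_mem_smul _ (flip_mem_flipLine hv)

theorem isMorphism_flipLine : IsMorphism (flipLine : quadricLines n → quadricLines n) := by
  refine IsSubvariety.quadricLines.isMorphism IsSubvariety.quadricLines
    (isPolyMap_linear (exteriorPower.map 2 flip)) fun L => ?_
  obtain ⟨u, hu, v, hv, h⟩ := L.1.exists_pair
  obtain ⟨c, hc⟩ := exists_smul_plucker_rep L.1 hu hv h
  have hf : wedge (flip u) (flip v) ≠ 0 := wedge_ne_zero_of_map flip (by simpa using h)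
  have hr : exteriorPower.map 2 flip (plucker L.1).rep = c • wedge (flip u) (flip v) := by
    rw [hc, Units.smul_def, map_smul, map_wedge, Units.smul_def]
  refine ⟨by rw [hr, Units.smul_def]; exact smul_ne_zero c.ne_zero hf, ?_⟩
  rw [plucker_eq_mk _ (flip_mem_flipLine hu) (flip_mem_flipLine hv) hf,
    Projectivization.mk_eq_mk_iff]
  exact ⟨c⁻¹, by rw [hr, inv_smul_smul]⟩

theorem flip_mem_minusSpace {x : Coord n} : flip x ∈ minusSpace n ↔ x ∈ plusSpace n := by
  rw [mem_minusSpace, mem_plusSpace, midPart_flip, negPart_flip, and_comm]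

theorem flip_mem_plusSpace {x : Coord n} : flip x ∈ plusSpace n ↔ x ∈ minusSpace n := by
  rw [← flip_mem_minusSpace, flip_flip]

theorem flipLine_mem_sinkLines {L : quadricLines n} :
    flipLine L ∈ sinkLines n ↔ L ∈ sourceLines n := by
  constructor
  · exact fun h x hx => flip_mem_minusSpace.1 (h (flip_mem_flipLine hx))
  · rintro h _ ⟨x, hx, rfl⟩
    exact flip_mem_minusSpace.2 (h hx)

theorem flipLine_mem_sourceLines {L : quadricLines n} :
    flipLine L ∈ sourceLines n ↔ L ∈ sinkLines n := by
  rw [← flipLine_mem_sinkLines, flipLine_flipLine]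

theorem flipLine_mem_innerLines {L : quadricLines n} (hL : L ∈ innerLines n) :
    flipLine L ∈ innerLines n := by
  obtain ⟨x, hx, y, hy, hxm, hyp, hx0, hy0⟩ := mem_innerLines_iff.1 hL
  exact mem_innerLines_iff.2 ⟨_, flip_mem_flipLine hy, _, flip_mem_flipLine hx,
    flip_mem_minusSpace.2 hyp, flip_mem_plusSpace.2 hxm,
    fun h => hy0 (flip_injective (h.trans (map_zero _).symm)),
    fun h => hx0 (flip_injective (h.trans (map_zero _).symm))⟩

/-- The involution of X turns the action of t into that of t⁻¹, which the swap of 0 and ∞ on ℙ¹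
compensates; limits at 0 and at ∞ are thereby exchanged. -/
theorem ExtendsOrbit.flip {L : quadricLines n} {γ : ℙ ℂ (Fin 2 → ℂ) → quadricLines n}
    (h : ExtendsOrbit L γ) : ExtendsOrbit (flipLine L) (fun p => flipLine (γ (swapP1 p))) := by
  refine ⟨isMorphism_flipLine.comp (h.1.comp isMorphism_swapP1), fun t => ?_⟩
  change flipLine (γ (swapP1 _)) = _
  rw [swapP1_pointP1 _ _ _ (by simp), pointP1_inv, h.2, flipLine_smul, inv_inv]

theorem cellPlus_sourceLines : cellPlus (sourceLines n) = flipLine ⁻¹' cellMinus (sinkLines n) := by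
  ext L
  constructor
  · rintro ⟨y, hy, γ, hγ, rfl⟩
    refine ⟨_, flipLine_mem_sinkLines.2 hy, _, hγ.flip, ?_⟩
    rw [swapP1_pointP1 _ _ _ (by simp)]
  · rintro ⟨y, hy, γ, hγ, rfl⟩
    refine ⟨_, flipLine_mem_sourceLines.2 hy, _, flipLine_flipLine L ▸ hγ.flip, ?_⟩
    rw [swapP1_pointP1 _ _ _ (by simp)]

theorem isSource_sourceLines (hn : 2 ≤ n) : IsSource (sourceLines n) := by
  obtain ⟨-, ho, hd⟩ := isSink_sinkLines hn
  refine ⟨?_, ?_, ?_⟩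
  · rw [fixedComponents_quadricLines hn]
    simp
  · rw [cellPlus_sourceLines]
    exact ho.preimage isMorphism_flipLine.continuous
  · have hinv : Function.Involutive (flipLine : quadricLines n → quadricLines n) :=
      flipLine_flipLine
    rw [cellPlus_sourceLines, ← hinv.image_eq_preimage_symm]
    exact hinv.surjective.denseRange.dense_image isMorphism_flipLine.continuous hd

end Flip

/-! ### The inner component -/

section ProjTangentIso

variable {n : ℕ}

namespace ProjTangent

variable {V : Type*} [AddCommGroup V] [Module ℂ V]

/-- The hyperplane of `V` containing the line `x.pt` which defines `x`. -/
def covector (x : ProjTangent V) : ℙ ℂ (Module.Dual ℂ V) :=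
  Projectivization.map (eulerMap x.pt).dualMap
    (LinearMap.dualMap_injective_of_surjective (eulerMap_surjective x.pt)) x.hyp

theorem embed_eq (x : ProjTangent V) : x.embed = segre x.pt x.covector := rfl

theorem ext_covector {x y : ProjTangent V} (h : x.pt = y.pt) (h' : x.covector = y.covector) :
    x = y := by
  obtain ⟨p, f⟩ := x
  obtain ⟨q, g⟩ := y
  obtain rfl : p = q := h
  exact congrArg _ (Projectivization.map_injective _ _ h')

end ProjTangent

/-- Exactness of the Euler sequence in the fibre: the kernel is the line p itself. -/
theorem eulerMap_eq_zero_iff {V : Type*} [AddCommGroup V] [Module ℂ V] (p : ℙ ℂ V) (w : V) :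
    eulerMap p w = 0 ↔ w ∈ p.submodule := by
  have key : ∀ y, eulerMap p w y = lineCoord p y • p.submodule.mkQ w := fun _ => rfl
  rw [← Submodule.Quotient.mk_eq_zero, ← Submodule.mkQ_apply]
  constructor
  · intro h
    have := key ((lineCoord p).symm 1)
    rw [h, LinearEquiv.apply_symm_apply, one_smul] at this
    exact this.symm
  · intro h
    ext y
    rw [key, h, smul_zero]
    rfl

theorem ProjTangent.covector_rep_apply {V : Type*} [AddCommGroup V] [Module ℂ V]
    (x : ProjTangent V) : x.covector.rep x.pt.rep = 0 := by
  obtain ⟨p, f⟩ := x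
  induction f using Projectivization.ind with
  | h f hf =>
    obtain ⟨c, hc⟩ := Projectivization.exists_smul_eq_mk_rep ℂ ((eulerMap p).dualMap f)
      (fun h => hf (LinearMap.dualMap_injective_of_surjective (eulerMap_surjective p)
        (h.trans (map_zero _).symm)))
    have h0 : eulerMap p p.rep = 0 := by
      rw [eulerMap_eq_zero_iff, Projectivization.submodule_eq]
      exact Submodule.mem_span_singleton_self _
    rw [ProjTangent.covector, Projectivization.map_mk, ← hc, Units.smul_def, LinearMap.smul_apply,
      LinearMap.dualMap_apply, h0, map_zero, smul_zero]

/-- A form killing v kills the kernel of the Euler surjection, so it comes from a form on the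
tangent space. The points of P(T) are thus all the incident pairs in ℙ(V) × ℙ(V^∨). -/
theorem ProjTangent.exists_eq {V : Type*} [AddCommGroup V] [Module ℂ V] {v : V} (hv : v ≠ 0)
    {f : Module.Dual ℂ V} (hf : f ≠ 0) (hfv : f v = 0) : ∃ x : ProjTangent V,
      x.pt = Projectivization.mk ℂ v hv ∧ x.covector = Projectivization.mk ℂ f hf := by
  have hr : f ∈ LinearMap.range (eulerMap (Projectivization.mk ℂ v hv)).dualMap := by
    rw [LinearMap.range_dualMap_eq_dualAnnihilator_ker, Submodule.mem_dualAnnihilator]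
    intro w hw
    rw [LinearMap.mem_ker, eulerMap_eq_zero_iff, Projectivization.submodule_mk] at hw
    obtain ⟨c, rfl⟩ := Submodule.mem_span_singleton.1 hw
    rw [map_smul, hfv, smul_zero]
  obtain ⟨g, hg⟩ := hr
  have hg0 : g ≠ 0 := by
    rintro rfl
    exact hf (by rw [← hg, map_zero])
  refine ⟨⟨Projectivization.mk ℂ v hv, Projectivization.mk ℂ g hg0⟩, rfl, ?_⟩
  rw [ProjTangent.covector, Projectivization.map_mk]
  congr 1

/-- The vector dual to `x.covector`. -/
def ProjTangent.dualVec (x : ProjTangent (Fin n → ℂ)) : Fin n → ℂ :=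
  (dotProductEquiv ℂ (Fin n)).symm x.covector.rep

theorem ProjTangent.dualVec_ne_zero (x : ProjTangent (Fin n → ℂ)) : x.dualVec ≠ 0 := fun h =>
  x.covector.rep_nonzero ((LinearEquiv.map_eq_zero_iff _).1 h)

/-- The line of the quadric attached to a point and a hyperplane of the tangent space. -/
def ProjTangent.toInnerLines (x : ProjTangent (Fin n → ℂ)) : innerLines n :=
  innerLine x.pt.rep x.dualVec x.pt.rep_nonzero x.dualVec_ne_zero (by
    rw [dotProduct_comm, ProjTangent.dualVec, dotProductEquiv_symm_dotProduct,
      x.covector_rep_apply])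

theorem innerLine_eq_iff {a b a' b' : Fin n → ℂ} {ha : a ≠ 0} {hb : b ≠ 0} {hab : a ⬝ᵥ b = 0}
    {ha' : a' ≠ 0} {hb' : b' ≠ 0} {hab' : a' ⬝ᵥ b' = 0} :
    innerLine a b ha hb hab = innerLine a' b' ha' hb' hab' ↔
      (∃ c : ℂ, c • a' = a) ∧ ∃ c : ℂ, c • b' = b := by
  constructor
  · intro h
    have h1 : coordVec a 0 0 ∈ (innerLine a' b' ha' hb' hab').1.1.space := by
      rw [← h]
      exact LineGrassmannian.left_mem_ofPair (wedge_coordVec_ne_zero ha hb)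
    have h2 : coordVec 0 0 b ∈ (innerLine a' b' ha' hb' hab').1.1.space := by
      rw [← h]
      exact LineGrassmannian.right_mem_ofPair (wedge_coordVec_ne_zero ha hb)
    obtain ⟨s, t, hst⟩ := (LineGrassmannian.mem_ofPair (wedge_coordVec_ne_zero ha' hb')).1 h1
    obtain ⟨s', t', hst'⟩ := (LineGrassmannian.mem_ofPair (wedge_coordVec_ne_zero ha' hb')).1 h2
    exact ⟨⟨s, by simpa using congrArg posPart hst⟩, ⟨t', by simpa using congrArg negPart hst'⟩⟩
  · rintro ⟨⟨c, rfl⟩, ⟨d, rfl⟩⟩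
    refine Subtype.ext (Subtype.ext (LineGrassmannian.ext_of_mem (wedge_coordVec_ne_zero ha hb)
      (LineGrassmannian.left_mem_ofPair (wedge_coordVec_ne_zero ha hb))
      (LineGrassmannian.right_mem_ofPair (wedge_coordVec_ne_zero ha hb)) ?_ ?_))
    · have : coordVec (c • a') 0 0 = c • coordVec a' 0 0 :=
        coord_ext (by simp) (by simp) (by simp)
      rw [this]
      exact Submodule.smul_mem _ _
        (LineGrassmannian.left_mem_ofPair (wedge_coordVec_ne_zero ha' hb'))
    · have : coordVec 0 0 (d • b') = d • coordVec 0 0 b' :=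
        coord_ext (by simp) (by simp) (by simp)
      rw [this]
      exact Submodule.smul_mem _ _
        (LineGrassmannian.right_mem_ofPair (wedge_coordVec_ne_zero ha' hb'))

theorem ProjTangent.toInnerLines_bijective :
    Function.Bijective (ProjTangent.toInnerLines (n := n)) := by
  constructor
  · intro x y h
    obtain ⟨⟨c, hc⟩, ⟨d, hd⟩⟩ := innerLine_eq_iff.1 h
    refine ProjTangent.ext_covector ?_ ?_
    · rw [← x.pt.mk_rep, ← y.pt.mk_rep, Projectivization.mk_eq_mk_iff']
      exact ⟨c, hc⟩
    · rw [← x.covector.mk_rep, ← y.covector.mk_rep, Projectivization.mk_eq_mk_iff']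
      exact ⟨d, (dotProductEquiv ℂ (Fin n)).symm.injective (by rw [map_smul]; exact hd)⟩
  · rintro ⟨L, hL⟩
    obtain ⟨a, b, ha, hb, hab, rfl⟩ := eq_innerLine hL
    obtain ⟨x, hx, hx'⟩ := ProjTangent.exists_eq ha (f := dotProductEquiv ℂ (Fin n) b)
      (fun h => hb ((LinearEquiv.map_eq_zero_iff _).1 h)) (by
        rw [dotProduct_comm] at hab
        exact hab)
    refine ⟨x, (innerLine_eq_iff (ha' := ha) (hb' := hb) (hab' := hab)).2 ⟨?_, ?_⟩⟩
    · obtain ⟨c, hc⟩ := Projectivization.exists_smul_eq_mk_rep ℂ a ha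
      exact ⟨c, by rw [hx, ← hc, Units.smul_def]⟩
    · obtain ⟨c, hc⟩ := Projectivization.exists_smul_eq_mk_rep ℂ (dotProductEquiv ℂ (Fin n) b)
        (fun h => hb ((LinearEquiv.map_eq_zero_iff _).1 h))
      refine ⟨c, ?_⟩
      rw [ProjTangent.dualVec, hx', ← hc, Units.smul_def, map_smul, LinearEquiv.symm_apply_apply]

variable (n) in
/-- The linear map `p ⊗ h ↦ p ∧ h` from `V ⊗ V^∨` to the bivectors of `V ⊕ ℂ ⊕ V^∨`. -/
def tensorToWedge : ((Fin n → ℂ) ⊗[ℂ] Module.Dual ℂ (Fin n → ℂ)) →ₗ[ℂ] ⋀[ℂ]^2 (Coord n) :=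
  TensorProduct.lift (wedgeₗ.compl₁₂ (coordVecₗ ∘ₗ LinearMap.inl ℂ (Fin n → ℂ) (ℂ × (Fin n → ℂ)))
    (coordVecₗ ∘ₗ LinearMap.inr ℂ (Fin n → ℂ) (ℂ × (Fin n → ℂ)) ∘ₗ
      LinearMap.inr ℂ ℂ (Fin n → ℂ) ∘ₗ (dotProductEquiv ℂ (Fin n)).symm.toLinearMap))

theorem tensorToWedge_tmul (p : Fin n → ℂ) (h : Module.Dual ℂ (Fin n → ℂ)) :
    tensorToWedge n (p ⊗ₜ h) =
      wedge (coordVec p 0 0) (coordVec 0 0 ((dotProductEquiv ℂ (Fin n)).symm h)) := rfl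

variable (n) in
/-- A left inverse of `tensorToWedge`. -/
def wedgeToTensor : ⋀[ℂ]^2 (Coord n) →ₗ[ℂ] ((Fin n → ℂ) ⊗[ℂ] Module.Dual ℂ (Fin n → ℂ)) :=
  wedgeLift ((TensorProduct.mk ℂ (Fin n → ℂ) (Module.Dual ℂ (Fin n → ℂ))).compl₁₂ posPart
    ((dotProductEquiv ℂ (Fin n)).toLinearMap ∘ₗ negPart))

theorem wedgeToTensor_tensorToWedge (z : (Fin n → ℂ) ⊗[ℂ] Module.Dual ℂ (Fin n → ℂ)) :
    wedgeToTensor n (tensorToWedge n z) = z := by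
  have : wedgeToTensor n ∘ₗ tensorToWedge n = LinearMap.id := by
    refine TensorProduct.ext' fun p h => ?_
    rw [LinearMap.comp_apply, tensorToWedge_tmul, wedgeToTensor, wedgeLift_wedge]
    simp
  exact LinearMap.congr_fun this z

theorem isSubvariety_embed {V : Type*} [AddCommGroup V] [Module ℂ V] :
    IsSubvariety (ProjTangent.embed : ProjTangent V → _) := rfl

theorem isSubvariety_innerLines : IsSubvariety (fun L : innerLines n => plucker L.1.1) :=
  isSubvariety_plucker_coe_coe _ _

theorem plucker_toInnerLines (x : ProjTangent (Fin n → ℂ)) :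
    ∃ h, plucker x.toInnerLines.1.1 =
      Projectivization.mk ℂ (tensorToWedge n (x.pt.rep ⊗ₜ x.covector.rep)) h :=
  ⟨wedge_coordVec_ne_zero x.pt.rep_nonzero x.dualVec_ne_zero, plucker_innerLine _ _ _ _ _⟩

theorem exists_embed_rep (x : ProjTangent (Fin n → ℂ)) :
    ∃ c : ℂˣ, x.embed.rep = c • (x.pt.rep ⊗ₜ[ℂ] x.covector.rep) := by
  obtain ⟨c, hc⟩ := Projectivization.exists_smul_eq_mk_rep ℂ _
    (tmul_rep_ne_zero x.pt x.covector)
  exact ⟨c, hc.symm⟩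

/-- From Segre to Plücker coordinates the map is the linear map p ⊗ h ↦ p ∧ h. -/
theorem isMorphism_toInnerLines : IsMorphism (ProjTangent.toInnerLines (n := n)) := by
  refine isSubvariety_embed.isMorphism isSubvariety_innerLines
    (isPolyMap_linear (tensorToWedge n)) fun x => ?_
  obtain ⟨h, hx⟩ := plucker_toInnerLines x
  obtain ⟨c, hc⟩ := exists_embed_rep x
  have hr : tensorToWedge n x.embed.rep = c • tensorToWedge n (x.pt.rep ⊗ₜ x.covector.rep) := by
    rw [hc, Units.smul_def, map_smul, Units.smul_def]
  refine ⟨by rw [hr, Units.smul_def]; exact smul_ne_zero c.ne_zero h, ?_⟩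
  rw [hx, Projectivization.mk_eq_mk_iff]
  exact ⟨c⁻¹, by rw [hr, inv_smul_smul]⟩

/-- The inner component is the projectivised tangent bundle of `ℙ^{n-1}`. -/
theorem nonempty_innerLines_iso :
    Nonempty (VarietyIso (innerLines n) (ProjTangent (Fin n → ℂ))) := by
  let e := Equiv.ofBijective _ (ProjTangent.toInnerLines_bijective (n := n))
  refine ⟨⟨e.symm, ?_, isMorphism_toInnerLines⟩⟩
  -- The inverse is linear in the Plücker coordinates as well: it extracts the mixed component of
  -- the bivector.
  refine isSubvariety_innerLines.isMorphism isSubvariety_embed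
    (isPolyMap_linear (wedgeToTensor n)) fun L => ?_
  obtain ⟨x, rfl⟩ := e.surjective L
  rw [e.symm_apply_apply]
  obtain ⟨h, hx⟩ := plucker_toInnerLines x
  change ∃ h : wedgeToTensor n (plucker x.toInnerLines.1.1).rep ≠ 0,
    x.embed = Projectivization.mk ℂ (wedgeToTensor n (plucker x.toInnerLines.1.1).rep) h
  obtain ⟨c, hc⟩ := Projectivization.exists_smul_eq_mk_rep ℂ _ h
  have hr : wedgeToTensor n (plucker x.toInnerLines.1.1).rep =
      c • (x.pt.rep ⊗ₜ x.covector.rep) := by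
    rw [hx, ← hc, Units.smul_def, map_smul, wedgeToTensor_tensorToWedge, Units.smul_def]
  have h0 := tmul_rep_ne_zero x.pt x.covector
  refine ⟨by rw [hr, Units.smul_def]; exact smul_ne_zero c.ne_zero h0, ?_⟩
  rw [ProjTangent.embed_eq, segre, Projectivization.mk_eq_mk_iff]
  exact ⟨c⁻¹, by rw [hr, inv_smul_smul]⟩

end ProjTangentIso

/-! ### Criticality -/

section Criticality

variable {n : ℕ}

/-- A line of the quadric with limit in the sink at `∞` and in the inner component at `0`. -/
theorem exists_connecting_orbit (hn : 2 ≤ n) : ∃ (L : quadricLines n) (γ : _),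
    ExtendsOrbit L γ ∧ γ (pointP1 0 1 (by simp)) ∈ sinkLines n ∧
      γ (pointP1 1 0 (by simp)) ∈ innerLines n ∧ L ∉ MulAction.fixedPoints ℂˣ (quadricLines n) := by
  let e₀ : Fin n → ℂ := Pi.single ⟨0, by omega⟩ 1
  let e₁ : Fin n → ℂ := Pi.single ⟨1, by omega⟩ 1
  have h01 : wedge e₀ e₁ ≠ 0 := wedge_single_ne_zero (by simp)
  -- The vector (e₁, 1, -e₁) is isotropic since -e₁·e₁ + 1 = 0, and orthogonal to (e₀, 0, 0); its
  -- nonzero middle coordinate prevents the line from being fixed.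
  have h : wedge (coordVec e₀ 0 0) (coordVec e₁ 1 (-e₁)) ≠ 0 :=
    wedge_ne_zero_of_map posPart (by simpa using h01)
  let L := quadricLine (coordVec e₀ 0 0) (coordVec e₁ 1 (-e₁)) h (by simp [quadric_eq])
    (by simp [quadric_eq, e₁]) (by simp [quadricPolar, e₀, e₁])
  have hv : coordVec e₁ 1 (-e₁) ∈ L.1.space := LineGrassmannian.right_mem_ofPair h
  obtain ⟨γ, hγ, h1, h2⟩ := exists_curve_of_mem_minusSpace (L := L)
    (LineGrassmannian.left_mem_ofPair h) hv (coordVec_mem_minusSpace e₀) (by simpa using h01)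
    (by simp [e₁])
  refine ⟨L, γ, hγ, h1, h2, fun hfix => ?_⟩
  simpa using (parts_mem_of_mem_fixedPoints hfix hv).1

/-- Each component is nonempty, so a component has only one weight; on an empty set every integer
would qualify. -/
theorem weights_quadricLines (hn : 2 ≤ n) {E : Type*} [AddCommGroup E] [Module ℂ E]
    [FiniteDimensional ℂ E] (L : LinearizedEmbedding (quadricLines n) E) {i j k : ℤ}
    (hi : L.HasWeight (sinkLines n) i) (hj : L.HasWeight (innerLines n) j)
    (hk : L.HasWeight (sourceLines n) k) : L.weights = {i, j, k} := by
  obtain ⟨x, hx⟩ := (isIrreducible_sinkLines hn).1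
  obtain ⟨y, hy⟩ := (isIrreducible_innerLines hn).1
  obtain ⟨z, hz⟩ := (isIrreducible_sourceLines hn).1
  ext l
  rw [LinearizedEmbedding.weights, fixedComponents_quadricLines hn]
  simp only [Set.mem_ofPred_eq, Set.mem_insert_iff, Set.mem_singleton_iff, exists_eq_or_imp,
    exists_eq_left]
  have key : ∀ {Y : Set (quadricLines n)} {m : ℤ} {w : quadricLines n}, w ∈ Y → L.HasWeight Y m →
      (L.HasWeight Y l ↔ l = m) := fun {Y m w} hw hm =>
    ⟨fun hl => LinearizedEmbedding.WeightAt.unique (L := L) (x := w) (hl w hw) (hm w hw),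
      fun h => h ▸ hm⟩
  rw [key hx hi, key hy hj, key hz hk]

/-- The connecting orbit runs from the inner component at 0 to the sink at ∞, which gives i < j; its
image under the involution runs from the source to the inner component and gives j < k. -/
theorem hasCriticality_two (hn : 2 ≤ n) {E : Type*} [AddCommGroup E] [Module ℂ E]
    [FiniteDimensional ℂ E] (L : LinearizedEmbedding (quadricLines n) E) : L.HasCriticality 2 := by
  obtain ⟨i, hi⟩ := L.exists_hasWeight
    (fun _ h => (hasWeightBasis_of_mem_sinkLines h).mem_fixedPoints)
    (isIrreducible_sinkLines hn)
  obtain ⟨j, hj⟩ := L.exists_hasWeight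
    (fun _ h => (hasWeightBasis_of_mem_innerLines h).mem_fixedPoints)
    (isIrreducible_innerLines hn)
  obtain ⟨k, hk⟩ := L.exists_hasWeight
    (fun _ h => (hasWeightBasis_of_mem_sourceLines h).mem_fixedPoints)
    (isIrreducible_sourceLines hn)
  obtain ⟨x, γ, hγ, h1, h2, hx⟩ := exists_connecting_orbit hn
  have hij : i < j :=
    LinearizedEmbedding.weight_infty_lt_weight_zero (L := L) hγ (hj _ h2) (hi _ h1) hx
  have hjk : j < k := by
    refine LinearizedEmbedding.weight_infty_lt_weight_zero (L := L) hγ.flip (hk _ ?_) (hj _ ?_) ?_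
    · rw [swapP1_pointP1 _ _ _ (by simp)]
      exact flipLine_mem_sourceLines.2 h1
    · rw [swapP1_pointP1 _ _ _ (by simp)]
      exact flipLine_mem_innerLines h2
    · intro hfix
      refine hx fun t => ?_
      have := congrArg flipLine (hfix t⁻¹)
      rwa [flipLine_smul, flipLine_flipLine, inv_inv] at this
  refine ⟨![i, j, k], ?_, ?_⟩
  · rw [Fin.strictMono_iff_lt_succ]
    intro l
    fin_cases l
    exacts [hij, hjk]
  · rw [weights_quadricLines hn L hi hj hk]
    ext l
    simp only [Set.mem_range, Fin.exists_fin_succ, Fin.exists_fin_zero]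
    simp [eq_comm]

theorem hasBandwidth_pluckerBundle (hn : 2 ≤ n) : (pluckerBundle n).HasBandwidth 4 := by
  rw [LinearizedEmbedding.HasBandwidth, weights_quadricLines hn _ hasWeight_sinkLines
    hasWeight_innerLines hasWeight_sourceLines]
  refine ⟨-2, 2, ⟨by simp, ?_⟩, ⟨by simp, ?_⟩, by norm_num⟩
  · rintro x (rfl | rfl | rfl) <;> norm_num
  · rintro x (rfl | rfl | rfl) <;> norm_num

end Criticality

end QuadricLines

end

theorem mainTheorem10 (n : ℕ) (hn : 2 ≤ n) :
    -- the lines of `ℙ^{n-1}_-` and of `ℙ^{n-1}_+` lie on the quadric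
    (linesIn (minusSpace n) ⊆ quadricLines n ∧ linesIn (plusSpace n) ⊆ quadricLines n) ∧
    -- the fixed locus, as a disjoint union
    (MulAction.fixedPoints ℂˣ (quadricLines n) = sinkLines n ∪ innerLines n ∪ sourceLines n ∧
      Disjoint (sinkLines n) (innerLines n) ∧ Disjoint (innerLines n) (sourceLines n) ∧
      Disjoint (sinkLines n) (sourceLines n)) ∧
    -- the inner piece is the projectivised tangent bundle of `ℙ^{n-1}`
    Nonempty (VarietyIso (innerLines n) (ProjTangent (Fin n → ℂ))) ∧
    -- the three pieces are the irreducible components of the fixed locus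
    fixedComponents (quadricLines n) = {sinkLines n, innerLines n, sourceLines n} ∧
    -- the two Grassmannians are the sink and the source
    IsSink (sinkLines n) ∧ IsSource (sourceLines n) ∧
    -- the criticality is `2`, for every linearized polarization
    (∀ (E : Type*) [AddCommGroup E] [Module ℂ E] [FiniteDimensional ℂ E]
      (L : LinearizedEmbedding (quadricLines n) E), L.HasCriticality 2) ∧
    -- the weights and the bandwidth with respect to `𝒪(1)`
    ((pluckerBundle n).HasWeight (sinkLines n) (-2) ∧
      (pluckerBundle n).HasWeight (innerLines n) 0 ∧
      (pluckerBundle n).HasWeight (sourceLines n) 2 ∧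
      (pluckerBundle n).HasBandwidth 4) := by

  exact ⟨⟨linesIn_minusSpace_subset, linesIn_plusSpace_subset⟩,
    ⟨fixedPoints_quadricLines, disjoint_sinkLines_innerLines, disjoint_innerLines_sourceLines,
      disjoint_sinkLines_sourceLines⟩,
    nonempty_innerLines_iso, fixedComponents_quadricLines hn, isSink_sinkLines hn,
    isSource_sourceLines hn, fun E _ _ _ L => hasCriticality_two hn L,
    hasWeight_sinkLines, hasWeight_innerLines, hasWeight_sourceLines,
    hasBandwidth_pluckerBundle hn⟩
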